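/- Let $d\ge 1$ and let $\tilde I=[a,b]$, $a<b$, be a compact interval. For real $N$ write $C^N=C^{\lfloor N\rfloor,\,N-\lfloor N\rfloor}$ (Hölder class). For a curve $\zeta$ in $\mathbb{R}^d$ that is $C^d$ on an interval, its torsion is $\tau_\zeta(t)=|\det[\zeta'(t),\dots,\zeta^{(d)}(t)]|$; put $\Phi_\zeta(t_1,\dots,t_d)=\zeta(t_1)+\dots+\zeta(t_d)$, let $J_{\Phi_\zeta}$ be the Jacobian determinant of $\Phi_\zeta$, and let $v(t_1,\dots,t_d)=\prod_{1\le i<j\le d}(t_j-t_i)$. For $m\ge 1$ and $h\in\mathbb{R}^m$ with $h_1\le\dots\le h_m$, the offspring curve of $\gamma:\tilde I\to\mathbb{R}^d$ is $\gamma_h(t)=\frac1m\sum_{j=1}^m\gamma(t+h_j)$, and for an interval $I=[\alpha,\beta]$ put $I_h=[\alpha-h_1,\beta-h_m]$ (empty if $\alpha-h_1>\beta-h_m$); $\gamma_h$ is defined on $\tilde I_h$, and only those $h$ are considered for which $h_m-h_1<b-a$, i.e. $\tilde I_h$ has more than one point. Write $\tau=\tau_\gamma$ and $\tau_h=\tau_{\gamma_h}$.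 **Theorem.** There are constants $c,C>0$ depending only on $d$ and $\tilde I$ such that the following holds. For every $\gamma:\tilde I\to\mathbb{R}^d$ there are $k_0\in\mathbb{Z}$ and $C_\gamma\in\mathbb{R}$ with $k_0+C_\gamma>0$, depending only on $\gamma$, $d$ and $\tilde I$, such that for every real $N>d$ with $\gamma\in C^N(\tilde I;\mathbb{R}^d)$ there are a constant $C_{N,\gamma}>0$, integers $N_k\ge 0$ and compact intervals $I_{k,l}$ ($k\in\mathbb{Z}$, $k\ge k_0$, $1\le l\le N_k$) with $$\tilde I=\{t\in\tilde I:\tau(t)=0\}\cup\bigcup_{k\ge k_0}\bigcup_{l=1}^{N_k}I_{k,l},$$ such that for all $k\ge k_0$, $1\le l\le N_k$, all $m\ge1$ and all $h\in\mathbb{R}^m$ as above: 1. $c\,2^{-k}\le\tau_h(t)\le C\,2^{-k}$ for all $t\in(I_{k,l})_h$; 2. $\Phi_{\gamma_h}$ is injective on $\{(t_1,\dots,t_d): t_1<\dots<t_d,\ t_i\in(I_{k,l})_h\}$; 3. $|J_{\Phi_{\gamma_h}}(t_1,\dots,t_d)|\ge c\,2^{-k}|v(t_1,\dots,t_d)|$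 for all $(t_1,\dots,t_d)\in(I_{k,l})_h^d$; and such that for all $k\ge k_0$ $$N_k\le C_{N,\gamma}(k+C_\gamma)^d\,2^{k\sum_{j=1}^d\frac1{N-j}},\qquad \sum_{l=1}^{N_k}|I_{k,l}|\le C_{N,\gamma}(k+C_\gamma)^d .$$ -/

import Mathlib

/-- `γ ∈ C^N(S; ℝ^d)` for real `N`, in the sense `C^N = C^{⌊N⌋, N - ⌊N⌋}`: `γ` is `⌊N⌋` times
continuously differentiable on `S` and the derivative of order `⌊N⌋` is Hölder continuous on `S`
with exponent `N - ⌊N⌋` (which says nothing more on a compact interval if `N` is an integer). -/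
def IsClassCN {d : ℕ} (N : ℝ) (γ : ℝ → Fin d → ℝ) (S : Set ℝ) : Prop :=
  ContDiffOn ℝ (⌊N⌋₊ : ℕ) γ S ∧
    ∃ K : NNReal, HolderOnWith K (N - ⌊N⌋₊).toNNReal (iteratedDerivWithin ⌊N⌋₊ γ S) S

/-- The torsion `|det [ζ'(t), …, ζ^{(d)}(t)]|` of a curve `ζ` with domain the interval `S`. -/
noncomputable def torsion {d : ℕ} (ζ : ℝ → Fin d → ℝ) (S : Set ℝ) (t : ℝ) : ℝ :=
  |(Matrix.of fun i j : Fin d => iteratedDerivWithin (j + 1) ζ S t i).det|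

/-- The offspring curve `γ_h(t) = (1 / m) ∑_{j = 1}^m γ(t + h_j)`; here `h` has `m + 1` entries. -/
noncomputable def offspring {d m : ℕ} (γ : ℝ → Fin d → ℝ) (h : Fin (m + 1) → ℝ) (t : ℝ) :
    Fin d → ℝ :=
  ((m : ℝ) + 1)⁻¹ • ∑ j, γ (t + h j)

/-- `I_h = [a - h_1, b - h_m]` for `I = [a, b]`. -/
def shiftInterval {m : ℕ} (a b : ℝ) (h : Fin (m + 1) → ℝ) : Set ℝ :=
  Set.Icc (a - h 0) (b - h (Fin.last m))

/-- `Φ_ζ(t_1, …, t_d) = ζ(t_1) + ⋯ + ζ(t_d)`. -/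
def sumMap {d : ℕ} (ζ : ℝ → Fin d → ℝ) (t : Fin d → ℝ) : Fin d → ℝ :=
  ∑ i, ζ (t i)

/-- The Jacobian determinant at `t` of `Φ_ζ` on `S^d`, for a curve `ζ` with domain `S`. -/
noncomputable def jacobianSumMap {d : ℕ} (ζ : ℝ → Fin d → ℝ) (S : Set ℝ) (t : Fin d → ℝ) : ℝ :=
  (fderivWithin ℝ (sumMap ζ) (Set.univ.pi fun _ => S) t).det

/-!
Order the coordinates so that, at a given point, expanding the torsion along a largest minor at each
step shows every leading Wronskian `W_j` of `γ'` to be at least a constant multiple of the torsion.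
The function `W_j` has Hölder regularity `N - j`. On a mesh of width about `λ ^ (1 / (N - j))` it is
a polynomial up to errors smaller than `λ`, so counting zeros by Rolle's theorem gives
`O(λ ^ (-1 / (N - j)))` breakpoints such that on an interval between two of them either `W_j` is
nowhere of size `λ`, or it is everywhere, with derivatives controlled at the scale of the interval.
The dyadic sizes of the torsion and of the `W_j` have `O((k + C_γ) ^ d)` combinations at level `k`,
which yields both counts.

After a further subdivision into boundedly many pieces all `W_j` are nearly constant. By induction
on `d`, dividing by the first coordinate of `γ'` and differentiating, the determinants
`det [γ'(s_1), …, γ^{(d)}(s_d)]` at arbitrary points of a piece are then comparable to the torsion,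
with a constant sign. This property passes to offspring curves because the determinant is
multilinear. Iterated integration bounds `det [ζ'(t_1), …, ζ'(t_d)]` below by the Vandermonde
determinant. As these determinants do not vanish, a coincidence `Φ_ζ(t) = Φ_ζ(r)` is excluded by
sorting the `2d` points and summing by parts.
-/

namespace TorsionDecomp

open Set

/-! ### Jets and Rolle's theorem -/

section Jet

variable {E : Type*} [NormedAddCommGroup E] [NormedSpace ℝ E]

/-- A jet of order `n` on `I`: the functions `G 0, …, G n` are successive derivatives of each other
on `I`. It stands for `G 0` and its iterated derivatives, but is stable under linear operations
without any bookkeeping of smoothness. -/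
def IsJet (n : ℕ) (G : ℕ → ℝ → E) (I : Set ℝ) : Prop :=
  ∀ j < n, ∀ t ∈ I, HasDerivWithinAt (G j) (G (j + 1) t) I t

theorem IsJet.mono {n m : ℕ} {G : ℕ → ℝ → E} {I J : Set ℝ} (hG : IsJet n G I) (hm : m ≤ n)
    (hJ : J ⊆ I) : IsJet m G J :=
  fun j hj t ht => (hG j (hj.trans_le hm) t (hJ ht)).mono hJ

theorem IsJet.tail {n : ℕ} {G : ℕ → ℝ → E} {I : Set ℝ} (hG : IsJet n G I) :
    IsJet (n - 1) (fun j => G (j + 1)) I :=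
  fun j hj => hG (j + 1) (by omega)

theorem isJet_iteratedDerivWithin {n : ℕ} {f : ℝ → E} {I : Set ℝ} (hI : UniqueDiffOn ℝ I)
    (hf : ContDiffOn ℝ n f I) : IsJet n (fun j => iteratedDerivWithin j f I) I := by
  intro j hj t ht
  have h := hf.differentiableOn_iteratedDerivWithin (by exact_mod_cast hj) hI t ht
  simpa only [← iteratedDerivWithin_succ] using h.hasDerivWithinAt

theorem IsJet.iteratedDerivWithin_eqOn {n k : ℕ} {G : ℕ → ℝ → E} {I : Set ℝ} (hG : IsJet n G I)
    (hI : UniqueDiffOn ℝ I) (hk : k ≤ n) : EqOn (iteratedDerivWithin k (G 0) I) (G k) I := by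
  induction k with
  | zero => exact fun t _ => by rw [iteratedDerivWithin_zero]
  | succ k ih =>
    intro t ht
    rw [iteratedDerivWithin_succ, derivWithin_congr (ih (by omega)) (ih (by omega) ht)]
    exact (hG k hk t ht).derivWithin (hI t ht)

theorem iteratedDerivWithin_subset {n : ℕ} {f : ℝ → E} {I J : Set ℝ} (hJI : J ⊆ I)
    (hJ : UniqueDiffOn ℝ J) (hI : UniqueDiffOn ℝ I) (hf : ContDiffOn ℝ n f I) {t : ℝ}
    (ht : t ∈ J) : iteratedDerivWithin n f J t = iteratedDerivWithin n f I t := by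
  rw [iteratedDerivWithin, iteratedDerivWithin, iteratedFDerivWithin_subset hJI hJ hI hf ht]

end Jet

section RolleAndLagrange

variable {f f' : ℝ → ℝ} {I : Set ℝ} [I.OrdConnected] {x y : ℝ} {n : ℕ} {G : ℕ → ℝ → ℝ}

theorem exists_sub_eq_mul_sub (hf : ∀ t ∈ I, HasDerivWithinAt f (f' t) I t) (hx : x ∈ I)
    (hy : y ∈ I) : ∃ ξ ∈ I, f y - f x = f' ξ * (y - x) := by
  have hI : Convex ℝ I := convex_iff_ordConnected.2 ‹_›
  obtain ⟨ξ, hξ, h⟩ := domain_mvt (fun t ht => (hf t ht).hasFDerivWithinAt) hI hx hy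
  exact ⟨ξ, hI.segment_subset hx hy hξ, by simpa [mul_comm] using h⟩

theorem exists_deriv_eq_zero_of_eq (hf : ∀ t ∈ I, HasDerivWithinAt f (f' t) I t) (hx : x ∈ I)
    (hy : y ∈ I) (hxy : x < y) (h0 : f x = f y) : ∃ ξ ∈ Ioo x y, f' ξ = 0 := by
  have hsub : Icc x y ⊆ I := OrdConnected.out ‹_› hx hy
  exact exists_hasDerivAt_eq_zero hxy (fun t ht => ((hf t (hsub ht)).mono hsub).continuousWithinAt)
    h0 fun t ht => ((hf t (hsub (Ioo_subset_Icc_self ht))).mono hsub).hasDerivAt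
      (Icc_mem_nhds ht.1 ht.2)

theorem IsJet.exists_eq_zero_of_strictMono (hG : IsJet n G I) {z : Fin (n + 1) → ℝ}
    (hz : StrictMono z) (hzI : ∀ i, z i ∈ I) (h0 : ∀ i, G 0 (z i) = 0) : ∃ ξ ∈ I, G n ξ = 0 := by
  induction n generalizing G with
  | zero => exact ⟨z 0, hzI 0, h0 0⟩
  | succ n ih =>
    have hrolle (i : Fin (n + 1)) : ∃ ξ ∈ Ioo (z i.castSucc) (z i.succ), G 1 ξ = 0 :=
      exists_deriv_eq_zero_of_eq (hG 0 (by omega)) (hzI _) (hzI _) (hz i.castSucc_lt_succ)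
        ((h0 _).trans (h0 _).symm)
    choose w hw hw0 using hrolle
    refine ih hG.tail (Fin.strictMono_iff_lt_succ.2 fun i => ?_)
      (fun i => OrdConnected.out ‹_› (hzI _) (hzI _) (Ioo_subset_Icc_self (hw i))) hw0
    exact (hw i.castSucc).2.trans_le (by simpa using (hw i.succ).1.le)

theorem IsJet.exists_eq_zero_of_finset (hG : IsJet n G I) {Z : Finset ℝ} (hZ : n + 1 ≤ Z.card)
    (hZI : ↑Z ⊆ I) (h0 : ∀ z ∈ Z, G 0 z = 0) : ∃ ξ ∈ I, G n ξ = 0 := by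
  obtain ⟨W, hWZ, hW⟩ := Finset.exists_subset_card_eq hZ
  have hmem i : W.orderEmbOfFin hW i ∈ Z := hWZ (W.orderEmbOfFin_mem hW i)
  exact hG.exists_eq_zero_of_strictMono (W.orderEmbOfFin hW).strictMono (fun i => hZI (hmem i))
    fun i => h0 _ (hmem i)

open Polynomial in
theorem isJet_polynomial (p : ℝ[X]) (n : ℕ) (I : Set ℝ) :
    IsJet n (fun j t => (derivative^[j] p).eval t) I := by
  intro j _ t _
  simp only [Function.iterate_succ_apply']
  exact (Polynomial.hasDerivAt _ t).hasDerivWithinAt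

open Polynomial in
theorem IsJet.exists_mul_factorial_eq_prod_mul (hG : IsJet n G I) {Z : Finset ℝ} (hZ : Z.card = n)
    (hZI : ↑Z ⊆ I) (h0 : ∀ z ∈ Z, G 0 z = 0) (hx : x ∈ I) :
    ∃ ξ ∈ I, G 0 x * n.factorial = (∏ z ∈ Z, (x - z)) * G n ξ := by
  classical
  by_cases hxZ : x ∈ Z
  · exact ⟨x, hx, by rw [h0 x hxZ, Finset.prod_eq_zero hxZ (sub_self x), zero_mul, zero_mul]⟩
  have hP : ∏ z ∈ Z, (x - z) ≠ 0 :=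
    Finset.prod_ne_zero_iff.2 fun z hz => sub_ne_zero.2 fun h => hxZ (h ▸ hz)
  set p : ℝ[X] := ∏ z ∈ Z, (X - C z) with hp
  set K := G 0 x / ∏ z ∈ Z, (x - z) with hK
  have heval y : p.eval y = ∏ z ∈ Z, (y - z) := by simp [hp, eval_prod]
  have hderiv : derivative^[n] p = (n.factorial : ℝ[X]) := by
    rw [hp, iterate_derivative_prod_X_sub_C hZ.ge, hZ]
    simp
  -- `G - K p` vanishes at `x` as well as on `Z`
  have hjet : IsJet n (fun j t => G j t - K * (derivative^[j] p).eval t) I := fun j hj t ht =>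
    (hG j hj t ht).sub ((isJet_polynomial p n _ j hj t ht).const_mul K)
  obtain ⟨ξ, hξ, h⟩ := hjet.exists_eq_zero_of_finset (Z := insert x Z) (by simp [hxZ, hZ])
    (by simpa [insert_subset_iff] using ⟨hx, hZI⟩) fun z hz => by
      simp only [Function.iterate_zero, id, heval]
      rcases Finset.mem_insert.1 hz with rfl | hz
      · rw [hK, div_mul_cancel₀ _ hP, sub_self]
      · rw [h0 z hz, Finset.prod_eq_zero hz (sub_self z), mul_zero, sub_zero]
  refine ⟨ξ, hξ, ?_⟩
  rw [hderiv, eval_natCast, sub_eq_zero] at h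
  rw [h, hK]
  field_simp

end RolleAndLagrange

section HolderJet

variable {u v A H α : ℝ} {n : ℕ} {G : ℕ → ℝ → ℝ}

theorem IsJet.abs_le_of_zeros (hα : 0 ≤ α) (hG : IsJet n G (Icc u v)) (hH : 0 ≤ H)
    (hhol : ∀ x ∈ Icc u v, ∀ y ∈ Icc u v, |G n x - G n y| ≤ H * |x - y| ^ α)
    {Z : Finset ℝ} (hZ : n + 1 ≤ Z.card) (hZI : ↑Z ⊆ Icc u v) (h0 : ∀ z ∈ Z, G 0 z = 0) {x : ℝ}
    (hx : x ∈ Icc u v) : |G 0 x| ≤ H * (v - u) ^ ((n : ℝ) + α) := by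
  have huv : 0 ≤ v - u := sub_nonneg.2 (hx.1.trans hx.2)
  have hzero : ∀ j ≤ n, ∃ ξ ∈ Icc u v, G j ξ = 0 := fun j hj =>
    (hG.mono hj subset_rfl).exists_eq_zero_of_finset (by omega) hZI h0
  have hdescend : ∀ j ≤ n, ∀ x ∈ Icc u v, |G j x| ≤ H * (v - u) ^ α * (v - u) ^ (n - j) := by
    intro j hj
    induction hj using Nat.decreasingInduction with
    | self =>
      intro x hx
      obtain ⟨ξ, hξ, h⟩ := hzero n le_rfl
      calc |G n x| ≤ H * |x - ξ| ^ α := by simpa [h] using hhol x hx ξ hξ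
        _ ≤ H * (v - u) ^ α := by gcongr; exact Real.dist_le_of_mem_Icc hx hξ
        _ = _ := by simp
    | of_succ j hj ih =>
      intro x hx
      obtain ⟨ξ, hξ, h⟩ := hzero j hj.le
      obtain ⟨η, hη, hmvt⟩ := exists_sub_eq_mul_sub (hG j hj) hξ hx
      rw [h, sub_zero] at hmvt
      calc |G j x| = |G (j + 1) η| * |x - ξ| := by rw [hmvt, abs_mul]
        _ ≤ H * (v - u) ^ α * (v - u) ^ (n - (j + 1)) * (v - u) := by
          gcongr
          exacts [ih η hη, Real.dist_le_of_mem_Icc hx hξ]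
        _ = _ := by rw [show n - j = n - (j + 1) + 1 by omega, pow_succ, mul_assoc, mul_assoc]
  refine (hdescend 0 n.zero_le x hx).trans_eq ?_
  rw [Real.rpow_add_of_nonneg huv n.cast_nonneg hα, Real.rpow_natCast, Nat.sub_zero]
  ring

/-- The constant in `IsJet.exists_abs_mul_pow_le`, which comes from trisecting the interval `n`
times. -/
def trisectionConst (n : ℕ) : ℝ := (2 * 3 ^ n) ^ n

theorem monotone_trisectionConst : Monotone trisectionConst := fun m n hmn => by
  unfold trisectionConst
  have h3 : (3 : ℝ) ^ m ≤ 3 ^ n := pow_le_pow_right₀ (by norm_num) hmn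
  have h1 : (1 : ℝ) ≤ 3 ^ n := one_le_pow₀ (by norm_num)
  calc (2 * 3 ^ m : ℝ) ^ m ≤ (2 * 3 ^ n) ^ m := by gcongr
    _ ≤ (2 * 3 ^ n) ^ n := pow_le_pow_right₀ (by linarith) hmn

theorem one_le_trisectionConst (n : ℕ) : 1 ≤ trisectionConst n := by
  simpa [trisectionConst] using monotone_trisectionConst n.zero_le

theorem trisectionConst_succ_ge (n : ℕ) :
    2 * 3 ^ (n + 1) * trisectionConst n ≤ trisectionConst (n + 1) := by
  unfold trisectionConst
  rw [pow_succ' (2 * 3 ^ (n + 1) : ℝ) n]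
  gcongr <;> norm_num

theorem IsJet.exists_abs_mul_pow_le (huv : u < v) (hG : IsJet n G (Icc u v))
    (hA : ∀ x ∈ Icc u v, |G 0 x| ≤ A) :
    ∃ ξ ∈ Icc u v, |G n ξ| * (v - u) ^ n ≤ trisectionConst n * A := by
  induction n generalizing u v with
  | zero =>
    have hu := left_mem_Icc.2 huv.le
    exact ⟨u, hu, by simpa [trisectionConst] using hA u hu⟩
  | succ n ih =>
    set w := v - u
    have hw0 : 0 < w := sub_pos.2 huv
    have hA0 : 0 ≤ A := (abs_nonneg _).trans (hA u (left_mem_Icc.2 huv.le))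
    have hleft : Icc u (u + w / 3) ⊆ Icc u v := Icc_subset_Icc_right (by linarith)
    have hright : Icc (v - w / 3) v ⊆ Icc u v := Icc_subset_Icc_left (by linarith)
    obtain ⟨x, hx, hGx⟩ := ih (by linarith) (hG.mono n.le_succ hleft) fun x hx => hA x (hleft hx)
    obtain ⟨y, hy, hGy⟩ := ih (by linarith) (hG.mono n.le_succ hright) fun y hy => hA y (hright hy)
    obtain ⟨ξ, hξ, hmvt⟩ := exists_sub_eq_mul_sub (hG n n.lt_succ_self) (hleft hx) (hright hy)
    rw [add_sub_cancel_left] at hGx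
    rw [sub_sub_cancel] at hGy
    have hxy : w / 3 ≤ y - x := by linarith [hx.2, hy.1]
    have hdiff : |G n y - G n x| * (w / 3) ^ n ≤ 2 * trisectionConst n * A := by
      calc _ ≤ (|G n y| + |G n x|) * (w / 3) ^ n := by gcongr; exact abs_sub _ _
        _ ≤ _ := by linarith
    refine ⟨ξ, hξ, ?_⟩
    calc |G (n + 1) ξ| * w ^ (n + 1)
        = 3 ^ (n + 1) * (|G (n + 1) ξ| * (w / 3) * (w / 3) ^ n) := by
          rw [div_pow, pow_succ, pow_succ]; field_simp
      _ ≤ 3 ^ (n + 1) * (|G n y - G n x| * (w / 3) ^ n) := by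
          rw [hmvt, abs_mul, abs_of_nonneg (by linarith : 0 ≤ y - x)]; gcongr
      _ ≤ 3 ^ (n + 1) * (2 * trisectionConst n * A) := by gcongr
      _ = 2 * 3 ^ (n + 1) * trisectionConst n * A := by ring
      _ ≤ trisectionConst (n + 1) * A := by gcongr; exact trisectionConst_succ_ge n

/-- The constant in `IsJet.abs_mul_pow_le`. -/
def interpolationConst (n : ℕ) : ℝ := (n + 2) * trisectionConst n

theorem IsJet.abs_mul_pow_le (huv : u < v) (hα : 0 ≤ α) (hH : 0 ≤ H) (hG : IsJet n G (Icc u v))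
    (hA : ∀ x ∈ Icc u v, |G 0 x| ≤ A)
    (hhol : ∀ x ∈ Icc u v, ∀ y ∈ Icc u v, |G n x - G n y| ≤ H * |x - y| ^ α)
    (hHA : H * (v - u) ^ ((n : ℝ) + α) ≤ A) :
    ∀ i ≤ n, ∀ x ∈ Icc u v, |G i x| * (v - u) ^ i ≤ interpolationConst n * A := by
  set w := v - u
  set M := trisectionConst n
  have hw0 : 0 < w := sub_pos.2 huv
  have hA0 : 0 ≤ A := (abs_nonneg _).trans (hA u (left_mem_Icc.2 huv.le))
  have hAM : A ≤ M * A := le_mul_of_one_le_left hA0 (one_le_trisectionConst n)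
  have hpoint : ∀ i ≤ n, ∃ ξ ∈ Icc u v, |G i ξ| * w ^ i ≤ M * A := by
    intro i hi
    obtain ⟨ξ, hξ, h⟩ := (hG.mono hi subset_rfl).exists_abs_mul_pow_le huv hA
    exact ⟨ξ, hξ, h.trans (by gcongr; exact monotone_trisectionConst hi)⟩
  have hdescend : ∀ i ≤ n, ∀ x ∈ Icc u v, |G i x| * w ^ i ≤ (n - i + 2) * (M * A) := by
    intro i hi
    induction hi using Nat.decreasingInduction with
    | self =>
      intro x hx
      obtain ⟨ξ, hξ, h⟩ := hpoint n le_rfl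
      have hosc : |G n x - G n ξ| * w ^ n ≤ A := by
        calc _ ≤ H * w ^ α * w ^ n := by
              gcongr; exact (hhol x hx ξ hξ).trans (by gcongr; exact Real.dist_le_of_mem_Icc hx hξ)
          _ = H * w ^ ((n : ℝ) + α) := by rw [Real.rpow_add hw0, Real.rpow_natCast]; ring
          _ ≤ A := hHA
      calc |G n x| * w ^ n ≤ (|G n x - G n ξ| + |G n ξ|) * w ^ n := by
            gcongr; linarith [abs_sub_abs_le_abs_sub (G n x) (G n ξ)]
        _ ≤ _ := by linarith
    | of_succ i hi ih =>
      intro x hx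
      obtain ⟨ξ, hξ, h⟩ := hpoint i hi.le
      obtain ⟨η, hη, hmvt⟩ := exists_sub_eq_mul_sub (hG i hi) hξ hx
      have hη' := ih η hη
      push_cast at hη'
      calc |G i x| * w ^ i ≤ (|G (i + 1) η| * w + |G i ξ|) * w ^ i := by
            gcongr
            calc |G i x| ≤ |G i x - G i ξ| + |G i ξ| := by
                  linarith [abs_sub_abs_le_abs_sub (G i x) (G i ξ)]
              _ ≤ _ := by rw [hmvt, abs_mul]; gcongr; exact Real.dist_le_of_mem_Icc hx hξ
        _ = |G (i + 1) η| * w ^ (i + 1) + |G i ξ| * w ^ i := by ring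
        _ ≤ _ := by linarith
  intro i hi x hx
  calc |G i x| * w ^ i ≤ (n - i + 2) * (M * A) := hdescend i hi x hx
    _ ≤ (n + 2) * (M * A) := by
        gcongr
        exacts [hA0.trans hAM, by simp]
    _ = interpolationConst n * A := by rw [interpolationConst, mul_assoc]

end HolderJet

/-! ### Slowly varying functions -/

section SlowOn

/-- `f` varies slowly on `I` at the length scale `w`: it has no zero there and its derivatives up to
order `n`, normalised by powers of `w`, are at most `ε |f|`. -/
structure SlowOn (n : ℕ) (ε w : ℝ) (I : Set ℝ) (f : ℝ → ℝ) : Prop where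
  contDiffOn : ContDiffOn ℝ n f I
  ne_zero : ∀ t ∈ I, f t ≠ 0
  bound : ∀ i, 1 ≤ i → i ≤ n → ∀ t ∈ I, |iteratedDerivWithin i f I t| * w ^ i ≤ ε * |f t|

variable {n m : ℕ} {ε ε' w : ℝ} {I : Set ℝ} {f g : ℝ → ℝ}

theorem SlowOn.mono (hf : SlowOn n ε w I f) (he : ε ≤ ε') : SlowOn n ε' w I f :=
  ⟨hf.contDiffOn, hf.ne_zero, fun i h1 hi t ht => (hf.bound i h1 hi t ht).trans (by gcongr)⟩

theorem SlowOn.of_le (hf : SlowOn n ε w I f) (hm : m ≤ n) : SlowOn m ε w I f :=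
  ⟨hf.contDiffOn.of_le (by exact_mod_cast hm), hf.ne_zero, fun i h1 hi =>
    hf.bound i h1 (hi.trans hm)⟩

theorem SlowOn.congr (hf : SlowOn n ε w I f) (hfg : EqOn g f I) : SlowOn n ε w I g where
  contDiffOn := hf.contDiffOn.congr hfg
  ne_zero t ht := by rw [hfg ht]; exact hf.ne_zero t ht
  bound i h1 hi t ht := by
    rw [iteratedDerivWithin_congr hfg ht, hfg ht]; exact hf.bound i h1 hi t ht

theorem SlowOn.bound_of_le_one (hf : SlowOn n ε w I f) (he : ε ≤ 1) {i : ℕ} (hi : i ≤ n) {t : ℝ}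
    (ht : t ∈ I) : |iteratedDerivWithin i f I t| * w ^ i ≤ |f t| := by
  rcases Nat.eq_zero_or_pos i with rfl | h1
  · simp
  · exact (hf.bound i h1 hi t ht).trans (mul_le_of_le_one_left (abs_nonneg _) he)

theorem abs_sum_choose_mul_pow_le {i : ℕ} (hi : i ≤ n) (hw : 0 ≤ w) {M : ℝ} (hM : 0 ≤ M)
    {S : Finset ℕ} (hS : S ⊆ Finset.range (i + 1)) {F G : ℕ → ℝ}
    (hFG : ∀ k ∈ S, (|F k| * w ^ k) * (|G (i - k)| * w ^ (i - k)) ≤ M) :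
    |∑ k ∈ S, (i.choose k : ℝ) * F k * G (i - k)| * w ^ i ≤ 2 ^ n * M := by
  have hterm : ∀ k ∈ S, |(i.choose k : ℝ) * F k * G (i - k)| * w ^ i ≤ i.choose k * M := by
    intro k hk
    have hki : k ≤ i := Nat.lt_succ_iff.1 (Finset.mem_range.1 (hS hk))
    calc |(i.choose k : ℝ) * F k * G (i - k)| * w ^ i
        = i.choose k * ((|F k| * w ^ k) * (|G (i - k)| * w ^ (i - k))) := by
          rw [abs_mul, abs_mul, Nat.abs_cast, ← pow_mul_pow_sub w hki]; ring
      _ ≤ i.choose k * M := by gcongr; exact hFG k hk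
  calc |∑ k ∈ S, (i.choose k : ℝ) * F k * G (i - k)| * w ^ i
      ≤ ∑ k ∈ S, |(i.choose k : ℝ) * F k * G (i - k)| * w ^ i := by
        rw [← Finset.sum_mul]; gcongr; exact Finset.abs_sum_le_sum_abs _ _
    _ ≤ ∑ k ∈ S, i.choose k * M := Finset.sum_le_sum hterm
    _ ≤ ∑ k ∈ Finset.range (i + 1), i.choose k * M :=
        Finset.sum_le_sum_of_subset_of_nonneg hS fun _ _ _ => by positivity
    _ = 2 ^ i * M := by
        rw [← Finset.sum_mul]; exact_mod_cast congrArg (fun k : ℕ => k * M) i.sum_range_choose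
    _ ≤ 2 ^ n * M := by gcongr; norm_num

theorem SlowOn.mul (hI : UniqueDiffOn ℝ I) (hw : 0 ≤ w) (he0 : 0 ≤ ε) (he : ε ≤ 1)
    (hf : SlowOn n ε w I f) (hg : SlowOn n ε w I g) : SlowOn n (2 ^ n * ε) w I (f * g) where
  contDiffOn := hf.contDiffOn.mul hg.contDiffOn
  ne_zero t ht := mul_ne_zero (hf.ne_zero t ht) (hg.ne_zero t ht)
  bound i h1 hi t ht := by
    have hin : (i : WithTop ℕ∞) ≤ n := by exact_mod_cast hi
    rw [iteratedDerivWithin_mul ht hI ((hf.contDiffOn t ht).of_le hin)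
      ((hg.contDiffOn t ht).of_le hin), mul_assoc, Pi.mul_apply, abs_mul]
    refine abs_sum_choose_mul_pow_le (F := fun k => iteratedDerivWithin k f I t)
      (G := fun k => iteratedDerivWithin k g I t) hi hw (by positivity) subset_rfl fun k hk => ?_
    have hki : k ≤ i := Nat.lt_succ_iff.1 (Finset.mem_range.1 hk)
    rcases Nat.eq_zero_or_pos k with rfl | hk0
    · calc _ ≤ |f t| * (ε * |g t|) := by
            simpa using mul_le_mul_of_nonneg_left (hg.bound i h1 hi t ht) (abs_nonneg (f t))
        _ = ε * (|f t| * |g t|) := by ring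
    · calc _ ≤ (ε * |f t|) * |g t| := mul_le_mul (hf.bound k hk0 (hki.trans hi) t ht)
            (hg.bound_of_le_one he (by omega) ht) (by positivity) (by positivity)
        _ = ε * (|f t| * |g t|) := by ring

theorem SlowOn.inv (hI : UniqueDiffOn ℝ I) (hw : 0 ≤ w) (he0 : 0 ≤ ε) (he : 2 ^ n * ε ≤ 1)
    (hf : SlowOn n ε w I f) : SlowOn n (2 ^ n * ε) w I f⁻¹ where
  contDiffOn := hf.contDiffOn.inv hf.ne_zero
  ne_zero t ht := inv_ne_zero (hf.ne_zero t ht)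
  bound i := by
    induction i using Nat.strong_induction_on with
    | _ i ih =>
    intro h1 hi t ht
    have hin : (i : WithTop ℕ∞) ≤ n := by exact_mod_cast hi
    have hprev : ∀ m < i, |iteratedDerivWithin m f⁻¹ I t| * w ^ m ≤ |f⁻¹ t| := by
      intro m hm
      rcases Nat.eq_zero_or_pos m with rfl | h0
      · simp
      · exact (ih m hm h0 (by omega) t ht).trans (mul_le_of_le_one_left (abs_nonneg _) he)
    -- the Leibniz rule for `f * f⁻¹ = 1`, solved for the term with the highest derivative of `f⁻¹`
    have hleib : f t * iteratedDerivWithin i f⁻¹ I t = -∑ k ∈ (Finset.range (i + 1)).erase 0,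
        (i.choose k : ℝ) * iteratedDerivWithin k f I t * iteratedDerivWithin (i - k) f⁻¹ I t := by
      have hone : EqOn (f * f⁻¹) (fun _ => 1) I := fun t ht => mul_inv_cancel₀ (hf.ne_zero t ht)
      have h := iteratedDerivWithin_mul ht hI ((hf.contDiffOn t ht).of_le hin)
        (((hf.contDiffOn.inv hf.ne_zero) t ht).of_le hin)
      rw [iteratedDerivWithin_congr hone ht, iteratedDerivWithin_const, if_neg (by omega),
        ← Finset.add_sum_erase _ _ (Finset.mem_range.2 i.succ_pos)] at h
      simpa using eq_neg_of_add_eq_zero_left h.symm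
    refine le_of_mul_le_mul_left ?_ (abs_pos.2 (hf.ne_zero t ht))
    calc |f t| * (|iteratedDerivWithin i f⁻¹ I t| * w ^ i)
        = |∑ k ∈ (Finset.range (i + 1)).erase 0, (i.choose k : ℝ) * iteratedDerivWithin k f I t *
            iteratedDerivWithin (i - k) f⁻¹ I t| * w ^ i := by
          rw [← mul_assoc, ← abs_mul, hleib, abs_neg]
      _ ≤ 2 ^ n * ((ε * |f t|) * |f⁻¹ t|) := by
          refine abs_sum_choose_mul_pow_le (F := fun k => iteratedDerivWithin k f I t)
            (G := fun k => iteratedDerivWithin k f⁻¹ I t) hi hw (by positivity)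
            (Finset.erase_subset _ _) fun k hk => ?_
          have hk0 : k ≠ 0 := Finset.ne_of_mem_erase hk
          have hki : k < i + 1 := Finset.mem_range.1 (Finset.mem_of_mem_erase hk)
          exact mul_le_mul (hf.bound k (by omega) (by omega) t ht) (hprev (i - k) (by omega))
            (by positivity) (by positivity)
      _ = |f t| * (2 ^ n * ε * |f⁻¹ t|) := by ring

theorem SlowOn.div_pow (hI : UniqueDiffOn ℝ I) (hw : 0 ≤ w) (he0 : 0 ≤ ε) (hf : SlowOn n ε w I f)
    (hg : SlowOn n ε w I g) (he : (4 ^ n) ^ m * ε ≤ 1) :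
    SlowOn n ((4 ^ n) ^ m * ε) w I (g / f ^ m) := by
  induction m with
  | zero => simpa using hg
  | succ m ih =>
    have h4 : (4 : ℝ) ^ n = 2 ^ n * 2 ^ n := by rw [← mul_pow]; norm_num
    have h2 : (1 : ℝ) ≤ 2 ^ n := one_le_pow₀ (by norm_num)
    have h4m : (1 : ℝ) ≤ (4 ^ n) ^ m := one_le_pow₀ (one_le_pow₀ (by norm_num))
    set δ := (4 ^ n) ^ m * ε with hδ
    have hδ0 : 0 ≤ δ := by positivity
    have hεδ : 2 ^ n * ε ≤ 2 ^ n * δ := by gcongr; exact le_mul_of_one_le_left he0 h4m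
    have hsucc : ((4 : ℝ) ^ n) ^ (m + 1) * ε = 2 ^ n * (2 ^ n * δ) := by rw [hδ, pow_succ, h4]; ring
    rw [hsucc] at he ⊢
    have h2δ : 2 ^ n * δ ≤ 1 := (le_mul_of_one_le_left (by positivity) h2).trans he
    have hδ1 : δ ≤ 1 := (le_mul_of_one_le_left hδ0 h2).trans h2δ
    have hdiv := (ih hδ1).mono (le_mul_of_one_le_left hδ0 h2)
    have hinv := (hf.inv hI hw he0 (hεδ.trans h2δ)).mono hεδ
    refine (hdiv.mul hI hw (by positivity) h2δ hinv).congr fun t _ => ?_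
    simp only [Pi.div_apply, Pi.pow_apply, Pi.mul_apply, Pi.inv_apply, pow_succ]
    rw [div_mul_eq_div_div, div_eq_mul_inv _ (f t)]

end SlowOn

section Determinant

variable {ι : Type*} [Fintype ι] [DecidableEq ι]

theorem hasDerivWithinAt_det_updateRow (M : Matrix ι ι ℝ) (b : ι) {g : ℝ → ι → ℝ} {g' : ι → ℝ}
    {I : Set ℝ} {x : ℝ} (hg : HasDerivWithinAt g g' I x) :
    HasDerivWithinAt (fun x => (M.updateRow b (g x)).det) (M.updateRow b g').det I x :=
  (LinearMap.toContinuousLinearMap (Matrix.detRowAlternating.toMultilinearMap.toLinearMap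
    M b)).hasFDerivAt.comp_hasDerivWithinAt x hg

theorem det_of_sum_rows {R κ : Type*} [CommRing R] [Fintype κ] (c : ι → κ → R)
    (X : ι → κ → ι → R) :
    (Matrix.of fun b a => ∑ i, c b i * X b i a).det =
      ∑ r : ι → κ, (∏ b, c b (r b)) * (Matrix.of fun b => X b (r b)).det := by
  classical
  have hrows : (Matrix.of fun b a => ∑ i, c b i * X b i a) = fun b => ∑ i, c b i • X b i := by
    ext b a
    simp
  rw [hrows]
  refine (Matrix.detRowAlternating.toMultilinearMap.map_sum fun b i => c b i • X b i).trans ?_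
  exact Finset.sum_congr rfl fun r _ => MultilinearMap.map_smul_univ _ _ _

variable {n : ℕ} {u v : ℝ} {Φ : ℕ → ℝ → Fin (n + 1) → ℝ}

/- Row `r b` of the matrix evaluated at `s b` in place of `s (r b)` would repeat row `r b`, so the
mean value theorem in the variable `s b` applies to a function with a zero. -/
theorem exists_abs_det_le_of_lt (hΦ : IsJet n Φ (Icc u v)) {r : Fin (n + 1) → ℕ}
    {s : Fin (n + 1) → ℝ} (hs : ∀ b, s b ∈ Icc u v) {b : Fin (n + 1)} (hb : r b < b)
    (hmin : ∀ c < b, r c = c) :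
    ∃ ξ ∈ Icc u v, |(Matrix.of fun c => Φ (r c) (s c)).det| ≤
      (v - u) * |(Matrix.of fun c => Φ (Function.update r b (r b + 1) c)
        (Function.update s b ξ c)).det| := by
  set M : Matrix (Fin (n + 1)) (Fin (n + 1)) ℝ := Matrix.of fun c => Φ (r c) (s c) with hM
  have hupdate (k : ℕ) (x : ℝ) : M.updateRow b (Φ k x) =
      Matrix.of fun c => Φ (Function.update r b k c) (Function.update s b x c) := by
    ext c a
    rcases eq_or_ne c b with rfl | hc <;> simp [*]
  let i : Fin (n + 1) := ⟨r b, hb.trans b.2⟩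
  have hib : i < b := hb
  obtain ⟨ξ, hξ, h⟩ := exists_sub_eq_mul_sub (fun t ht => hasDerivWithinAt_det_updateRow M b
    (hΦ (r b) (by omega) t ht)) (hs i) (hs b)
  have hzero : (M.updateRow b (Φ (r b) (s i))).det = 0 := by
    refine Matrix.det_zero_of_row_eq hib.ne ?_
    rw [Matrix.updateRow_self, Matrix.updateRow_ne hib.ne]
    exact congrArg (Φ · (s i)) (hmin i hib)
  have hself : M.updateRow b (Φ (r b) (s b)) = M := by
    rw [hupdate, Function.update_eq_self, Function.update_eq_self]
  refine ⟨ξ, hξ, ?_⟩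
  rw [hself, hzero, sub_zero] at h
  rw [h, hupdate, abs_mul, mul_comm]
  gcongr
  exact Real.dist_le_of_mem_Icc (hs b) (hs i)

theorem exists_abs_det_le (hΦ : IsJet n Φ (Icc u v)) {r : Fin (n + 1) → ℕ} {s : Fin (n + 1) → ℝ}
    (hr : ∀ b, r b ≤ b) (hs : ∀ b, s b ∈ Icc u v) :
    ∃ s' : Fin (n + 1) → ℝ, (∀ b, s' b ∈ Icc u v) ∧
      |(Matrix.of fun b => Φ (r b) (s b)).det| ≤
        (∏ b : Fin (n + 1), (v - u) ^ ((b : ℕ) - r b)) *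
          |(Matrix.of fun b : Fin (n + 1) => Φ b (s' b)).det| := by
  induction hK : ∑ b : Fin (n + 1), ((b : ℕ) - r b) generalizing r s with
  | zero =>
    have hrb : ∀ b, r b = b := fun b => le_antisymm (hr b)
      (Nat.sub_eq_zero_iff_le.1 (Finset.sum_eq_zero_iff.1 hK b (Finset.mem_univ b)))
    exact ⟨s, hs, by simp [hrb]⟩
  | succ K ih =>
    obtain ⟨b, hb, hmin⟩ := wellFounded_lt.has_min {b : Fin (n + 1) | r b ≠ b} <| by
      by_contra! h
      have hrb : ∀ b, r b = b := fun b => not_not.1 (eq_empty_iff_forall_notMem.1 h b)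
      simp [hrb] at hK
    have hrb : r b < b := lt_of_le_of_ne (hr b) hb
    obtain ⟨ξ, hξ, hstep⟩ := exists_abs_det_le_of_lt hΦ hs hrb fun c hc =>
      not_not.1 fun hne => hmin c hne hc
    set r' := Function.update r b (r b + 1) with hr'
    have hsum : ∑ c : Fin (n + 1), ((c : ℕ) - r' c) = K := by
      rw [← Finset.add_sum_erase _ _ (Finset.mem_univ b)] at hK ⊢
      rw [Finset.sum_congr rfl fun c hc => by rw [hr', Function.update_of_ne
        (Finset.ne_of_mem_erase hc)], hr', Function.update_self]
      omega
    have hr'le : ∀ c, r' c ≤ c := fun c => by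
      rcases eq_or_ne c b with rfl | hc
      exacts [by simpa [hr'] using hrb, by simpa [hr', hc] using hr c]
    have hs' : ∀ c, Function.update s b ξ c ∈ Icc u v := fun c => by
      rcases eq_or_ne c b with rfl | hc
      exacts [by simpa using hξ, by simpa [hc] using hs c]
    obtain ⟨s', hs', hle⟩ := ih hr'le hs' hsum
    have huv : 0 ≤ v - u := sub_nonneg.2 (hξ.1.trans hξ.2)
    refine ⟨s', hs', hstep.trans ?_⟩
    rw [Finset.prod_pow_eq_pow_sum, hsum] at hle
    rw [Finset.prod_pow_eq_pow_sum, hK, pow_succ', mul_assoc]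
    gcongr

end Determinant

/-! ### Mixed determinants and Wronskians -/

section MixedDet

/-- The determinant of the `n × n` matrix whose row `b` holds the derivatives of order `b` of
`f 0, …, f (n - 1)` at the point `s b`. -/
noncomputable def mixedDet (n : ℕ) (f : ℕ → ℝ → ℝ) (I : Set ℝ) (s : Fin n → ℝ) : ℝ :=
  (Matrix.of fun b a : Fin n => iteratedDerivWithin b (f a) I (s b)).det

/-- The Wronskian of `f 0, …, f (n - 1)`. -/
noncomputable def wronskian (n : ℕ) (f : ℕ → ℝ → ℝ) (I : Set ℝ) (t : ℝ) : ℝ :=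
  mixedDet n f I fun _ => t

/-- The coefficients of the Leibniz rule for multiplication by `p`. -/
noncomputable def leibnizCoeff (p : ℝ → ℝ) (I : Set ℝ) (t : ℝ) (b i : ℕ) : ℝ :=
  b.choose i * iteratedDerivWithin (b - i) p I t

/-- The functions whose Wronskians are those of `f`, one order higher, up to powers of `f 0`. -/
noncomputable def reduction (f : ℕ → ℝ → ℝ) (I : Set ℝ) (a : ℕ) : ℝ → ℝ :=
  derivWithin (f (a + 1) / f 0) I

variable {n : ℕ} {I : Set ℝ} {t ε w : ℝ} {p : ℝ → ℝ} {f g φ : ℕ → ℝ → ℝ}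

theorem wronskian_one (f : ℕ → ℝ → ℝ) (I : Set ℝ) : wronskian 1 f I = f 0 := by
  ext t
  simp [wronskian, mixedDet]

theorem mixedDet_congr (hfg : ∀ a < n, EqOn (f a) (g a) I) {s : Fin n → ℝ} (hs : ∀ b, s b ∈ I) :
    mixedDet n f I s = mixedDet n g I s := by
  unfold mixedDet
  congr 2
  ext b a
  exact iteratedDerivWithin_congr (hfg a a.2) (hs b)

theorem leibnizCoeff_self (p : ℝ → ℝ) (I : Set ℝ) (t : ℝ) (b : ℕ) :
    leibnizCoeff p I t b b = p t := by
  simp [leibnizCoeff]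

theorem leibnizCoeff_of_lt {b i : ℕ} (h : b < i) : leibnizCoeff p I t b i = 0 := by
  simp [leibnizCoeff, Nat.choose_eq_zero_of_lt h]

theorem iteratedDerivWithin_mul_eq_sum (hI : UniqueDiffOn ℝ I) {q : ℝ → ℝ}
    (hq : ContDiffOn ℝ n q I) (hp : ContDiffOn ℝ n p I) (ht : t ∈ I) (b : Fin (n + 1)) :
    iteratedDerivWithin b (q * p) I t =
      ∑ i : Fin (n + 1), leibnizCoeff p I t b i * iteratedDerivWithin i q I t := by
  have hb : ((b : ℕ) : WithTop ℕ∞) ≤ n := by exact_mod_cast b.is_le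
  rw [iteratedDerivWithin_mul ht hI ((hq t ht).of_le hb) ((hp t ht).of_le hb),
    Fin.sum_univ_eq_sum_range fun i => leibnizCoeff p I t b i * iteratedDerivWithin i q I t]
  rw [← Finset.sum_subset (Finset.range_subset_range.2 b.2) fun i _ hi => by
    rw [leibnizCoeff_of_lt (by simpa using hi), zero_mul]]
  exact Finset.sum_congr rfl fun i _ => by rw [leibnizCoeff]; ring

theorem wronskian_mul (hI : UniqueDiffOn ℝ I) (hφ : ∀ a ≤ n, ContDiffOn ℝ n (φ a) I)
    (hp : ContDiffOn ℝ n p I) (ht : t ∈ I) :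
    wronskian (n + 1) (fun a => φ a * p) I t = p t ^ (n + 1) * wronskian (n + 1) φ I t := by
  set T : Matrix (Fin (n + 1)) (Fin (n + 1)) ℝ := Matrix.of fun b i => leibnizCoeff p I t b i
  have hmul : (Matrix.of fun b a : Fin (n + 1) => iteratedDerivWithin b (φ a * p) I t) =
      T * Matrix.of fun i a : Fin (n + 1) => iteratedDerivWithin i (φ a) I t := by
    ext b a
    rw [Matrix.mul_apply]
    exact iteratedDerivWithin_mul_eq_sum hI (hφ a a.is_le) hp ht b
  have hdet : T.det = p t ^ (n + 1) := by
    rw [Matrix.det_of_isLowerTriangular T fun b i hbi => leibnizCoeff_of_lt hbi]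
    simp [T, leibnizCoeff_self]
  rw [wronskian, mixedDet, hmul, Matrix.det_mul, hdet]
  rfl

theorem mixedDet_div_succ (h0 : ∀ t ∈ I, f 0 t ≠ 0) {s : Fin (n + 1) → ℝ} (hs : ∀ b, s b ∈ I) :
    mixedDet (n + 1) (fun a => f a / f 0) I s = mixedDet n (reduction f I) I (Fin.tail s) := by
  have hone : EqOn (f 0 / f 0) (fun _ => 1) I := fun t ht => div_self (h0 t ht)
  have hcol (b : Fin n) : iteratedDerivWithin (b + 1) (f 0 / f 0) I (s b.succ) = 0 := by
    rw [iteratedDerivWithin_congr hone (hs _), iteratedDerivWithin_const, if_neg (by simp)]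
  have hdiag : (f 0 / f 0) (s 0) = 1 := hone (hs 0)
  rw [mixedDet, Matrix.det_succ_column_zero, Fin.sum_univ_succ]
  simp only [Matrix.of_apply, Fin.val_zero, Fin.val_succ, hcol, mul_zero, zero_mul,
    Finset.sum_const_zero, add_zero, pow_zero, iteratedDerivWithin_zero, hdiag, one_mul]
  rw [mixedDet]
  congr 1
  ext b a
  simp [iteratedDerivWithin_succ', reduction, Fin.tail]

theorem wronskian_succ (hI : UniqueDiffOn ℝ I) (hf : ∀ a ≤ n, ContDiffOn ℝ n (f a) I)
    (h0 : ∀ t ∈ I, f 0 t ≠ 0) (ht : t ∈ I) :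
    wronskian (n + 1) f I t = f 0 t ^ (n + 1) * wronskian n (reduction f I) I t := by
  have hdiv : ∀ a ≤ n, ContDiffOn ℝ n (f a / f 0) I := fun a ha => (hf a ha).div (hf 0 n.zero_le) h0
  calc wronskian (n + 1) f I t = wronskian (n + 1) (fun a => f a / f 0 * f 0) I t :=
        mixedDet_congr (fun a _ x hx => (div_mul_cancel₀ _ (h0 x hx)).symm) fun _ => ht
    _ = f 0 t ^ (n + 1) * wronskian n (reduction f I) I t := by
        rw [wronskian_mul hI hdiv (hf 0 n.zero_le) ht]
        exact congrArg _ (mixedDet_div_succ h0 fun _ => ht)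

theorem abs_leibnizCoeff_mul_le (he0 : 0 ≤ ε) (hp : SlowOn n ε w I p) (ht : t ∈ I) {b i : ℕ}
    (hb : b ≤ n) :
    |leibnizCoeff p I t b i| * w ^ (b - i) ≤ 2 ^ n * |p t| * if i = b then 1 else ε := by
  have hchoose : (b.choose i : ℝ) ≤ 2 ^ n := by
    exact_mod_cast (b.choose_le_two_pow i).trans (Nat.pow_le_pow_right two_pos hb)
  rcases lt_trichotomy i b with h | rfl | h
  · rw [if_neg h.ne, leibnizCoeff, abs_mul, Nat.abs_cast, mul_assoc]
    calc _ ≤ (b.choose i : ℝ) * (ε * |p t|) := by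
          gcongr ?_ * ?_; exact hp.bound (b - i) (by omega) (by omega) t ht
      _ ≤ 2 ^ n * (ε * |p t|) := by gcongr
      _ = 2 ^ n * |p t| * ε := by ring
  · rw [if_pos rfl, leibnizCoeff_self, Nat.sub_self, pow_zero, mul_one, mul_one]
    exact le_mul_of_one_le_left (abs_nonneg _) (one_le_pow₀ one_le_two)
  · rw [if_neg h.ne', leibnizCoeff_of_lt h, abs_zero, zero_mul]
    positivity

theorem prod_abs_leibnizCoeff_mul_le (hw : 0 ≤ w) (he0 : 0 ≤ ε) (he : ε ≤ 1)
    (hp : SlowOn n ε w I p) {s : Fin (n + 1) → ℝ} (hs : ∀ b, s b ∈ I)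
    {r : Fin (n + 1) → Fin (n + 1)} (hr : r ≠ id) :
    ∏ b, (|leibnizCoeff p I (s b) b (r b)| * w ^ ((b : ℕ) - r b)) ≤
      ε * ((2 ^ n) ^ (n + 1) * |∏ b, p (s b)|) := by
  obtain ⟨b₀, hb₀⟩ : ∃ b, r b ≠ b := by
    by_contra! h
    exact hr (funext h)
  have hle (b : Fin (n + 1)) : 0 ≤ (if (r b : ℕ) = b then 1 else ε) ∧
      (if (r b : ℕ) = b then 1 else ε) ≤ 1 := by
    split_ifs <;> simp [*]
  have hε : ∏ b, (if (r b : ℕ) = b then 1 else ε) ≤ ε := by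
    rw [← Finset.mul_prod_erase _ _ (Finset.mem_univ b₀), if_neg (Fin.val_ne_of_ne hb₀)]
    exact mul_le_of_le_one_right he0
      (Finset.prod_le_one (fun b _ => (hle b).1) fun b _ => (hle b).2)
  calc ∏ b, (|leibnizCoeff p I (s b) b (r b)| * w ^ ((b : ℕ) - r b))
      ≤ ∏ b, (2 ^ n * |p (s b)| * if (r b : ℕ) = b then 1 else ε) :=
        Finset.prod_le_prod (fun b _ => by positivity) fun b _ =>
          abs_leibnizCoeff_mul_le he0 hp (hs b) b.is_le
    _ = (2 ^ n) ^ (n + 1) * |∏ b, p (s b)| * ∏ b, (if (r b : ℕ) = b then 1 else ε) := by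
        rw [Finset.prod_mul_distrib, Finset.prod_mul_distrib, Finset.abs_prod, Finset.prod_const,
          Finset.card_univ, Fintype.card_fin]
    _ ≤ (2 ^ n) ^ (n + 1) * |∏ b, p (s b)| * ε := by gcongr
    _ = ε * ((2 ^ n) ^ (n + 1) * |∏ b, p (s b)|) := mul_comm _ _

/-- The constant in `abs_mixedDet_mul_sub_le`: the number of terms in the expansion of the
determinant, times the bound for the binomial coefficients in each of them. -/
def perturbationConst (n : ℕ) : ℝ := (n + 1) ^ (n + 1) * (2 ^ n) ^ (n + 1)

variable {u v A : ℝ}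

theorem abs_prod_leibnizCoeff_mul_det_le (huv : u < v) (he0 : 0 ≤ ε) (he : ε ≤ 1)
    (hp : SlowOn n ε (v - u) (Icc u v) p) (hφ : ∀ a ≤ n, ContDiffOn ℝ n (φ a) (Icc u v))
    (hA : ∀ s : Fin (n + 1) → ℝ, (∀ b, s b ∈ Icc u v) → |mixedDet (n + 1) φ (Icc u v) s| ≤ A)
    {s : Fin (n + 1) → ℝ} (hs : ∀ b, s b ∈ Icc u v) {r : Fin (n + 1) → Fin (n + 1)} (hr : r ≠ id) :
    |(∏ b, leibnizCoeff p (Icc u v) (s b) b (r b)) *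
        (Matrix.of fun b a : Fin (n + 1) => iteratedDerivWithin (r b) (φ a) (Icc u v) (s b)).det| ≤
      ε * ((2 ^ n) ^ (n + 1) * |∏ b, p (s b)| * A) := by
  have hA0 : 0 ≤ A := (abs_nonneg _).trans (hA s hs)
  have hw : 0 ≤ v - u := (sub_pos.2 huv).le
  by_cases hle : ∀ b, r b ≤ b
  · have hΦ : IsJet n (fun i t (a : Fin (n + 1)) => iteratedDerivWithin i (φ a) (Icc u v) t)
        (Icc u v) := fun j hj t ht => hasDerivWithinAt_pi.2 fun a =>
      isJet_iteratedDerivWithin (uniqueDiffOn_Icc huv) (hφ a a.is_le) j hj t ht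
    obtain ⟨s', hs', hdet⟩ := exists_abs_det_le hΦ (r := fun b => r b) hle hs
    have hdet' := hdet.trans (mul_le_mul_of_nonneg_left (hA s' hs')
      (Finset.prod_nonneg fun b _ => by positivity))
    calc _ ≤ (∏ b, |leibnizCoeff p (Icc u v) (s b) b (r b)|) *
          ((∏ b : Fin (n + 1), (v - u) ^ ((b : ℕ) - r b)) * A) := by
          rw [abs_mul, Finset.abs_prod]
          exact mul_le_mul_of_nonneg_left hdet' (Finset.prod_nonneg fun _ _ => abs_nonneg _)
      _ = (∏ b : Fin (n + 1),
            (|leibnizCoeff p (Icc u v) (s b) b (r b)| * (v - u) ^ ((b : ℕ) - r b))) * A := by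
          rw [Finset.prod_mul_distrib, mul_assoc]
      _ ≤ ε * ((2 ^ n) ^ (n + 1) * |∏ b, p (s b)|) * A :=
          mul_le_mul_of_nonneg_right (prod_abs_leibnizCoeff_mul_le hw he0 he hp hs hr) hA0
      _ = ε * ((2 ^ n) ^ (n + 1) * |∏ b, p (s b)| * A) := by ring
  · obtain ⟨b, hb⟩ := not_forall.1 hle
    rw [Finset.prod_eq_zero (Finset.mem_univ b) (leibnizCoeff_of_lt (not_le.1 hb)), zero_mul,
      abs_zero]
    positivity

theorem abs_mixedDet_mul_sub_le (huv : u < v) (he0 : 0 ≤ ε) (he : ε ≤ 1)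
    (hp : SlowOn n ε (v - u) (Icc u v) p) (hφ : ∀ a ≤ n, ContDiffOn ℝ n (φ a) (Icc u v))
    (hA : ∀ s : Fin (n + 1) → ℝ, (∀ b, s b ∈ Icc u v) → |mixedDet (n + 1) φ (Icc u v) s| ≤ A)
    {s : Fin (n + 1) → ℝ} (hs : ∀ b, s b ∈ Icc u v) :
    |mixedDet (n + 1) (fun a => φ a * p) (Icc u v) s -
        (∏ b, p (s b)) * mixedDet (n + 1) φ (Icc u v) s| ≤
      ε * (perturbationConst n * |∏ b, p (s b)| * A) := by
  classical
  have hA0 : 0 ≤ A := (abs_nonneg _).trans (hA s hs)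
  set term : (Fin (n + 1) → Fin (n + 1)) → ℝ := fun r =>
    (∏ b, leibnizCoeff p (Icc u v) (s b) b (r b)) *
      (Matrix.of fun b a : Fin (n + 1) => iteratedDerivWithin (r b) (φ a) (Icc u v) (s b)).det
  have hexpand : mixedDet (n + 1) (fun a => φ a * p) (Icc u v) s = ∑ r, term r := by
    rw [← det_of_sum_rows (fun b i : Fin (n + 1) => leibnizCoeff p (Icc u v) (s b) b i)
      fun b i a => iteratedDerivWithin i (φ a) (Icc u v) (s b), mixedDet]
    congr 2
    ext b a
    exact iteratedDerivWithin_mul_eq_sum (uniqueDiffOn_Icc huv) (hφ a a.is_le) hp.contDiffOn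
      (hs b) b
  have hid : term id = (∏ b, p (s b)) * mixedDet (n + 1) φ (Icc u v) s := by
    simp only [term, id, leibnizCoeff_self, mixedDet]
  rw [hexpand, ← Finset.add_sum_erase _ _ (Finset.mem_univ id), hid, add_sub_cancel_left]
  set M := ε * ((2 ^ n) ^ (n + 1) * |∏ b, p (s b)| * A)
  calc _ ≤ ∑ r ∈ Finset.univ.erase id, |term r| := Finset.abs_sum_le_sum_abs _ _
    _ ≤ ∑ _r ∈ Finset.univ.erase (id : Fin (n + 1) → Fin (n + 1)), M :=
        Finset.sum_le_sum fun r hr =>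
          abs_prod_leibnizCoeff_mul_det_le huv he0 he hp hφ hA hs (Finset.ne_of_mem_erase hr)
    _ ≤ ∑ _r : Fin (n + 1) → Fin (n + 1), M :=
        Finset.sum_le_sum_of_subset_of_nonneg (Finset.erase_subset _ _) fun _ _ _ => by positivity
    _ = ε * (perturbationConst n * |∏ b, p (s b)| * A) := by
        simp only [M, perturbationConst, Finset.sum_const, Finset.card_univ, Fintype.card_fun,
          Fintype.card_fin, nsmul_eq_mul, Nat.cast_pow, Nat.cast_add, Nat.cast_one]
        ring

end MixedDet

section MixedComparable

/-- `f` has a constant sign on `I` and any two of its values there agree up to a factor `B`. -/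
def NearlyConstOn (B : ℝ) (I : Set ℝ) (f : ℝ → ℝ) : Prop :=
  ∀ t ∈ I, ∀ t' ∈ I, 0 < f t / f t' ∧ f t / f t' ≤ B

/-- A family whose leading Wronskians are nearly constant on `I` and vary slowly there. -/
structure SlowFamily (d : ℕ) (B ε w : ℝ) (I : Set ℝ) (f : ℕ → ℝ → ℝ) : Prop where
  contDiffOn : ∀ a < d, ContDiffOn ℝ (d - 1 : ℕ) (f a) I
  nearlyConst : ∀ j, 1 ≤ j → j ≤ d → NearlyConstOn B I (wronskian j f I)
  slow : ∀ j, 1 ≤ j → j ≤ d → SlowOn (d - j) ε w I (wronskian j f I)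

/-- The mixed determinants of a slow family on an interval are comparable to its Wronskian, with
constants `c` and `C`. -/
def MixedComparable (d : ℕ) (B ε c C : ℝ) : Prop :=
  ∀ (u v : ℝ) (f : ℕ → ℝ → ℝ), u < v → SlowFamily d B ε (v - u) (Icc u v) f →
    ∀ s : Fin d → ℝ, (∀ b, s b ∈ Icc u v) → ∀ t ∈ Icc u v,
      mixedDet d f (Icc u v) s / wronskian d f (Icc u v) t ∈ Icc c C

variable {d : ℕ} {B ε ε' c C w u v t : ℝ} {I : Set ℝ} {p : ℝ → ℝ} {f : ℕ → ℝ → ℝ}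

theorem NearlyConstOn.prod_div_pow_mem (hp : NearlyConstOn B I p) {s : Fin d → ℝ}
    (hs : ∀ b, s b ∈ I) (ht : t ∈ I) : (∏ b, p (s b)) / p t ^ d ∈ Icc (B⁻¹ ^ d) (B ^ d) := by
  have hprod : (∏ b, p (s b)) / p t ^ d = ∏ b, p (s b) / p t := by
    simp [Finset.prod_div_distrib]
  have hB : 0 ≤ B := (hp t ht t ht).1.le.trans (hp t ht t ht).2
  rw [hprod, ← Fin.prod_const d, ← Fin.prod_const d]
  refine ⟨Finset.prod_le_prod (fun _ _ => inv_nonneg.2 hB) fun b _ => ?_,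
    Finset.prod_le_prod (fun b _ => (hp (s b) (hs b) t ht).1.le) fun b _ =>
      (hp (s b) (hs b) t ht).2⟩
  obtain ⟨hpos, hle⟩ := hp t ht (s b) (hs b)
  rw [← inv_div]
  exact inv_anti₀ hpos hle

theorem SlowFamily.slowOn_zero (hf : SlowFamily (d + 1) B ε w I f) : SlowOn d ε w I (f 0) := by
  simpa only [wronskian_one, add_tsub_cancel_right] using hf.slow 1 le_rfl (by omega)

theorem SlowFamily.nearlyConstOn_zero (hf : SlowFamily (d + 1) B ε w I f) :
    NearlyConstOn B I (f 0) := by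
  simpa only [wronskian_one] using hf.nearlyConst 1 le_rfl (by omega)

theorem SlowFamily.wronskian_succ_eq (hI : UniqueDiffOn ℝ I) (hf : SlowFamily (d + 1) B ε w I f)
    {j : ℕ} (hj : j ≤ d) (ht : t ∈ I) :
    wronskian (j + 1) f I t = f 0 t ^ (j + 1) * wronskian j (reduction f I) I t :=
  wronskian_succ hI (fun a ha => (hf.contDiffOn a (by omega)).of_le (by exact_mod_cast hj))
    hf.slowOn_zero.ne_zero ht

theorem SlowFamily.slowFamily_reduction (hI : UniqueDiffOn ℝ I) (hB : 1 ≤ B) (hw : 0 ≤ w)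
    (he0 : 0 ≤ ε) (he : (4 ^ d) ^ (d + 1) * ε ≤ min 1 ε') (hf : SlowFamily (d + 1) B ε w I f) :
    SlowFamily d (B ^ (d + 2)) ε' w I (reduction f I) := by
  have hW : ∀ j ≤ d, EqOn (wronskian j (reduction f I) I)
      (wronskian (j + 1) f I / f 0 ^ (j + 1)) I := fun j hj t ht => by
    rw [Pi.div_apply, hf.wronskian_succ_eq hI hj ht, Pi.pow_apply,
      mul_div_cancel_left₀ _ (pow_ne_zero _ (hf.slowOn_zero.ne_zero t ht))]
  refine ⟨fun a ha => ?_, fun j _ hj x hx y hy => ?_, fun j _ hj => ?_⟩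
  · refine ContDiffOn.derivWithin (n := (d : ℕ)) ?_ hI (by exact_mod_cast (by omega))
    exact (hf.contDiffOn (a + 1) (by omega)).div (hf.contDiffOn 0 (by omega))
      hf.slowOn_zero.ne_zero
  · obtain ⟨hpos, hle⟩ := hf.nearlyConst (j + 1) (by omega) (by omega) x hx y hy
    obtain ⟨hpos0, hle0⟩ := hf.nearlyConstOn_zero y hy x hx
    have hratio : wronskian (j + 1) f I x / f 0 x ^ (j + 1) /
        (wronskian (j + 1) f I y / f 0 y ^ (j + 1)) =
        wronskian (j + 1) f I x / wronskian (j + 1) f I y * (f 0 y / f 0 x) ^ (j + 1) := by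
      rw [div_div_div_comm, ← div_pow, div_eq_mul_inv, ← inv_pow, inv_div]
    rw [hW j hj hx, hW j hj hy, Pi.div_apply, Pi.pow_apply, Pi.div_apply, Pi.pow_apply, hratio]
    refine ⟨by positivity, ?_⟩
    calc _ ≤ B * B ^ (j + 1) := by gcongr
      _ = B ^ (j + 2) := by ring
      _ ≤ B ^ (d + 2) := pow_le_pow_right₀ hB (by omega)
  · have hle : ((4 : ℝ) ^ (d - j)) ^ (j + 1) * ε ≤ min 1 ε' := by
      refine le_trans ?_ he
      rw [← pow_mul, ← pow_mul]
      gcongr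
      exacts [by norm_num, by omega]
    have hslow : SlowOn (d - j) ε w I (wronskian (j + 1) f I) := by
      simpa only [Nat.add_sub_add_right] using hf.slow (j + 1) (by omega) (by omega)
    exact (((hf.slowOn_zero.of_le (d.sub_le j)).div_pow hI hw he0 hslow
      (hle.trans (min_le_left _ _))).mono (hle.trans (min_le_right _ _))).congr (hW j hj)

theorem SlowFamily.abs_mixedDet_div_sub_le (huv : u < v) (he0 : 0 ≤ ε) (he : ε ≤ 1)
    (hf : SlowFamily (d + 1) B ε (v - u) (Icc u v) f)
    (hC : ∀ s : Fin d → ℝ, (∀ b, s b ∈ Icc u v) →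
      |mixedDet d (reduction f (Icc u v)) (Icc u v) s /
        wronskian d (reduction f (Icc u v)) (Icc u v) t| ≤ C)
    (ht : t ∈ Icc u v) {s : Fin (d + 1) → ℝ} (hs : ∀ b, s b ∈ Icc u v) :
    |mixedDet (d + 1) f (Icc u v) s /
        ((∏ b, f 0 (s b)) * wronskian d (reduction f (Icc u v)) (Icc u v) t) -
      mixedDet d (reduction f (Icc u v)) (Icc u v) (Fin.tail s) /
        wronskian d (reduction f (Icc u v)) (Icc u v) t| ≤
      ε * (perturbationConst d * C) := by
  set I := Icc u v
  set g := reduction f I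
  have h0 := hf.slowOn_zero.ne_zero
  have hg : wronskian d g I t ≠ 0 := right_ne_zero_of_mul <|
    hf.wronskian_succ_eq (uniqueDiffOn_Icc huv) le_rfl ht ▸
      (hf.slow (d + 1) (by omega) le_rfl).ne_zero t ht
  have hP : ∏ b, f 0 (s b) ≠ 0 := Finset.prod_ne_zero_iff.2 fun b _ => h0 _ (hs b)
  have hmul : mixedDet (d + 1) f I s = mixedDet (d + 1) (fun a => f a / f 0 * f 0) I s :=
    mixedDet_congr (fun a _ x hx => (div_mul_cancel₀ _ (h0 x hx)).symm) hs
  have hA : ∀ s : Fin (d + 1) → ℝ, (∀ b, s b ∈ I) →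
      |mixedDet (d + 1) (fun a => f a / f 0) I s| ≤ C * |wronskian d g I t| := fun s hs => by
    rw [mixedDet_div_succ h0 hs, ← div_le_iff₀ (abs_pos.2 hg), ← abs_div]
    exact hC _ fun b => hs _
  have hmain := abs_mixedDet_mul_sub_le huv he0 he hf.slowOn_zero
    (fun a ha => (hf.contDiffOn a (by omega)).div (hf.contDiffOn 0 (by omega)) h0) hA hs
  rw [← hmul, mixedDet_div_succ h0 hs] at hmain
  rw [← mul_div_mul_left (mixedDet d g I _) _ hP, ← sub_div, abs_div,
    div_le_iff₀ (abs_pos.2 (mul_ne_zero hP hg)), abs_mul (∏ b, f 0 (s b))]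
  exact hmain.trans_eq (by ring)

theorem MixedComparable.succ (hB : 1 ≤ B) (hc : 0 < c) (he0 : 0 ≤ ε)
    (he : (4 ^ d) ^ (d + 1) * ε ≤ min 1 ε') (hec : ε * (perturbationConst d * C) ≤ c / 2)
    (h : MixedComparable d (B ^ (d + 2)) ε' c C) :
    MixedComparable (d + 1) B ε (c / 2 * B⁻¹ ^ (d + 1)) ((C + c / 2) * B ^ (d + 1)) := by
  intro u v f huv hf s hs t ht
  set I := Icc u v
  have hI : UniqueDiffOn ℝ I := uniqueDiffOn_Icc huv
  have he1 : ε ≤ 1 := (le_mul_of_one_le_left he0 (one_le_pow₀ (one_le_pow₀ (by norm_num)))).trans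
    (he.trans (min_le_left _ _))
  have hred := h u v _ huv (hf.slowFamily_reduction hI hB (sub_pos.2 huv).le he0 he)
  obtain ⟨hlow, hup⟩ := hred (Fin.tail s) (fun b => hs _) t ht
  obtain ⟨hPlow, hPup⟩ := hf.nearlyConstOn_zero.prod_div_pow_mem hs ht
  obtain ⟨hdiff, hdiff'⟩ := abs_le.1 <| (hf.abs_mixedDet_div_sub_le huv he0 he1 (fun s hs =>
    abs_le.2 ⟨by linarith [(hred s hs t ht).1, (hred s hs t ht).2], (hred s hs t ht).2⟩)
    ht hs).trans hec
  have hP : ∏ b, f 0 (s b) ≠ 0 :=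
    Finset.prod_ne_zero_iff.2 fun b _ => hf.slowOn_zero.ne_zero _ (hs b)
  have hsplit : mixedDet (d + 1) f I s / wronskian (d + 1) f I t =
      mixedDet (d + 1) f I s / ((∏ b, f 0 (s b)) * wronskian d (reduction f I) I t) *
        ((∏ b, f 0 (s b)) / f 0 t ^ (d + 1)) := by
    rw [hf.wronskian_succ_eq hI le_rfl ht, div_mul_div_comm, mul_comm (∏ b, f 0 (s b)),
      mul_comm (mixedDet _ _ _ _), mul_comm (_ * _) (f 0 t ^ (d + 1)), ← mul_assoc,
      mul_comm _ (∏ b, f 0 (s b)), mul_div_mul_left _ _ hP]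
  have : 0 < B := by linarith
  rw [hsplit]
  constructor
  · exact mul_le_mul (by linarith) hPlow (by positivity) (by linarith)
  · exact mul_le_mul (by linarith) hPup (le_trans (by positivity) hPlow) (by linarith)

theorem exists_mixedComparable (d : ℕ) (hB : 1 ≤ B) :
    ∃ ε c C : ℝ, 0 < ε ∧ 0 < c ∧ 0 < C ∧ MixedComparable d B ε c C := by
  induction d generalizing B with
  | zero =>
    exact ⟨1, 1, 1, one_pos, one_pos, one_pos, fun u v f _ _ s _ t _ => by
      simp [wronskian, mixedDet]⟩
  | succ d ih =>
    obtain ⟨ε', c, C, hε', hc, hC, h⟩ := ih (one_le_pow₀ hB : 1 ≤ B ^ (d + 2))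
    have hK : 0 < perturbationConst d := by unfold perturbationConst; positivity
    have : 0 < B := by linarith
    set Q : ℝ := (4 ^ d) ^ (d + 1)
    have hQ : 0 < Q := by positivity
    refine ⟨min (min 1 ε' / Q) (c / 2 / (perturbationConst d * C)), _, _, by positivity,
      by positivity, by positivity, h.succ hB hc (by positivity) ?_ ?_⟩
    · rw [← le_div_iff₀' hQ]
      exact min_le_left _ _
    · rw [← le_div_iff₀ (by positivity)]
      exact min_le_right _ _

end MixedComparable

/-! ### Hölder classes -/

/-- The class `C^{n, α}` of real functions on `I`, for an exponent `α`; the derivatives are taken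
within `I`, so at an endpoint they are one-sided. -/
def HolderClass (n : ℕ) (α : ℝ) (I : Set ℝ) (f : ℝ → ℝ) : Prop :=
  ContDiffOn ℝ n f I ∧ ∃ H : ℝ, 0 ≤ H ∧ ∀ x ∈ I, ∀ y ∈ I,
    |iteratedDerivWithin n f I x - iteratedDerivWithin n f I y| ≤ H * |x - y| ^ α

theorem le_mul_rpow {L α x : ℝ} (hα : 0 ≤ α) (hα1 : α ≤ 1) (hx0 : 0 ≤ x) (hxL : x ≤ L) :
    x ≤ (L + 1) * x ^ α := by
  rcases hx0.eq_or_lt with rfl | hx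
  · positivity
  calc x = x ^ (1 - α) * x ^ α := by rw [← Real.rpow_add hx, sub_add_cancel, Real.rpow_one]
    _ ≤ (L + 1) ^ (1 : ℝ) * x ^ α := by
        gcongr ?_ * _
        calc x ^ (1 - α) ≤ (L + 1) ^ (1 - α) := by gcongr; linarith
          _ ≤ (L + 1) ^ (1 : ℝ) := by
              gcongr
              · linarith
              · linarith
    _ = (L + 1) * x ^ α := by rw [Real.rpow_one]

theorem exists_abs_le_of_continuousOn {K : Set ℝ} {f : ℝ → ℝ} (hK : IsCompact K)
    (hf : ContinuousOn f K) : ∃ A : ℝ, 0 ≤ A ∧ ∀ x ∈ K, |f x| ≤ A := by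
  obtain ⟨A, hA⟩ := hK.exists_bound_of_continuousOn hf
  exact ⟨max A 0, le_max_right _ _, fun x hx => (hA x hx).trans (le_max_left _ _)⟩

namespace HolderClass

variable {n m : ℕ} {α a b : ℝ} {I : Set ℝ} {f g : ℝ → ℝ} {κ : Type*}

theorem succ_iff (hI : UniqueDiffOn ℝ I) :
    HolderClass (n + 1) α I f ↔
      DifferentiableOn ℝ f I ∧ HolderClass n α I (derivWithin f I) := by
  have h := contDiffOn_succ_iff_derivWithin (𝕜 := ℝ) (f := f) (n := (n : WithTop ℕ∞)) hI
  unfold HolderClass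
  rw [← iteratedDerivWithin_succ', ← and_assoc]
  refine and_congr_left fun _ => ?_
  rw [Nat.cast_succ, h]
  simp

theorem congr (hf : HolderClass n α I f) (h : EqOn g f I) : HolderClass n α I g := by
  obtain ⟨hfc, H, hH, hhol⟩ := hf
  refine ⟨hfc.congr h, H, hH, fun x hx y hy => ?_⟩
  rw [iteratedDerivWithin_congr h hx, iteratedDerivWithin_congr h hy]
  exact hhol x hx y hy

theorem const (c : ℝ) : HolderClass n α I fun _ => c :=
  ⟨contDiffOn_const, 0, le_rfl, fun x _ y _ => by simp [iteratedDerivWithin_const]⟩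

theorem add (hI : UniqueDiffOn ℝ I) (hf : HolderClass n α I f) (hg : HolderClass n α I g) :
    HolderClass n α I (f + g) := by
  obtain ⟨hfc, H, hH, hf⟩ := hf
  obtain ⟨hgc, K, hK, hg⟩ := hg
  refine ⟨hfc.add hgc, H + K, by positivity, fun x hx y hy => ?_⟩
  rw [iteratedDerivWithin_add hx hI (hfc x hx) (hgc x hx),
    iteratedDerivWithin_add hy hI (hfc y hy) (hgc y hy), add_mul, add_sub_add_comm]
  exact (abs_add_le _ _).trans (add_le_add (hf x hx y hy) (hg x hx y hy))

theorem sum (hI : UniqueDiffOn ℝ I) (s : Finset κ) {f : κ → ℝ → ℝ}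
    (hf : ∀ i ∈ s, HolderClass n α I (f i)) : HolderClass n α I fun t => ∑ i ∈ s, f i t := by
  simp only [← Finset.sum_apply]
  exact Finset.sum_induction _ _ (fun _ _ => add hI) (const 0) hf

theorem iteratedDerivWithin_of_add (hI : UniqueDiffOn ℝ I) (hf : HolderClass (n + m) α I f) :
    HolderClass n α I (iteratedDerivWithin m f I) := by
  induction m generalizing f with
  | zero => simpa using hf
  | succ m ih =>
    rw [iteratedDerivWithin_succ']
    exact ih ((succ_iff hI).1 hf).2

theorem of_succ (hα : 0 ≤ α) (hα1 : α ≤ 1) (hab : a < b)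
    (hf : HolderClass (n + 1) α (Icc a b) f) : HolderClass n α (Icc a b) f := by
  have hI := uniqueDiffOn_Icc hab
  have hc : ContDiffOn ℝ (n + 1 : ℕ) f (Icc a b) := hf.1
  obtain ⟨A, hA0, hA⟩ := exists_abs_le_of_continuousOn isCompact_Icc
    (hc.continuousOn_iteratedDerivWithin (m := n + 1) le_rfl hI)
  refine ⟨hc.of_le (mod_cast n.le_succ), A * (b - a + 1),
    mul_nonneg hA0 (by linarith), fun x hx y hy => ?_⟩
  obtain ⟨ξ, hξ, h⟩ :=
    exists_sub_eq_mul_sub (isJet_iteratedDerivWithin hI hc n n.lt_succ_self) hy hx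
  have hxy : |x - y| ≤ b - a := abs_sub_le_of_le_of_le hx.1 hx.2 hy.1 hy.2
  rw [h, abs_mul, mul_assoc]
  gcongr
  · exact hA ξ hξ
  · exact le_mul_rpow hα hα1 (abs_nonneg _) hxy

theorem of_le (hα : 0 ≤ α) (hα1 : α ≤ 1) (hab : a < b) (hf : HolderClass n α (Icc a b) f)
    (hmn : m ≤ n) : HolderClass m α (Icc a b) f := by
  induction n, hmn using Nat.le_induction with
  | base => exact hf
  | succ n _ ih => exact ih (hf.of_succ hα hα1 hab)

theorem mul_zero_order (hK : IsCompact I) (hf : HolderClass 0 α I f) (hg : HolderClass 0 α I g) :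
    HolderClass 0 α I (f * g) := by
  obtain ⟨hfc, H, hH, hf⟩ := hf
  obtain ⟨hgc, K, hK', hg⟩ := hg
  obtain ⟨A, hA0, hA⟩ := exists_abs_le_of_continuousOn hK hfc.continuousOn
  obtain ⟨B, hB0, hB⟩ := exists_abs_le_of_continuousOn hK hgc.continuousOn
  refine ⟨hfc.mul hgc, A * K + B * H, by positivity, fun x hx y hy => ?_⟩
  have hfxy := hf x hx y hy
  have hgxy := hg x hx y hy
  simp only [iteratedDerivWithin_zero, Pi.mul_apply] at hfxy hgxy ⊢
  calc |f x * g x - f y * g y| = |f x * (g x - g y) + g y * (f x - f y)| := by ring_nf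
    _ ≤ |f x| * |g x - g y| + |g y| * |f x - f y| := by
        rw [← abs_mul, ← abs_mul]; exact abs_add_le _ _
    _ ≤ A * (K * |x - y| ^ α) + B * (H * |x - y| ^ α) := by
        gcongr
        · exact hA x hx
        · exact hB y hy
    _ = (A * K + B * H) * |x - y| ^ α := by ring

theorem mul (hα : 0 ≤ α) (hα1 : α ≤ 1) (hab : a < b) (hf : HolderClass n α (Icc a b) f)
    (hg : HolderClass n α (Icc a b) g) : HolderClass n α (Icc a b) (f * g) := by
  have hI := uniqueDiffOn_Icc hab
  induction n generalizing f g with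
  | zero => exact hf.mul_zero_order isCompact_Icc hg
  | succ n ih =>
    have hf' := (succ_iff hI).1 hf
    have hg' := (succ_iff hI).1 hg
    have hsum := (ih hf'.2 (hg.of_succ hα hα1 hab)).add hI (ih (hf.of_succ hα hα1 hab) hg'.2)
    exact (succ_iff hI).2 ⟨hf'.1.mul hg'.1,
      hsum.congr fun t ht => derivWithin_mul (hf'.1 t ht) (hg'.1 t ht)⟩

theorem prod (hα : 0 ≤ α) (hα1 : α ≤ 1) (hab : a < b) (s : Finset κ) {f : κ → ℝ → ℝ}
    (hf : ∀ i ∈ s, HolderClass n α (Icc a b) (f i)) :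
    HolderClass n α (Icc a b) fun t => ∏ i ∈ s, f i t := by
  simp only [← Finset.prod_apply]
  exact Finset.prod_induction _ _ (fun _ _ => mul hα hα1 hab) (const 1) hf

theorem det (hα : 0 ≤ α) (hα1 : α ≤ 1) (hab : a < b) {M : ℝ → Matrix (Fin m) (Fin m) ℝ}
    (hM : ∀ i j, HolderClass n α (Icc a b) fun t => M t i j) :
    HolderClass n α (Icc a b) fun t => (M t).det := by
  simp only [Matrix.det_apply']
  exact sum (uniqueDiffOn_Icc hab) _ fun σ _ =>
    (const _).mul hα hα1 hab (prod hα hα1 hab _ fun i _ => hM (σ i) i)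

end HolderClass

/-! ### Level sets -/

theorem exists_abs_eq_of_lt {f : ℝ → ℝ} {u v s t c : ℝ} (hf : ContinuousOn f (Icc u v))
    (hs : s ∈ Icc u v) (ht : t ∈ Icc u v) (hsc : |f s| < c) (htc : c < |f t|) :
    ∃ x ∈ Ioo u v, |f x| = c := by
  have hsub : uIcc s t ⊆ Icc u v := uIcc_subset_Icc hs ht
  obtain ⟨x, hx, hxc : |f x| = c⟩ :=
    intermediate_value_uIcc (hf.mono hsub).abs (mem_uIcc_of_le hsc.le htc.le)
  have hxs : x ≠ s := by rintro rfl; exact hsc.ne hxc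
  have hxt : x ≠ t := by rintro rfl; exact htc.ne' hxc
  refine ⟨x, ?_, hxc⟩
  rcases le_total s t with h | h
  · rw [uIcc_of_le h] at hx
    exact ⟨hs.1.trans_lt (lt_of_le_of_ne hx.1 hxs.symm), (lt_of_le_of_ne hx.2 hxt).trans_le ht.2⟩
  · rw [uIcc_of_ge h] at hx
    exact ⟨ht.1.trans_lt (lt_of_le_of_ne hx.1 hxt.symm), (lt_of_le_of_ne hx.2 hxs).trans_le hs.2⟩

theorem abs_mem_Icc_of_avoids {f : ℝ → ℝ} {u v t p q : ℝ} (hf : ContinuousOn f (Icc u v))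
    (ht : t ∈ Icc u v) (hpt : p < |f t|) (htq : |f t| < q)
    (havoid : ∀ x ∈ Ioo u v, |f x| ≠ p ∧ |f x| ≠ q) : ∀ s ∈ Icc u v, |f s| ∈ Icc p q := by
  refine fun s hs => ⟨le_of_not_gt fun hlt => ?_, le_of_not_gt fun hlt => ?_⟩
  · obtain ⟨x, hx, h⟩ := exists_abs_eq_of_lt hf hs ht hlt hpt
    exact (havoid x hx).1 h
  · obtain ⟨x, hx, h⟩ := exists_abs_eq_of_lt hf ht hs htq hlt
    exact (havoid x hx).2 h

theorem exists_mem_Ico_succ {z : ℕ → ℝ} {m : ℕ} {t : ℝ} (h0 : z 0 ≤ t) (hm : t < z m) :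
    ∃ g < m, t ∈ Ico (z g) (z (g + 1)) := by
  induction m with
  | zero => exact absurd hm h0.not_gt
  | succ m ih =>
    rcases lt_or_ge t (z m) with h | h
    · obtain ⟨g, hg, hmem⟩ := ih h
      exact ⟨g, hg.trans m.lt_succ_self, hmem⟩
    · exact ⟨m, m.lt_succ_self, h, hm⟩

theorem exists_Icc_subset_cell {z : ℕ → ℝ} {m : ℕ} {u v : ℝ} (huv : u < v) (h0 : z 0 ≤ u)
    (hm : v ≤ z m) (havoid : ∀ i ≤ m, z i ∉ Ioo u v) :
    ∃ g < m, z g ≤ u ∧ v ≤ z (g + 1) := by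
  obtain ⟨g, hg, hgu, hug⟩ := exists_mem_Ico_succ h0 (huv.trans_le hm)
  exact ⟨g, hg, hgu, le_of_not_gt fun hgv => havoid (g + 1) hg ⟨hug, hgv⟩⟩

section Breakpoints

variable {n : ℕ} {α a b H : ℝ} {f : ℝ → ℝ}

theorem exists_levelSet_finset {u v c : ℝ} (hα : 0 ≤ α) (hab : a < b)
    (hf : ContDiffOn ℝ n f (Icc a b)) (hH : 0 ≤ H)
    (hhol : ∀ x ∈ Icc a b, ∀ y ∈ Icc a b, |iteratedDerivWithin n f (Icc a b) x -
      iteratedDerivWithin n f (Icc a b) y| ≤ H * |x - y| ^ α) (hsub : Icc u v ⊆ Icc a b)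
    (hfar : ∃ t ∈ Icc u v, H * (v - u) ^ ((n : ℝ) + α) < |f t - c|) :
    ∃ Z : Finset ℝ, Z.card ≤ n ∧ (Z : Set ℝ) = {x ∈ Icc u v | f x = c} := by
  obtain ⟨t, ht, hlt⟩ := hfar
  have hcard : ∀ Z : Finset ℝ, (Z : Set ℝ) ⊆ {x ∈ Icc u v | f x = c} → Z.card ≤ n := by
    intro Z hZ
    by_contra! hcon
    let G : ℕ → ℝ → ℝ := fun i x => iteratedDerivWithin i f (Icc a b) x - if i = 0 then c else 0
    have hG : IsJet n G (Icc u v) := fun j hj x hx => by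
      have h := ((isJet_iteratedDerivWithin (uniqueDiffOn_Icc hab) hf j hj x (hsub hx)).mono
        hsub).sub_const (if j = 0 then c else 0)
      simpa [G] using h
    have hle := hG.abs_le_of_zeros hα hH
      (fun x hx y hy => by simpa [G] using hhol x (hsub hx) y (hsub hy)) hcon
      (fun z hz => (hZ hz).1) (fun z hz => by simp [G, (hZ hz).2]) ht
    simp only [G, iteratedDerivWithin_zero, if_true] at hle
    exact hlt.not_ge hle
  have hfin : {x ∈ Icc u v | f x = c}.Finite := by
    by_contra hinf
    obtain ⟨Z, hZ, hZc⟩ := Set.Infinite.exists_subset_card_eq hinf (n + 1)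
    exact absurd (hcard Z hZ) (by omega)
  exact ⟨hfin.toFinset, hcard _ (by simp), hfin.coe_toFinset⟩

/-- The `i`-th point of the uniform mesh which divides `[a, b]` into `m` cells; for `m = 0` all
mesh points are `a`. -/
noncomputable def meshPoint (a b : ℝ) (m i : ℕ) : ℝ := a + i * ((b - a) / m)

theorem meshPoint_zero (m : ℕ) : meshPoint a b m 0 = a := by simp [meshPoint]

theorem meshPoint_self {m : ℕ} (hm : m ≠ 0) : meshPoint a b m m = b := by
  have : (m : ℝ) ≠ 0 := Nat.cast_ne_zero.2 hm
  unfold meshPoint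
  field_simp
  ring

theorem meshPoint_succ_sub (m i : ℕ) :
    meshPoint a b m (i + 1) - meshPoint a b m i = (b - a) / m := by
  unfold meshPoint
  push_cast
  ring

theorem meshPoint_mono (hab : a ≤ b) (m : ℕ) : Monotone (meshPoint a b m) := by
  have : 0 ≤ (b - a) / m := div_nonneg (sub_nonneg.2 hab) m.cast_nonneg
  intro i j hij
  unfold meshPoint
  gcongr

theorem meshPoint_mem_Icc (hab : a ≤ b) {m i : ℕ} (hm : m ≠ 0) (hi : i ≤ m) :
    meshPoint a b m i ∈ Icc a b :=
  ⟨(meshPoint_zero m).symm.le.trans (meshPoint_mono hab m i.zero_le),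
    (meshPoint_mono hab m hi).trans (meshPoint_self hm).le⟩

theorem exists_finset_of_level {u v : ℝ} (hα : 0 ≤ α) (hab : a < b)
    (hf : ContDiffOn ℝ n f (Icc a b)) (hH : 0 ≤ H)
    (hhol : ∀ x ∈ Icc a b, ∀ y ∈ Icc a b, |iteratedDerivWithin n f (Icc a b) x -
      iteratedDerivWithin n f (Icc a b) y| ≤ H * |x - y| ^ α) (hsub : Icc u v ⊆ Icc a b) (c : ℝ) :
    ∃ W : Finset ℝ, W.card ≤ n ∧
      ((∃ t ∈ Icc u v, H * (v - u) ^ ((n : ℝ) + α) < |f t - c|) →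
        ∀ y ∈ Icc u v, f y = c → y ∈ W) := by
  by_cases hfar : ∃ t ∈ Icc u v, H * (v - u) ^ ((n : ℝ) + α) < |f t - c|
  · obtain ⟨W, hW, hWeq⟩ := exists_levelSet_finset hα hab hf hH hhol hsub hfar
    refine ⟨W, hW, fun _ y hy hyc => ?_⟩
    rw [← Finset.mem_coe, hWeq]
    exact ⟨hy, hyc⟩
  · exact ⟨∅, by simp, fun h => absurd h hfar⟩

theorem exists_finset_of_levels {m : ℕ} (hm : m ≠ 0) (hα : 0 ≤ α) (hab : a < b)
    (hf : ContDiffOn ℝ n f (Icc a b)) (hH : 0 ≤ H)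
    (hhol : ∀ x ∈ Icc a b, ∀ y ∈ Icc a b, |iteratedDerivWithin n f (Icc a b) x -
      iteratedDerivWithin n f (Icc a b) y| ≤ H * |x - y| ^ α) (lev : Finset ℝ) :
    ∃ Z : Finset ℝ, Z.card ≤ m + 1 + m * (lev.card * n) ∧
      ∀ u v : ℝ, u < v → Icc u v ⊆ Icc a b → (∀ z ∈ Z, z ∉ Ioo u v) → v - u ≤ (b - a) / m ∧
        ∀ c ∈ lev, (∃ t ∈ Icc u v, H * ((b - a) / m) ^ ((n : ℝ) + α) < |f t - c|) →
          ∀ y ∈ Ioo u v, f y ≠ c := by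
  classical
  let x := meshPoint a b m
  have hcell : ∀ i : Fin m, Icc (x i) (x (i + 1)) ⊆ Icc a b := fun i =>
    Icc_subset_Icc (meshPoint_mem_Icc hab.le hm i.2.le).1 (meshPoint_mem_Icc hab.le hm i.2).2
  choose W hWcard hW using fun (i : Fin m) (c : ℝ) =>
    exists_finset_of_level hα hab hf hH hhol (hcell i) c
  refine ⟨(Finset.range (m + 1)).image x ∪ Finset.univ.biUnion fun i => lev.biUnion (W i),
    ?_, fun u v huv hsub havoid => ?_⟩
  · refine (Finset.card_union_le _ _).trans (add_le_add ?_ ?_)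
    · exact Finset.card_image_le.trans_eq (Finset.card_range _)
    · refine (Finset.card_biUnion_le_card_mul _ _ _ fun i _ =>
        Finset.card_biUnion_le_card_mul _ _ n fun c _ => hWcard i c).trans_eq ?_
      rw [Finset.card_fin]
  · obtain ⟨i, hi, hiu, hiv⟩ : ∃ i < m, x i ≤ u ∧ v ≤ x (i + 1) :=
      exists_Icc_subset_cell huv
        ((meshPoint_zero m).trans_le (hsub (left_mem_Icc.2 huv.le)).1)
        ((hsub (right_mem_Icc.2 huv.le)).2.trans_eq (meshPoint_self hm).symm)
        fun i hi => havoid _ (Finset.mem_union_left _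
          (Finset.mem_image_of_mem _ (Finset.mem_range_succ_iff.2 hi)))
    have hsubcell : Icc u v ⊆ Icc (x i) (x (i + 1)) := Icc_subset_Icc hiu hiv
    refine ⟨(sub_le_sub hiv hiu).trans_eq (meshPoint_succ_sub m i), ?_⟩
    rintro c hc ⟨t, ht, hlt⟩ y hy hyc
    rw [← meshPoint_succ_sub m i] at hlt
    have hyW := hW ⟨i, hi⟩ c ⟨t, hsubcell ht, hlt⟩ y (hsubcell (Ioo_subset_Icc_self hy)) hyc
    exact havoid y (Finset.mem_union_right _ (Finset.mem_biUnion.2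
      ⟨⟨i, hi⟩, Finset.mem_univ _, Finset.mem_biUnion.2 ⟨c, hc, hyW⟩⟩)) hy

theorem exists_mesh_card {β L : ℝ} (hβ : 0 < β) (hL : 0 ≤ L) (hH : 0 < H) (Λ : ℝ) :
    ∃ K : ℝ, ∀ lam : ℝ, 0 < lam → lam ≤ Λ → ∃ m : ℕ, m ≠ 0 ∧
      m ≤ K * lam ^ (-(1 / β)) ∧ H * (L / m) ^ β < lam / 8 := by
  refine ⟨L * (16 * H) ^ (1 / β) + 2 * Λ ^ (1 / β), fun lam hlam hlamΛ => ?_⟩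
  let X : ℝ := L * (16 * H / lam) ^ (1 / β)
  have hX0 : 0 ≤ X := by positivity
  have hX : X = L * (16 * H) ^ (1 / β) * lam ^ (-(1 / β)) := by
    simp only [X]
    rw [Real.div_rpow (by positivity) hlam.le, Real.rpow_neg hlam.le, div_eq_mul_inv, mul_assoc]
  have hone : 1 ≤ Λ ^ (1 / β) * lam ^ (-(1 / β)) := by
    rw [Real.rpow_neg hlam.le, ← div_eq_mul_inv, one_le_div (by positivity)]
    gcongr
  have hceil : (⌈X⌉₊ : ℝ) < X + 1 := Nat.ceil_lt_add_one hX0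
  refine ⟨⌈X⌉₊ + 1, Nat.succ_ne_zero _, ?_, ?_⟩
  · push_cast
    linarith
  · have hle : L / (⌈X⌉₊ + 1 : ℕ) ≤ (lam / (16 * H)) ^ (1 / β) := by
      rw [div_le_iff₀ (by positivity), ← inv_div, Real.inv_rpow (by positivity), inv_mul_eq_div,
        le_div_iff₀ (by positivity)]
      push_cast
      exact (Nat.le_ceil X).trans (le_add_of_nonneg_right zero_le_one)
    calc H * (L / (⌈X⌉₊ + 1 : ℕ)) ^ β ≤ H * ((lam / (16 * H)) ^ (1 / β)) ^ β := by gcongr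
      _ = lam / 16 := by
        rw [one_div, Real.rpow_inv_rpow (by positivity) hβ.ne']
        field_simp
      _ < lam / 8 := by linarith

/-- On `J` the function `f` has size `lam` up to constant factors, and its derivatives on `I`
up to order `n` are bounded there as if `f` oscillated no faster than on the scale `w`. -/
def TameOn (n : ℕ) (lam Q w : ℝ) (I J : Set ℝ) (f : ℝ → ℝ) : Prop :=
  (∀ s ∈ J, |f s| ∈ Icc (3 / 8 * lam) (3 / 2 * lam)) ∧
    ∀ i ≤ n, ∀ s ∈ J, |iteratedDerivWithin i f I s| * w ^ i ≤ Q * lam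

theorem HolderClass.exists_breakpoints (hα : 0 ≤ α) (hβ : 0 < (n : ℝ) + α) (hab : a < b)
    (hf : HolderClass n α (Icc a b) f) (Λ : ℝ) :
    ∃ K Q : ℝ, ∀ lam : ℝ, 0 < lam → lam ≤ Λ → ∃ Z : Finset ℝ,
      (Z.card : ℝ) ≤ K * lam ^ (-(1 / ((n : ℝ) + α))) ∧
      ∀ u v : ℝ, u < v → Icc u v ⊆ Icc a b → (∀ z ∈ Z, z ∉ Ioo u v) →
        (∃ t ∈ Icc u v, |f t| ∈ Icc (lam / 2) lam) →
        TameOn n lam Q (v - u) (Icc a b) (Icc u v) f := by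
  classical
  obtain ⟨hfc, H₀, hH₀, hhol₀⟩ := hf
  have hH : 0 < H₀ + 1 := by linarith
  have hhol : ∀ x ∈ Icc a b, ∀ y ∈ Icc a b, |iteratedDerivWithin n f (Icc a b) x -
      iteratedDerivWithin n f (Icc a b) y| ≤ (H₀ + 1) * |x - y| ^ α :=
    fun x hx y hy => (hhol₀ x hx y hy).trans (by gcongr; linarith)
  obtain ⟨K, hmesh⟩ := exists_mesh_card hβ (sub_pos.2 hab).le hH Λ
  refine ⟨(2 + 4 * n) * K, interpolationConst n * (3 / 2), fun lam hlam hlamΛ => ?_⟩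
  obtain ⟨m, hm0, hmK, hsmall⟩ := hmesh lam hlam hlamΛ
  let lev : Finset ℝ := {3 / 8 * lam, -(3 / 8 * lam), 3 / 2 * lam, -(3 / 2 * lam)}
  obtain ⟨Z, hZcard, hZ⟩ := exists_finset_of_levels hm0 hα hab hfc hH.le hhol lev
  refine ⟨Z, ?_, fun u v huv hsub havoid => ?_⟩
  · have hcard : Z.card ≤ (2 + 4 * n) * m := by
      have : 1 ≤ m := Nat.one_le_iff_ne_zero.2 hm0
      have : lev.card * n ≤ 4 * n := Nat.mul_le_mul_right n Finset.card_le_four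
      nlinarith
    calc (Z.card : ℝ) ≤ (2 + 4 * n) * m := mod_cast hcard
      _ ≤ (2 + 4 * n) * (K * lam ^ (-(1 / ((n : ℝ) + α)))) := by gcongr
      _ = (2 + 4 * n) * K * lam ^ (-(1 / ((n : ℝ) + α))) := by ring
  · rintro ⟨t, ht, htlo, hthi⟩
    obtain ⟨hlen, hlev⟩ := hZ u v huv hsub havoid
    have hne : ∀ c, |c| = 3 / 8 * lam ∨ |c| = 3 / 2 * lam → ∀ y ∈ Ioo u v, f y ≠ c := by
      intro c hc
      refine hlev c ?_ ⟨t, ht, hsmall.trans_le ?_⟩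
      · simp only [lev, Finset.mem_insert, Finset.mem_singleton]
        rcases hc with h | h <;> rcases eq_or_eq_neg_of_abs_eq h with h | h <;> simp [h]
      · have := abs_sub_abs_le_abs_sub (f t) c
        have := abs_sub_abs_le_abs_sub c (f t)
        rw [abs_sub_comm c] at this
        rcases hc with h | h <;> linarith
    have hrange : ∀ s ∈ Icc u v, |f s| ∈ Icc (3 / 8 * lam) (3 / 2 * lam) :=
      abs_mem_Icc_of_avoids (hfc.continuousOn.mono hsub) ht (by linarith) (by linarith)
        fun y hy => ⟨fun h => hne _ (.inl h) y hy rfl, fun h => hne _ (.inr h) y hy rfl⟩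
    refine ⟨hrange, fun i hi s hs => ?_⟩
    have hjet := (isJet_iteratedDerivWithin (uniqueDiffOn_Icc hab) hfc).mono le_rfl hsub
    rw [mul_assoc]
    refine hjet.abs_mul_pow_le huv hα hH.le (by simpa using fun y hy hy' => (hrange y ⟨hy, hy'⟩).2)
      (fun y hy z hz => hhol y (hsub hy) z (hsub hz)) ?_ i hi s hs
    calc (H₀ + 1) * (v - u) ^ ((n : ℝ) + α) ≤ (H₀ + 1) * ((b - a) / m) ^ ((n : ℝ) + α) := by
          gcongr
      _ ≤ 3 / 2 * lam := by linarith

end Breakpoints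

/-! ### The Jacobian of the sum map -/

section SumMap

variable {d : ℕ} {ζ ζ' : ℝ → Fin d → ℝ} {I : Set ℝ}

theorem hasFDerivWithinAt_sumMap (hζ : ∀ x ∈ I, HasDerivWithinAt ζ (ζ' x) I x) {t : Fin d → ℝ}
    (ht : ∀ i, t i ∈ I) :
    HasFDerivWithinAt (sumMap ζ)
      (∑ i, (ContinuousLinearMap.proj (R := ℝ) (φ := fun _ : Fin d => ℝ) i).smulRight (ζ' (t i)))
      (univ.pi fun _ => I) t := by
  refine HasFDerivWithinAt.fun_sum fun i _ => ?_
  refine (HasFDerivWithinAt.comp t (hζ (t i) (ht i)).hasFDerivWithinAt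
    (ContinuousLinearMap.proj (R := ℝ) (φ := fun _ : Fin d => ℝ) i).hasFDerivWithinAt
    fun (x : Fin d → ℝ) (hx : x ∈ univ.pi fun _ => I) => hx i (mem_univ i)).congr_fderiv ?_
  ext
  simp

theorem jacobianSumMap_eq_det (hI : UniqueDiffOn ℝ I)
    (hζ : ∀ x ∈ I, HasDerivWithinAt ζ (ζ' x) I x) {t : Fin d → ℝ} (ht : ∀ i, t i ∈ I) :
    jacobianSumMap ζ I t = (Matrix.of fun b => ζ' (t b)).det := by
  have hu : UniqueDiffWithinAt ℝ (univ.pi fun _ : Fin d => I) t :=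
    UniqueDiffOn.univ_pi (fun _ => hI) t fun i _ => ht i
  rw [jacobianSumMap, (hasFDerivWithinAt_sumMap hζ ht).fderivWithin hu, ContinuousLinearMap.det,
    ← LinearMap.det_toMatrix', ← Matrix.det_transpose]
  congr 1
  ext b a
  rw [Matrix.transpose_apply, LinearMap.toMatrix'_apply]
  simp [Pi.single_apply, Finset.sum_apply, ite_apply]

end SumMap

section Vandermonde

variable {d : ℕ} {I : Set ℝ} [OrdConnected I] {G : ℕ → ℝ → Fin d → ℝ} {t : Fin d → ℝ}

theorem exists_det_mul_factorial_eq (hG : IsJet (d - 1) G I) (ht : ∀ b, t b ∈ I)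
    (hinj : Function.Injective t) {M : Matrix (Fin d) (Fin d) ℝ} {b : Fin d}
    (hM : ∀ i ≤ b, M i = G 0 (t i)) :
    ∃ ξ ∈ I, M.det * (b : ℕ).factorial =
      (∏ i ∈ Finset.Iio b, (t b - t i)) * (M.updateRow b (G b ξ)).det := by
  classical
  have hg : IsJet (b : ℕ) (fun i x => (M.updateRow b (G i x)).det) I := fun j hj x hx =>
    hasDerivWithinAt_det_updateRow M b (hG j (by omega) x hx)
  obtain ⟨ξ, hξ, h⟩ := hg.exists_mul_factorial_eq_prod_mul (Z := (Finset.Iio b).image t)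
    (by rw [Finset.card_image_of_injective _ hinj, Fin.card_Iio])
    (by
      rw [Finset.coe_image]
      exact image_subset_iff.2 fun i _ => ht i)
    (by
      rintro z hz
      obtain ⟨i, hi, rfl⟩ := Finset.mem_image.1 hz
      have hib : i < b := Finset.mem_Iio.1 hi
      refine Matrix.det_zero_of_row_eq hib.ne ?_
      rw [Matrix.updateRow_self, Matrix.updateRow_ne hib.ne]
      exact hM i hib.le) (ht b)
  rw [← hM b le_rfl, Matrix.updateRow_eq_self, Finset.prod_image hinj.injOn] at h
  exact ⟨ξ, hξ, h⟩

theorem exists_det_mul_prod_factorial_eq (hG : IsJet (d - 1) G I) (ht : ∀ b, t b ∈ I)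
    (hinj : Function.Injective t) {k : ℕ} (hk : k ≤ d) :
    ∃ s : Fin d → ℝ, (∀ b, s b ∈ I) ∧
      (Matrix.of fun b => G 0 (t b)).det * ∏ b : Fin d with k ≤ b.val, ((b : ℕ).factorial : ℝ) =
        (∏ b : Fin d with k ≤ b.val, ∏ i ∈ Finset.Iio b, (t b - t i)) *
          (Matrix.of fun b : Fin d => if (b : ℕ) < k then G 0 (t b) else G b (s b)).det := by
  induction hk using Nat.decreasingInduction with
  | self => exact ⟨t, ht, by simp [fun b : Fin d => b.2.not_ge]⟩
  | of_succ k hk ih =>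
    obtain ⟨s, hs, h⟩ := ih
    let c : Fin d := ⟨k, hk⟩
    obtain ⟨ξ, hξ, hstep⟩ := exists_det_mul_factorial_eq hG ht hinj (b := c)
      (M := Matrix.of fun b : Fin d => if (b : ℕ) < k + 1 then G 0 (t b) else G b (s b))
      (fun i hi => if_pos (Nat.lt_succ_iff.2 hi))
    refine ⟨Function.update s c ξ, fun b => ?_, ?_⟩
    · rcases eq_or_ne b c with rfl | hb
      · rwa [Function.update_self]
      · rw [Function.update_of_ne hb]
        exact hs b
    have hfilter : (Finset.univ.filter fun b : Fin d => k ≤ (b : ℕ)) =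
        insert c (Finset.univ.filter fun b : Fin d => k + 1 ≤ (b : ℕ)) := by
      ext b
      simp only [Finset.mem_filter, Finset.mem_univ, true_and, Finset.mem_insert, c, Fin.ext_iff]
      omega
    have hc : c ∉ Finset.univ.filter fun b : Fin d => k + 1 ≤ (b : ℕ) := by simp [c]
    have hrows : (Matrix.of fun b : Fin d =>
        if (b : ℕ) < k then G 0 (t b) else G b (Function.update s c ξ b)) =
        (Matrix.of fun b : Fin d =>
          if (b : ℕ) < k + 1 then G 0 (t b) else G b (s b)).updateRow c (G c ξ) := by
      ext b a
      rcases eq_or_ne b c with rfl | hb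
      · simp [c]
      · have hbk : (b : ℕ) < k ↔ (b : ℕ) < k + 1 := by
          have : (b : ℕ) ≠ k := fun h => hb (Fin.ext h)
          omega
        simp only [Matrix.updateRow_ne hb, Function.update_of_ne hb, Matrix.of_apply, hbk]
    rw [hfilter, Finset.prod_insert hc, Finset.prod_insert hc, hrows]
    linear_combination ((c : ℕ).factorial : ℝ) * h +
      (∏ b : Fin d with k + 1 ≤ b.val, ∏ i ∈ Finset.Iio b, (t b - t i)) * hstep

theorem exists_det_eq_vandermonde (hG : IsJet (d - 1) G I) (ht : ∀ b, t b ∈ I) :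
    ∃ s : Fin d → ℝ, (∀ b, s b ∈ I) ∧
      (Matrix.of fun b => G 0 (t b)).det * ∏ b : Fin d, ((b : ℕ).factorial : ℝ) =
        (Matrix.vandermonde t).det * (Matrix.of fun b : Fin d => G b (s b)).det := by
  by_cases hinj : Function.Injective t
  · obtain ⟨s, hs, h⟩ := exists_det_mul_prod_factorial_eq hG ht hinj d.zero_le
    refine ⟨s, hs, ?_⟩
    simp only [zero_le, Finset.filter_true, not_lt_zero, if_false] at h
    rw [h, Matrix.det_vandermonde]
    congr 1
    exact Finset.prod_comm' fun i j => by simp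
  · obtain ⟨i, j, hij, hne⟩ := Function.not_injective_iff.1 hinj
    refine ⟨t, ht, ?_⟩
    rw [Matrix.det_zero_of_row_eq hne (by ext; simp [hij]),
      Matrix.det_zero_of_row_eq hne (by ext; simp [hij, Matrix.vandermonde_apply]),
      zero_mul, zero_mul]

end Vandermonde

/-! ### Injectivity of the sum map -/

theorem mul_sub_add_mul_sub_ne_zero {f : ℝ → ℝ} {x y z A B : ℝ} (hf : StrictMonoOn f (Icc x z))
    (hxy : x ≤ y) (hyz : y ≤ z) (hA : A ≠ 0) (hAB : 0 ≤ A * B) (hnd : x < y ∨ B ≠ 0 ∧ y < z) :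
    A * (f y - f x) + B * (f z - f y) ≠ 0 := by
  have hx : x ∈ Icc x z := left_mem_Icc.2 (hxy.trans hyz)
  have hy : y ∈ Icc x z := ⟨hxy, hyz⟩
  have hz : z ∈ Icc x z := right_mem_Icc.2 (hxy.trans hyz)
  have hA2 : 0 < A * A := mul_self_pos.2 hA
  suffices 0 < A * A * (f y - f x) + A * B * (f z - f y) by
    intro h
    exact this.ne' (by linear_combination A * h)
  rcases hnd with hlt | ⟨hB, hlt⟩
  · exact add_pos_of_pos_of_nonneg (mul_pos hA2 (sub_pos.2 (hf hx hy hlt)))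
      (mul_nonneg hAB (sub_nonneg.2 (hf.monotoneOn hy hz hyz)))
  · have hAB' : 0 < A * B := hAB.lt_of_ne (mul_ne_zero hA hB).symm
    exact add_pos_of_nonneg_of_pos
      (mul_nonneg hA2.le (sub_nonneg.2 (hf.monotoneOn hx hy hxy)))
      (mul_pos hAB' (sub_pos.2 (hf hy hz hlt)))

theorem exists_deriv_eq_zero_of_combination {f f' : ℝ → ℝ} {x y z A B : ℝ}
    (hf : ∀ t ∈ Icc x z, HasDerivWithinAt f (f' t) (Icc x z) t) (hxy : x ≤ y) (hyz : y ≤ z)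
    (hA : A ≠ 0) (hAB : 0 ≤ A * B) (hnd : x < y ∨ B ≠ 0 ∧ y < z)
    (h : A * (f y - f x) + B * (f z - f y) = 0) : ∃ ξ ∈ Ioo x z, f' ξ = 0 := by
  by_contra! hne
  have hcont : ContinuousOn f (Icc x z) := fun t ht => (hf t ht).continuousWithinAt
  have hderiv : ∀ t ∈ Ioo x z, HasDerivAt f (f' t) t := fun t ht =>
    (hf t (Ioo_subset_Icc_self ht)).hasDerivAt (Icc_mem_nhds ht.1 ht.2)
  rcases hasDerivWithinAt_forall_lt_or_forall_gt_of_forall_ne (convex_Ioo x z)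
    (fun t ht => (hderiv t ht).hasDerivWithinAt) hne with hneg | hpos
  · have hanti : StrictAntiOn f (Icc x z) := strictAntiOn_of_deriv_neg (convex_Icc x z) hcont
      fun t ht => by
        rw [interior_Icc] at ht
        rw [(hderiv t ht).deriv]
        exact hneg t ht
    refine mul_sub_add_mul_sub_ne_zero hanti.neg hxy hyz hA hAB hnd ?_
    linear_combination -h
  · have hmono : StrictMonoOn f (Icc x z) := strictMonoOn_of_deriv_pos (convex_Icc x z) hcont
      fun t ht => by
        rw [interior_Icc] at ht
        rw [(hderiv t ht).deriv]
        exact hpos t ht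
    exact mul_sub_add_mul_sub_ne_zero hmono hxy hyz hA hAB hnd h

theorem sum_range_two_mul_smul {E : Type*} [AddCommGroup E] (ε : ℕ → ℤ) (g : ℕ → E) (n : ℕ) :
    ∑ k ∈ Finset.range (2 * n), ε k • g k =
      (∑ i ∈ Finset.range (2 * n), ε i) • g (2 * n) - ∑ j ∈ Finset.range n,
        ((∑ i ∈ Finset.range (2 * j + 1), ε i) • (g (2 * j + 1) - g (2 * j)) +
          (∑ i ∈ Finset.range (2 * j + 2), ε i) • (g (2 * j + 2) - g (2 * j + 1))) := by
  induction n with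
  | zero => simp
  | succ n ih =>
    rw [show 2 * (n + 1) = 2 * n + 1 + 1 by ring, Finset.sum_range_succ, Finset.sum_range_succ, ih,
      Finset.sum_range_succ _ n]
    simp only [Finset.sum_range_succ _ (2 * n + 1), Finset.sum_range_succ _ (2 * n)]
    module

section Signs

variable {ε : ℕ → ℤ}

theorem sum_range_emod_two (hε : ∀ k, ε k = 1 ∨ ε k = -1) (n : ℕ) :
    (∑ i ∈ Finset.range n, ε i) % 2 = (n : ℤ) % 2 := by
  induction n with
  | zero => simp
  | succ n ih =>
    rw [Finset.sum_range_succ]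
    rcases hε n with h | h <;> rw [h] <;> push_cast <;> omega

theorem sum_range_odd_ne_zero (hε : ∀ k, ε k = 1 ∨ ε k = -1) (j : ℕ) :
    ∑ i ∈ Finset.range (2 * j + 1), ε i ≠ 0 := by
  intro h
  have hmod := sum_range_emod_two hε (2 * j + 1)
  rw [h] at hmod
  omega

theorem sum_range_odd_mul_sum_range_succ_nonneg (hε : ∀ k, ε k = 1 ∨ ε k = -1) (j : ℕ) :
    0 ≤ (∑ i ∈ Finset.range (2 * j + 1), ε i) * ∑ i ∈ Finset.range (2 * j + 2), ε i := by
  rw [Finset.sum_range_succ ε (2 * j + 1)]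
  rcases lt_or_gt_of_ne (sum_range_odd_ne_zero hε j) with h | h <;>
    rcases hε (2 * j + 1) with h' | h' <;> rw [h'] <;> nlinarith

end Signs

section Curve

variable {d : ℕ} {ζ ζ' : ℝ → Fin d → ℝ} {I : Set ℝ}

theorem hasDerivWithinAt_dotProduct {x : ℝ} (hζ : HasDerivWithinAt ζ (ζ' x) I x) (ξ : Fin d → ℝ) :
    HasDerivWithinAt (fun x => ζ x ⬝ᵥ ξ) (ζ' x ⬝ᵥ ξ) I x :=
  HasDerivWithinAt.fun_sum fun i _ => (hasDerivWithinAt_pi.1 hζ i).mul_const (ξ i)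

theorem det_ne_zero_of_exists_dotProduct_eq_zero
    (hdet : ∀ y : Fin d → ℝ, StrictMono y → (∀ i, y i ∈ I) →
      (Matrix.of fun b => ζ' (y b)).det ≠ 0)
    {W : Matrix (Fin d) (Fin d) ℝ} {S : Fin d → Set ℝ} (hSI : ∀ j, S j ⊆ I)
    (hS : ∀ i j, i < j → ∀ x ∈ S i, ∀ y ∈ S j, x < y)
    (hW : ∀ ξ j, W j ⬝ᵥ ξ = 0 → ∃ y ∈ S j, ζ' y ⬝ᵥ ξ = 0) : W.det ≠ 0 := by
  intro hzero
  obtain ⟨ξ, hξ, hWξ⟩ := Matrix.exists_mulVec_eq_zero_iff.2 hzero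
  choose y hyS hy0 using fun j => hW ξ j (congrFun hWξ j)
  exact hdet y (fun i j hij => hS i j hij _ (hyS i) _ (hyS j)) (fun j => hSI j (hyS j))
    (Matrix.exists_mulVec_eq_zero_iff.1 ⟨ξ, hξ, funext hy0⟩)

end Curve

theorem det_eq_zero_of_sum_ite_eq_zero {d : ℕ} {D : Fin d → Prop} [DecidablePred D]
    {w y : Fin d → Fin d → ℝ} (hsum : ∑ j, w j = 0) (hw : ∀ j, D j → w j = 0)
    (hD : ∃ j, ¬ D j) : (Matrix.of fun j => if D j then y j else w j).det = 0 := by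
  obtain ⟨j₀, hj₀⟩ := hD
  refine Matrix.exists_vecMul_eq_zero_iff.1 ⟨fun j => if D j then 0 else 1, fun h => ?_, ?_⟩
  · simpa [hj₀] using congrFun h j₀
  · rw [Matrix.vecMul_eq_sum, ← hsum]
    refine Finset.sum_congr rfl fun j _ => ?_
    by_cases hj : D j
    · rw [if_pos hj, zero_smul, hw j hj]
    · rw [if_neg hj, one_smul]
      exact if_neg hj

section Pairs

variable {d : ℕ} {ζ ζ' : ℝ → Fin d → ℝ} {u v : ℝ}

theorem exists_mem_Ico_dotProduct_eq_zero
    (hζ : ∀ x ∈ Icc u v, HasDerivWithinAt ζ (ζ' x) (Icc u v) x) {x y z : ℝ} (hux : u ≤ x)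
    (hxy : x ≤ y) (hyz : y ≤ z) (hzv : z ≤ v) {A B : ℤ} (hA : A ≠ 0) (hAB : 0 ≤ A * B)
    (hnd : x < y ∨ B ≠ 0 ∧ y < z) {ξ : Fin d → ℝ}
    (h : (A • (ζ y - ζ x) + B • (ζ z - ζ y)) ⬝ᵥ ξ = 0) : ∃ t ∈ Ico x z, ζ' t ⬝ᵥ ξ = 0 := by
  have hsub : Icc x z ⊆ Icc u v := Icc_subset_Icc hux hzv
  obtain ⟨t, ht, ht0⟩ := exists_deriv_eq_zero_of_combination
    (fun t ht => (hasDerivWithinAt_dotProduct (hζ t (hsub ht)) ξ).mono hsub) hxy hyz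
    (A := A) (B := B) (mod_cast hA) (mod_cast hAB) (mod_cast hnd) (by
      rw [← h]
      simp only [← Int.cast_smul_eq_zsmul ℝ, add_dotProduct, smul_dotProduct, sub_dotProduct,
        smul_eq_mul])
  exact ⟨t, Ioo_subset_Ico_self ht, ht0⟩

/- Summation by parts groups the signed sum into `d` combinations of increments over consecutive,
essentially disjoint windows `[p (2j), p (2j + 2)]`. The partial sums of the signs at odd indices
are odd, hence nonzero, so a functional killing the `j`-th combination has a critical point along
the curve in the `j`-th window. A combination degenerates only when its two points coincide; it is
then replaced by the tangent vector at that point. -/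
theorem eq_of_signed_sum_eq_zero
    (hζ : ∀ x ∈ Icc u v, HasDerivWithinAt ζ (ζ' x) (Icc u v) x)
    (hdet : ∀ y : Fin d → ℝ, StrictMono y → (∀ i, y i ∈ Icc u v) →
      (Matrix.of fun b => ζ' (y b)).det ≠ 0)
    {p : ℕ → ℝ} (hp : Monotone p) (hpI : ∀ k, p k ∈ Icc u v)
    (hlt : ∀ j, j + 1 < d → p (2 * j) < p (2 * j + 2))
    {ε : ℕ → ℤ} (hε : ∀ k, ε k = 1 ∨ ε k = -1) (hsum : ∑ k ∈ Finset.range (2 * d), ε k = 0)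
    (h0 : ∑ k ∈ Finset.range (2 * d), ε k • ζ (p k) = 0) :
    ∀ j < d, p (2 * j) = p (2 * j + 1) := by
  classical
  let T : ℕ → ℤ := fun n => ∑ i ∈ Finset.range n, ε i
  let w : ℕ → Fin d → ℝ := fun j => T (2 * j + 1) • (ζ (p (2 * j + 1)) - ζ (p (2 * j))) +
    T (2 * j + 2) • (ζ (p (2 * j + 2)) - ζ (p (2 * j + 1)))
  let D : ℕ → Prop := fun j => p (2 * j) = p (2 * j + 1) ∧ T (2 * j + 2) = 0
  have hwsum : ∑ j : Fin d, w j = 0 := by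
    have h := sum_range_two_mul_smul ε (fun k => ζ (p k)) d
    rwa [h0, hsum, zero_smul, zero_sub, eq_comm, neg_eq_zero, Finset.sum_range] at h
  have hcrit : ∀ ξ : Fin d → ℝ, ∀ j < d, ¬ D j → w j ⬝ᵥ ξ = 0 →
      ∃ y ∈ Icc (p (2 * j)) (p (2 * j + 2)), y < p (2 * j + 2) ∧ ζ' y ⬝ᵥ ξ = 0 := by
    intro ξ j hj hD hrow
    have hnd : p (2 * j) < p (2 * j + 1) ∨ T (2 * j + 2) ≠ 0 ∧ p (2 * j + 1) < p (2 * j + 2) := by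
      refine or_iff_not_imp_left.2 fun h => ?_
      have heq : p (2 * j) = p (2 * j + 1) := (hp (Nat.le_succ _)).eq_of_not_lt h
      have hT : T (2 * j + 2) ≠ 0 := fun h => hD ⟨heq, h⟩
      have hjd : j + 1 ≠ d := by rintro rfl; exact hT hsum
      exact ⟨hT, heq ▸ hlt j (by omega)⟩
    obtain ⟨y, hy, hy0⟩ := exists_mem_Ico_dotProduct_eq_zero hζ (hpI _).1 (hp (Nat.le_succ _))
      (hp (Nat.le_succ _)) (hpI _).2 (sum_range_odd_ne_zero hε j)
      (sum_range_odd_mul_sum_range_succ_nonneg hε j) hnd hrow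
    exact ⟨y, Ico_subset_Icc_self hy, hy.2, hy0⟩
  have hW : (Matrix.of fun j : Fin d => if D j then ζ' (p (2 * j)) else w j).det ≠ 0 := by
    refine det_ne_zero_of_exists_dotProduct_eq_zero hdet
      (S := fun j => {y ∈ Icc (p (2 * j)) (p (2 * j + 2)) | (j : ℕ) + 1 < d → y < p (2 * j + 2)})
      (fun j y hy => ⟨(hpI _).1.trans hy.1.1, hy.1.2.trans (hpI _).2⟩)
      (fun i j hij x hx y hy => ?_) fun ξ j hj => ?_
    · have : (i : ℕ) < j := hij
      exact (hx.2 (by omega)).trans_le ((hp (by omega)).trans hy.1.1)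
    change (if D j then ζ' (p (2 * j)) else w j) ⬝ᵥ ξ = 0 at hj
    split_ifs at hj with hD
    · exact ⟨p (2 * j), ⟨⟨le_rfl, hp (by omega)⟩, fun h => hlt j h⟩, hj⟩
    · obtain ⟨y, hy, hylt, hy0⟩ := hcrit ξ j j.2 hD hj
      exact ⟨y, ⟨hy, fun _ => hylt⟩, hy0⟩
  by_contra! hne
  obtain ⟨j₀, hj₀, hne⟩ := hne
  exact hW (det_eq_zero_of_sum_ite_eq_zero hwsum
    (fun j hD => by simp only [w]; rw [← hD.1, hD.2]; simp) ⟨⟨j₀, hj₀⟩, fun hD => hne hD.1⟩)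

end Pairs

theorem exists_monotone_enumeration {κ : Type*} [Fintype κ] [Nonempty κ] (x : κ → ℝ) :
    ∃ e : ℕ → κ, Monotone (x ∘ e) ∧
      BijOn e (Finset.range (Fintype.card κ)) (Finset.univ : Finset κ) := by
  let φ := (Fintype.equivFin κ).symm
  let σ := Tuple.sort (x ∘ φ)
  have hpos : 0 < Fintype.card κ := Fintype.card_pos
  let ι : ℕ → Fin (Fintype.card κ) := fun k => ⟨min k (Fintype.card κ - 1), by omega⟩
  have hι : Monotone ι := fun i j hij => min_le_min_right _ hij
  have hιval : ∀ k : Fin (Fintype.card κ), ι k = k := fun k => by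
    ext
    simp only [ι]
    omega
  refine ⟨fun k => φ (σ (ι k)), (Tuple.monotone_sort (x ∘ φ)).comp hι, fun k _ => by simp, ?_, ?_⟩
  · intro k hk l hl hkl
    have h := Fin.ext_iff.1 (σ.injective (φ.injective hkl))
    simp only [ι, Finset.coe_range, mem_Iio] at h hk hl
    omega
  · intro q _
    obtain ⟨k, rfl⟩ := (σ.trans φ).surjective q
    exact ⟨k, by simp, by simp [hιval]⟩

section InjOn

variable {d : ℕ} {ζ ζ' : ℝ → Fin d → ℝ} {t r : Fin d → ℝ} {u v : ℝ}

theorem eq_of_sum_elim_eq (ht : Function.Injective t) (hr : Function.Injective r)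
    {q q' : Fin d ⊕ Fin d} (h : Sum.elim t r q = Sum.elim t r q') (hside : q.isLeft = q'.isLeft) :
    q = q' := by
  rcases q with i | i <;> rcases q' with j | j
  · exact congrArg Sum.inl (ht h)
  · cases hside
  · cases hside
  · exact congrArg Sum.inr (hr h)

theorem range_eq_of_exists_ne (ht : Function.Injective t) (hr : Function.Injective r)
    (h : ∀ q, ∃ q' ≠ q, Sum.elim t r q = Sum.elim t r q') : range t = range r := by
  refine Subset.antisymm ?_ ?_
  · rintro _ ⟨i, rfl⟩
    obtain ⟨j | j, hne, hj⟩ := h (Sum.inl i)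
    · exact absurd (eq_of_sum_elim_eq ht hr hj rfl).symm hne
    · exact ⟨j, hj.symm⟩
  · rintro _ ⟨i, rfl⟩
    obtain ⟨j | j, hne, hj⟩ := h (Sum.inr i)
    · exact ⟨j, hj.symm⟩
    · exact absurd (eq_of_sum_elim_eq ht hr hj rfl).symm hne

theorem lt_of_monotone_enumeration (ht : Function.Injective t) (hr : Function.Injective r)
    {e : ℕ → Fin d ⊕ Fin d} (hmono : Monotone (Sum.elim t r ∘ e))
    (hinj : InjOn e (Finset.range (2 * d))) {k : ℕ} (hk : k + 2 < 2 * d) :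
    Sum.elim t r (e k) < Sum.elim t r (e (k + 2)) := by
  refine lt_of_le_of_ne (hmono (by omega)) fun h02 => ?_
  have h01 : Sum.elim t r (e k) = Sum.elim t r (e (k + 1)) :=
    le_antisymm (hmono (by omega)) (h02 ▸ hmono (by omega))
  have hside : ∀ i j, i < 2 * d → j < 2 * d → i ≠ j →
      Sum.elim t r (e i) = Sum.elim t r (e j) → (e i).isLeft ≠ (e j).isLeft :=
    fun i j hi hj hij h hs =>
      hij (hinj (by simpa using hi) (by simpa using hj) (eq_of_sum_elim_eq ht hr h hs))
  have hs01 := hside k (k + 1) (by omega) (by omega) (by omega) h01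
  have hs02 := hside k (k + 2) (by omega) (by omega) (by omega) h02
  have hs12 := hside (k + 1) (k + 2) (by omega) (by omega) (by omega) (h01.symm.trans h02)
  grind

theorem injOn_sumMap (hζ : ∀ x ∈ Icc u v, HasDerivWithinAt ζ (ζ' x) (Icc u v) x)
    (hdet : ∀ y : Fin d → ℝ, StrictMono y → (∀ i, y i ∈ Icc u v) →
      (Matrix.of fun b => ζ' (y b)).det ≠ 0) :
    InjOn (sumMap ζ) {t | StrictMono t ∧ ∀ i, t i ∈ Icc u v} := by
  rintro t ⟨ht, htI⟩ r ⟨hr, hrI⟩ (heq : ∑ i, ζ (t i) = ∑ i, ζ (r i))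
  rcases d.eq_zero_or_pos with rfl | hd
  · exact Subsingleton.elim _ _
  have : Nonempty (Fin d ⊕ Fin d) := ⟨Sum.inl ⟨0, hd⟩⟩
  let x : Fin d ⊕ Fin d → ℝ := Sum.elim t r
  let sgn : Fin d ⊕ Fin d → ℤ := Sum.elim 1 (-1)
  obtain ⟨e, hmono, he⟩ := exists_monotone_enumeration x
  rw [Fintype.card_sum, Fintype.card_fin, ← two_mul] at he
  have hsgn : ∀ q, sgn q = 1 ∨ sgn q = -1 := by rintro (i | i) <;> simp [sgn]
  have hsum : ∑ k ∈ Finset.range (2 * d), sgn (e k) = 0 := by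
    rw [Finset.sum_nbij e he.mapsTo he.injOn he.surjOn fun _ _ => rfl]
    simp [sgn]
  have hcurve : ∑ k ∈ Finset.range (2 * d), sgn (e k) • ζ (x (e k)) = 0 := by
    rw [Finset.sum_nbij e he.mapsTo he.injOn he.surjOn (g := fun q => sgn q • ζ (x q))
      fun _ _ => rfl]
    simpa [sgn, x, ← sub_eq_add_neg, sub_eq_zero] using heq
  have hpairs := eq_of_signed_sum_eq_zero hζ hdet hmono
    (fun k => show x (e k) ∈ Icc u v by rcases e k with i | i <;> [exact htI i; exact hrI i])
    (fun j hj => lt_of_monotone_enumeration ht.injective hr.injective hmono he.injOn (by omega))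
    (fun k => hsgn (e k)) hsum hcurve
  refine (ht.range_inj hr).1 (range_eq_of_exists_ne ht.injective hr.injective fun q => ?_)
  have hpartner : ∀ k < 2 * d, ∃ l < 2 * d, l ≠ k ∧ x (e k) = x (e l) := by
    intro k hk
    obtain ⟨j, rfl | rfl⟩ := k.even_or_odd'
    · exact ⟨2 * j + 1, by omega, by omega, hpairs j (by omega)⟩
    · exact ⟨2 * j, by omega, by omega, (hpairs j (by omega)).symm⟩
  obtain ⟨k, hk, rfl⟩ := he.surjOn (Finset.mem_coe.2 (Finset.mem_univ q))
  obtain ⟨l, hl, hlk, hxl⟩ := hpartner k (by simpa using hk)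
  exact ⟨e l, fun h => hlk (he.injOn (by simpa using hl) hk h), hxl⟩

end InjOn

/-! ### Offspring curves -/

/-- The determinants whose `b`-th row is an arbitrary value of `G b` on `I` lie in `[c, C]`, up to
a common sign `σ`. -/
def MixedBound {d : ℕ} (G : ℕ → ℝ → Fin d → ℝ) (I : Set ℝ) (c C : ℝ) : Prop :=
  ∃ σ : ℝ, |σ| = 1 ∧ ∀ s : Fin d → ℝ, (∀ b, s b ∈ I) →
    σ * (Matrix.of fun b : Fin d => G b (s b)).det ∈ Icc c C

namespace MixedBound

variable {d : ℕ} {G : ℕ → ℝ → Fin d → ℝ} {I : Set ℝ} {c C : ℝ} {s t : Fin d → ℝ}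

theorem le_abs_det (hG : MixedBound G I c C) (hs : ∀ b, s b ∈ I) :
    c ≤ |(Matrix.of fun b : Fin d => G b (s b)).det| := by
  obtain ⟨σ, hσ, h⟩ := hG
  simpa only [abs_mul, hσ, one_mul] using (h s hs).1.trans (le_abs_self _)

theorem abs_det_le (hG : MixedBound G I c C) (hc : 0 ≤ c) (hs : ∀ b, s b ∈ I) :
    |(Matrix.of fun b : Fin d => G b (s b)).det| ≤ C := by
  obtain ⟨σ, hσ, h⟩ := hG
  rw [← one_mul |_|, ← hσ, ← abs_mul, abs_of_nonneg (hc.trans (h s hs).1)]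
  exact (h s hs).2

theorem div_mul_abs_vandermonde_le [OrdConnected I] (hG : MixedBound G I c C)
    (hjet : IsJet (d - 1) G I) (ht : ∀ b, t b ∈ I) :
    c / (∏ k : Fin d, ((k : ℕ).factorial : ℝ)) * |(Matrix.vandermonde t).det| ≤
      |(Matrix.of fun b => G 0 (t b)).det| := by
  have hpos : 0 < ∏ k : Fin d, ((k : ℕ).factorial : ℝ) := Finset.prod_pos fun k _ => by positivity
  obtain ⟨s, hs, h⟩ := exists_det_eq_vandermonde hjet ht
  rw [div_mul_eq_mul_div, div_le_iff₀ hpos, ← abs_of_pos hpos, ← abs_mul, h, abs_mul, mul_comm]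
  gcongr
  exact hG.le_abs_det hs

end MixedBound

section ShiftInterval

variable {m : ℕ} {a b lo hi t : ℝ} {h : Fin (m + 1) → ℝ}

theorem add_mem_of_mem_shiftInterval (hh : Monotone h) (ht : t ∈ shiftInterval a b h)
    (j : Fin (m + 1)) : t + h j ∈ Icc a b :=
  ⟨(sub_le_iff_le_add.1 ht.1).trans (by grw [hh (Fin.zero_le j)]),
    (add_le_add_right (hh (Fin.le_last j)) t).trans (le_sub_iff_add_le.1 ht.2)⟩

theorem shiftInterval_subset (hlo : a ≤ lo) (hhi : hi ≤ b) :
    shiftInterval lo hi h ⊆ shiftInterval a b h :=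
  Icc_subset_Icc (sub_le_sub_right hlo _) (sub_le_sub_right hhi _)

theorem uniqueDiffOn_shiftInterval (hlt : h (Fin.last m) - h 0 < b - a) :
    UniqueDiffOn ℝ (shiftInterval a b h) :=
  uniqueDiffOn_Icc (by linarith)

instance : OrdConnected (shiftInterval a b h) := ordConnected_Icc

end ShiftInterval

section Offspring

variable {d m n : ℕ} {a b : ℝ} {h : Fin (m + 1) → ℝ}

theorem hasDerivWithinAt_offspring (hh : Monotone h) {g g' : ℝ → Fin d → ℝ}
    (hg : ∀ x ∈ Icc a b, HasDerivWithinAt g (g' x) (Icc a b) x) {t : ℝ}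
    (ht : t ∈ shiftInterval a b h) :
    HasDerivWithinAt (offspring g h) (offspring g' h t) (shiftInterval a b h) t := by
  refine .fun_const_smul _ (.fun_sum fun j _ => ?_)
  have hshift : HasDerivWithinAt (· + h j) 1 (shiftInterval a b h) t :=
    (hasDerivWithinAt_id t _).add_const (h j)
  simpa only [one_smul, Function.comp_def] using
    (hg _ (add_mem_of_mem_shiftInterval hh ht j)).scomp t hshift
      fun x hx => add_mem_of_mem_shiftInterval hh hx j

theorem IsJet.offspring {G : ℕ → ℝ → Fin d → ℝ} (hG : IsJet n G (Icc a b)) (hh : Monotone h) :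
    IsJet n (fun k => offspring (G k) h) (shiftInterval a b h) :=
  fun k hk _ ht => hasDerivWithinAt_offspring hh (hG k hk) ht

theorem det_offspring (G : ℕ → ℝ → Fin d → ℝ) (h : Fin (m + 1) → ℝ) (s : Fin d → ℝ) :
    (Matrix.of fun b : Fin d => offspring (G b) h (s b)).det = ∑ r : Fin d → Fin (m + 1),
      ((m : ℝ) + 1)⁻¹ ^ d • (Matrix.of fun b : Fin d => G b (s b + h (r b))).det := by
  have hdet := det_of_sum_rows (fun (_ : Fin d) (_ : Fin (m + 1)) => ((m : ℝ) + 1)⁻¹)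
    fun b j => G b (s b + h j)
  simp only [Finset.prod_const, Finset.card_univ, Fintype.card_fin] at hdet
  simp only [smul_eq_mul, ← hdet]
  congr 1
  ext b a
  simp [offspring, Finset.mul_sum]

theorem MixedBound.offspring {G : ℕ → ℝ → Fin d → ℝ} {c C : ℝ} (hG : MixedBound G (Icc a b) c C)
    (hh : Monotone h) : MixedBound (fun k => offspring (G k) h) (shiftInterval a b h) c C := by
  obtain ⟨σ, hσ, hmem⟩ := hG
  refine ⟨σ, hσ, fun s hs => ?_⟩
  have hweights : ∑ _r : Fin d → Fin (m + 1), ((m : ℝ) + 1)⁻¹ ^ d = 1 := by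
    rw [Finset.sum_const, Finset.card_univ, Fintype.card_fun, Fintype.card_fin, Fintype.card_fin,
      nsmul_eq_mul, Nat.cast_pow, Nat.cast_succ, ← mul_pow, mul_inv_cancel₀ (by positivity),
      one_pow]
  rw [det_offspring, Finset.mul_sum]
  simp only [mul_smul_comm]
  exact (convex_Icc c C).sum_mem (fun _ _ => by positivity) hweights fun r _ =>
    hmem _ fun b => add_mem_of_mem_shiftInterval hh (hs b) (r b)

end Offspring

section OffspringGeometry

variable {d m : ℕ} {a b lo hi c C : ℝ} {γ : ℝ → Fin d → ℝ} {h : Fin (m + 1) → ℝ}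

theorem torsion_eq_abs_det (γ : ℝ → Fin d → ℝ) (S : Set ℝ) (t : ℝ) :
    torsion γ S t = |(Matrix.of fun k : Fin d => iteratedDerivWithin (k + 1) γ S t).det| := by
  rw [torsion, ← Matrix.det_transpose]
  rfl

theorem isJet_offspring (hγ : ContDiffOn ℝ d γ (Icc a b)) (hh : Monotone h)
    (hlt : h (Fin.last m) - h 0 < b - a) :
    IsJet d (fun k => offspring (iteratedDerivWithin k γ (Icc a b)) h) (shiftInterval a b h) := by
  have hab : a < b := sub_pos.1 ((sub_nonneg.2 (hh (Fin.zero_le _))).trans_lt hlt)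
  exact (isJet_iteratedDerivWithin (uniqueDiffOn_Icc hab) hγ).offspring hh

theorem torsion_offspring_mem_Icc (hγ : ContDiffOn ℝ d γ (Icc a b)) (hlo : a ≤ lo) (hhi : hi ≤ b)
    (hG : MixedBound (fun k => iteratedDerivWithin (k + 1) γ (Icc a b)) (Icc lo hi) c C)
    (hc : 0 ≤ c) (hh : Monotone h) (hlt : h (Fin.last m) - h 0 < b - a) {t : ℝ}
    (ht : t ∈ shiftInterval lo hi h) :
    torsion (offspring γ h) (shiftInterval a b h) t ∈ Icc c C := by
  have htorsion : torsion (offspring γ h) (shiftInterval a b h) t = |(Matrix.of fun k : Fin d =>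
      offspring (iteratedDerivWithin (k + 1) γ (Icc a b)) h t).det| := by
    rw [torsion_eq_abs_det]
    congr 3
    ext1 k
    have hderiv := (isJet_offspring hγ hh hlt).iteratedDerivWithin_eqOn
      (uniqueDiffOn_shiftInterval hlt) k.2 (shiftInterval_subset hlo hhi ht)
    simpa only [iteratedDerivWithin_zero] using hderiv
  rw [htorsion]
  exact ⟨(hG.offspring hh).le_abs_det (s := fun _ => t) fun _ => ht,
    (hG.offspring hh).abs_det_le (s := fun _ => t) hc fun _ => ht⟩

theorem div_mul_abs_vandermonde_le_offspring (hγ : ContDiffOn ℝ d γ (Icc a b)) (hlo : a ≤ lo)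
    (hhi : hi ≤ b)
    (hG : MixedBound (fun k => iteratedDerivWithin (k + 1) γ (Icc a b)) (Icc lo hi) c C)
    (hh : Monotone h) (hlt : h (Fin.last m) - h 0 < b - a) {t : Fin d → ℝ}
    (ht : ∀ i, t i ∈ shiftInterval lo hi h) :
    c / (∏ k : Fin d, ((k : ℕ).factorial : ℝ)) * |(Matrix.vandermonde t).det| ≤
      |(Matrix.of fun i => offspring (iteratedDerivWithin 1 γ (Icc a b)) h (t i)).det| :=
  (hG.offspring hh).div_mul_abs_vandermonde_le
    ((isJet_offspring hγ hh hlt).tail.mono le_rfl (shiftInterval_subset hlo hhi)) ht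

theorem hasDerivWithinAt_offspring_iteratedDerivWithin (hd : 1 ≤ d)
    (hγ : ContDiffOn ℝ d γ (Icc a b)) (hh : Monotone h) (hlt : h (Fin.last m) - h 0 < b - a)
    {t : ℝ} (ht : t ∈ shiftInterval a b h) :
    HasDerivWithinAt (offspring γ h) (offspring (iteratedDerivWithin 1 γ (Icc a b)) h t)
      (shiftInterval a b h) t := by
  simpa only [iteratedDerivWithin_zero] using isJet_offspring hγ hh hlt 0 hd t ht

theorem injOn_sumMap_offspring (hd : 1 ≤ d) (hγ : ContDiffOn ℝ d γ (Icc a b)) (hlo : a ≤ lo)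
    (hhi : hi ≤ b)
    (hG : MixedBound (fun k => iteratedDerivWithin (k + 1) γ (Icc a b)) (Icc lo hi) c C)
    (hc : 0 < c) (hh : Monotone h) (hlt : h (Fin.last m) - h 0 < b - a) :
    InjOn (sumMap (offspring γ h)) {t | StrictMono t ∧ ∀ i, t i ∈ shiftInterval lo hi h} := by
  have hsub : shiftInterval lo hi h ⊆ shiftInterval a b h := shiftInterval_subset hlo hhi
  refine injOn_sumMap (fun t ht => (hasDerivWithinAt_offspring_iteratedDerivWithin hd hγ hh hlt
    (hsub ht)).mono hsub) fun y hy hyI => abs_pos.1 ?_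
  have hvand : 0 < |(Matrix.vandermonde y).det| :=
    abs_pos.2 (Matrix.det_vandermonde_ne_zero_iff.2 hy.injective)
  have : 0 < ∏ k : Fin d, ((k : ℕ).factorial : ℝ) := Finset.prod_pos fun k _ => by positivity
  exact (by positivity : 0 < c / _ * _).trans_le
    (div_mul_abs_vandermonde_le_offspring hγ hlo hhi hG hh hlt hyI)

theorem div_mul_abs_vandermonde_le_jacobianSumMap_offspring (hd : 1 ≤ d)
    (hγ : ContDiffOn ℝ d γ (Icc a b)) (hlo : a ≤ lo) (hhi : hi ≤ b)
    (hG : MixedBound (fun k => iteratedDerivWithin (k + 1) γ (Icc a b)) (Icc lo hi) c C)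
    (hh : Monotone h) (hlt : h (Fin.last m) - h 0 < b - a) {t : Fin d → ℝ}
    (ht : ∀ i, t i ∈ shiftInterval lo hi h) :
    c / (∏ k : Fin d, ((k : ℕ).factorial : ℝ)) * |(Matrix.vandermonde t).det| ≤
      |jacobianSumMap (offspring γ h) (shiftInterval a b h) t| := by
  rw [jacobianSumMap_eq_det (uniqueDiffOn_shiftInterval hlt)
    (fun x hx => hasDerivWithinAt_offspring_iteratedDerivWithin hd hγ hh hlt hx)
    fun i => shiftInterval_subset hlo hhi (ht i)]
  exact div_mul_abs_vandermonde_le_offspring hγ hlo hhi hG hh hlt ht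

end OffspringGeometry

/-! ### Covers by intervals -/

/-- `S` is covered by at most `X` compact intervals with the property `P`, of total length at
most `Y`. -/
def HasCover (P : ℝ → ℝ → Prop) (S : Set ℝ) (X Y : ℝ) : Prop :=
  ∃ (m : ℕ) (lo hi : Fin m → ℝ), (∀ l, lo l ≤ hi l ∧ P (lo l) (hi l)) ∧
    S ⊆ ⋃ l, Icc (lo l) (hi l) ∧ (m : ℝ) ≤ X ∧ ∑ l, (hi l - lo l) ≤ Y

theorem exists_mem_Icc_succ {z : ℕ → ℝ} (hz : Monotone z) {m : ℕ} {t : ℝ} (hm : m ≠ 0)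
    (h0 : z 0 ≤ t) (ht : t ≤ z m) : ∃ g < m, t ∈ Icc (z g) (z (g + 1)) := by
  rcases ht.lt_or_eq with hlt | rfl
  · obtain ⟨g, hg, hmem⟩ := exists_mem_Ico_succ h0 hlt
    exact ⟨g, hg, Ico_subset_Icc_self hmem⟩
  · exact ⟨m - 1, by omega, hz (m.sub_le 1), by rw [Nat.sub_add_cancel (by omega)]⟩

namespace HasCover

variable {P : ℝ → ℝ → Prop} {S T : Set ℝ} {X Y X' Y' u v a b : ℝ}

theorem of_fintype {κ : Type*} [Fintype κ] (lo hi : κ → ℝ)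
    (hP : ∀ l, lo l ≤ hi l ∧ P (lo l) (hi l)) (hS : S ⊆ ⋃ l, Icc (lo l) (hi l)) :
    HasCover P S (Fintype.card κ) (∑ l, (hi l - lo l)) := by
  let e := (Fintype.equivFin κ).symm
  refine ⟨Fintype.card κ, lo ∘ e, hi ∘ e, fun l => hP (e l), ?_, le_rfl,
    (e.sum_comp fun l => hi l - lo l).le⟩
  simpa only [Function.comp_def, e.surjective.iUnion_comp fun l => Icc (lo l) (hi l)] using hS

theorem mono (h : HasCover P T X Y) (hST : S ⊆ T) (hX : X ≤ X') (hY : Y ≤ Y') :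
    HasCover P S X' Y' := by
  obtain ⟨m, lo, hi, hP, hT, hm, hsum⟩ := h
  exact ⟨m, lo, hi, hP, hST.trans hT, hm.trans hX, hsum.trans hY⟩

theorem nonneg (h : HasCover P S X Y) : 0 ≤ X := by
  obtain ⟨m, _, _, _, _, hm, _⟩ := h
  exact m.cast_nonneg.trans hm

theorem of_eq_empty (hS : S = ∅) : HasCover P S 0 0 :=
  ⟨0, Fin.elim0, Fin.elim0, fun l => l.elim0, hS ▸ empty_subset _, by simp, by simp⟩

theorem iUnion {κ : Type*} [Fintype κ] {S : κ → Set ℝ} (h : ∀ x, HasCover P (S x) X Y) :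
    HasCover P (⋃ x, S x) (Fintype.card κ * X) (Fintype.card κ * Y) := by
  choose m lo hi hP hS hm hsum using h
  refine (of_fintype (fun l : Σ x, Fin (m x) => lo l.1 l.2) (fun l => hi l.1 l.2)
    (fun l => hP l.1 l.2) ?_).mono subset_rfl ?_ ?_
  · rw [iUnion_sigma]
    exact iUnion_mono hS
  · rw [Fintype.card_sigma, Nat.cast_sum, ← nsmul_eq_mul, ← Finset.card_univ]
    simpa only [Fintype.card_fin] using Finset.sum_le_card_nsmul _ _ X fun x _ => hm x
  · rw [Fintype.sum_sigma, ← nsmul_eq_mul, ← Finset.card_univ]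
    exact Finset.sum_le_card_nsmul _ _ Y fun x _ => hsum x

theorem union (hS : HasCover P S X Y) (hT : HasCover P T X' Y') :
    HasCover P (S ∪ T) (X + X') (Y + Y') := by
  obtain ⟨m, lo, hi, hP, hS, hm, hsum⟩ := hS
  obtain ⟨m', lo', hi', hP', hT, hm', hsum'⟩ := hT
  refine (of_fintype (Sum.elim lo lo') (Sum.elim hi hi') (Sum.forall.2 ⟨hP, hP'⟩) ?_).mono
    subset_rfl ?_ ?_
  · rw [iUnion_sum]
    exact union_subset_union hS hT
  · simpa using add_le_add hm hm'
  · simpa only [Fintype.sum_sum_type, Sum.elim_inl, Sum.elim_inr] using add_le_add hsum hsum'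

theorem of_subdivision {R : ℕ} (hR : R ≠ 0) (huv : u ≤ v)
    (hP : ∀ u' v', Icc u' v' ⊆ Icc u v → v' - u' = (v - u) / R → P u' v') :
    HasCover P (Icc u v) R (v - u) := by
  have hpiece : ∀ i : Fin R, Icc (meshPoint u v R i) (meshPoint u v R (i + 1)) ⊆ Icc u v :=
    fun i => Icc_subset_Icc (meshPoint_mem_Icc huv hR i.2.le).1 (meshPoint_mem_Icc huv hR i.2).2
  refine (of_fintype (fun i : Fin R => meshPoint u v R i) (fun i => meshPoint u v R (i + 1))
    (fun i => ⟨meshPoint_mono huv R (Nat.le_succ _), hP _ _ (hpiece i) (meshPoint_succ_sub R i)⟩)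
    fun t ht => ?_).mono subset_rfl (by rw [Fintype.card_fin]) ?_
  · obtain ⟨g, hg, hgt, htg⟩ := exists_mem_Icc_succ (meshPoint_mono (a := u) (b := v) huv R) hR
      ((meshPoint_zero R).trans_le ht.1) (ht.2.trans_eq (meshPoint_self hR).symm)
    exact mem_iUnion.2 ⟨⟨g, hg⟩, hgt, htg⟩
  · have hR' : (R : ℝ) ≠ 0 := Nat.cast_ne_zero.2 hR
    simp only [meshPoint_succ_sub, Finset.sum_const, Finset.card_univ, Fintype.card_fin,
      nsmul_eq_mul, mul_div_cancel₀ _ hR', le_refl]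

theorem of_cells {Z : Finset ℝ} (hab : a < b)
    (hcell : ∀ u v, u < v → Icc u v ⊆ Icc a b → (∀ z ∈ Z, z ∉ Ioo u v) →
      HasCover P (S ∩ Icc u v) X (v - u)) :
    HasCover P (S ∩ Icc a b) ((Z.card + 1) * X) (b - a) := by
  induction Z using Finset.strongInduction generalizing a b with
  | H Z ih =>
    by_cases hZ : ∀ z ∈ Z, z ∉ Ioo a b
    · have hcover := hcell a b hab subset_rfl hZ
      exact hcover.mono subset_rfl (le_mul_of_one_le_left hcover.nonneg (by simp)) le_rfl
    push Not at hZ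
    obtain ⟨x, hxZ, hax, hxb⟩ := hZ
    have hleft := ih (Z.filter (· < x)) (Finset.filter_ssubset.2 ⟨x, hxZ, lt_irrefl x⟩) hax
      fun u v huv hsub hZ => hcell u v huv (hsub.trans (Icc_subset_Icc_right hxb.le)) fun z hz hzuv
        => hZ z (Finset.mem_filter.2 ⟨hz, hzuv.2.trans_le (hsub (right_mem_Icc.2 huv.le)).2⟩) hzuv
    have hright := ih (Z.filter (x < ·)) (Finset.filter_ssubset.2 ⟨x, hxZ, lt_irrefl x⟩) hxb
      fun u v huv hsub hZ => hcell u v huv (hsub.trans (Icc_subset_Icc_left hax.le)) fun z hz hzuv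
        => hZ z (Finset.mem_filter.2 ⟨hz, (hsub (left_mem_Icc.2 huv.le)).1.trans_lt hzuv.1⟩) hzuv
    refine (hleft.union hright).mono ?_ ?_ (by simp)
    · rw [← inter_union_distrib_left, Icc_union_Icc_eq_Icc hax.le hxb.le]
    · have hcard : (Z.filter (· < x)).card + (Z.filter (x < ·)).card + 1 ≤ Z.card := by
        have hssub : Z.filter (x < ·) ⊂ Z.filter (¬ · < x) := by
          refine (Finset.ssubset_iff_of_subset ?_).2 ⟨x, by simpa using hxZ, by simp⟩
          exact Finset.monotone_filter_right _ fun z _ hz => hz.not_gt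
        rw [← Z.card_filter_add_card_filter_not (· < x), add_assoc]
        exact add_le_add_right (Finset.card_lt_card hssub) _
      have hX : 0 ≤ X := (mul_nonneg_iff_of_pos_left (by positivity)).1 hleft.nonneg
      rw [← add_mul]
      refine mul_le_mul_of_nonneg_right ?_ hX
      exact_mod_cast (by omega)

end HasCover

section Minors

theorem abs_intCast_sign {κ : Type*} [Fintype κ] [DecidableEq κ] (σ : Equiv.Perm κ) :
    |((Equiv.Perm.sign σ : ℤ) : ℝ)| = 1 := by
  rcases Int.units_eq_one_or (Equiv.Perm.sign σ) with h | h <;> simp [h]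

variable {n : ℕ} {A : ℝ}

theorem exists_abs_det_le_mul_abs_det_minor (hA : 0 ≤ A)
    (M : Matrix (Fin (n + 1)) (Fin (n + 1)) ℝ) (hM : ∀ i j, |M i j| ≤ A) :
    ∃ k : Fin (n + 1),
      |M.det| ≤ (n + 1) * A * |(M.submatrix Fin.castSucc k.succAbove).det| := by
  obtain ⟨k, hk⟩ := Finite.exists_max fun k : Fin (n + 1) =>
    |(M.submatrix Fin.castSucc k.succAbove).det|
  refine ⟨k, ?_⟩
  rw [Matrix.det_succ_row M (Fin.last n), Fin.succAbove_last]
  calc _ ≤ ∑ _i : Fin (n + 1), A * |(M.submatrix Fin.castSucc k.succAbove).det| :=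
        (Finset.abs_sum_le_sum_abs _ _).trans (Finset.sum_le_sum fun i _ => by
          rw [abs_mul, abs_mul, abs_pow, abs_neg, abs_one, one_pow, one_mul]
          exact mul_le_mul (hM _ _) (hk i) (abs_nonneg _) hA)
    _ = _ := by
      rw [Finset.sum_const, Finset.card_univ, Fintype.card_fin, nsmul_eq_mul, Nat.cast_succ,
        mul_assoc]

theorem exists_perm_abs_det_le (hA : 1 ≤ A) (M : Matrix (Fin n) (Fin n) ℝ)
    (hM : ∀ i j, |M i j| ≤ A) :
    ∃ σ : Equiv.Perm (Fin n), ∀ j (hj : j ≤ n), |M.det| ≤ (n * A) ^ n *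
      |(M.submatrix (Fin.castLE hj) (σ ∘ Fin.castLE hj)).det| := by
  induction n with
  | zero =>
    refine ⟨1, fun j hj => ?_⟩
    obtain rfl : j = 0 := by omega
    simp
  | succ n ih =>
    obtain ⟨k, hk⟩ := exists_abs_det_le_mul_abs_det_minor (zero_le_one.trans hA) M hM
    obtain ⟨σ, hσ⟩ := ih (M.submatrix Fin.castSucc k.succAbove) fun i j => hM _ _
    let ρ : Equiv.Perm (Fin (n + 1)) :=
      (finSuccEquivLast.trans (Equiv.optionCongr σ)).trans (finSuccEquiv' k).symm
    have hone : 1 ≤ ((n : ℝ) + 1) * A := one_le_mul_of_one_le_of_one_le (by simp) hA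
    refine ⟨ρ, fun j hj => ?_⟩
    rw [Nat.cast_succ]
    rcases hj.eq_or_lt with rfl | hlt
    · have hdet : |(M.submatrix (Fin.castLE hj) (ρ ∘ Fin.castLE hj)).det| = |M.det| := by
        rw [← one_mul |M.det|, ← abs_intCast_sign ρ, ← abs_mul, ← Matrix.det_permute']
        rfl
      rw [hdet]
      exact le_mul_of_one_le_left (abs_nonneg _) (one_le_pow₀ hone)
    · have hj' : j ≤ n := Nat.lt_succ_iff.1 hlt
      have hρ : ∀ a : Fin j, ρ (Fin.castLE hj a) = k.succAbove (σ (Fin.castLE hj' a)) := by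
        intro a
        have hcast : Fin.castLE hj a = (Fin.castLE hj' a).castSucc := rfl
        simp only [ρ, hcast, Equiv.trans_apply, finSuccEquivLast_castSucc, Equiv.optionCongr_apply,
          Option.map_some, finSuccEquiv'_symm_some]
      calc |M.det| ≤ (n + 1) * A * |(M.submatrix Fin.castSucc k.succAbove).det| := hk
        _ ≤ (n + 1) * A * ((n * A) ^ n * _) := by grw [hσ j hj']
        _ ≤ (n + 1) * A * (((n + 1) * A) ^ n * _) := by gcongr; linarith
        _ = _ := by
          rw [pow_succ', ← mul_assoc]
          simp only [Function.comp_def, hρ]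
          rfl

end Minors

/-! ### The components of the tangent vector -/

section Tame

variable {n m d : ℕ} {lam Q Q' w ε a b R : ℝ} {I J J' : Set ℝ} {g : ℝ → ℝ} {f : ℕ → ℝ → ℝ}

namespace TameOn

theorem mono (hg : TameOn n lam Q w I J g) (hlam : 0 ≤ lam) (hm : m ≤ n) (hQ : Q ≤ Q')
    (hJ : J' ⊆ J) : TameOn m lam Q' w I J' g :=
  ⟨fun s hs => hg.1 s (hJ hs), fun i hi s hs =>
    (hg.2 i (hi.trans hm) s (hJ hs)).trans (by gcongr)⟩

theorem ne_zero (hg : TameOn n lam Q w I J g) (hlam : 0 < lam) {s : ℝ} (hs : s ∈ J) : g s ≠ 0 :=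
  abs_pos.1 (lt_of_lt_of_le (by positivity) (hg.1 s hs).1)

theorem nearlyConstOn (hg : TameOn n lam Q w I J g) (hlam : 0 < lam) (hJ : IsPreconnected J)
    (hcont : ContinuousOn g J) : NearlyConstOn 4 J g := by
  intro s hs t ht
  have hsign : g s / |g s| = g t / |g t| := by
    have hne := fun x hx => abs_ne_zero.2 (hg.ne_zero hlam (s := x) hx)
    have hcont' : ContinuousOn (fun x => g x / |g x|) J := hcont.div hcont.abs hne
    have hsq : EqOn ((fun x => g x / |g x|) ^ 2) 1 J := fun x hx => by
      simp [div_pow, hg.ne_zero hlam hx]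
    rcases hJ.eq_one_or_eq_neg_one_of_sq_eq hcont' hsq with h | h <;>
      exact (h hs).trans (h ht).symm
  have hs0 := abs_pos.2 (hg.ne_zero hlam hs)
  have ht0 := abs_pos.2 (hg.ne_zero hlam ht)
  have hratio : g s / g t = |g s| / |g t| := by
    rw [div_eq_div_iff (hg.ne_zero hlam ht) ht0.ne']
    rw [div_eq_div_iff hs0.ne' ht0.ne'] at hsign
    linarith
  rw [hratio]
  refine ⟨div_pos hs0 ht0, (div_le_iff₀ ht0).2 ?_⟩
  linarith [(hg.1 s hs).2, (hg.1 t ht).1]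

theorem slowOn (hg : TameOn n lam Q w I J g) (hlam : 0 < lam) (hε : 0 ≤ ε) (hR : 1 ≤ R)
    (hQR : Q * (8 / 3) ≤ ε * R) (hJI : J ⊆ I) (hJ : UniqueDiffOn ℝ J) (hI : UniqueDiffOn ℝ I)
    (hsmooth : ContDiffOn ℝ n g I) : SlowOn n ε (w / R) J g where
  contDiffOn := hsmooth.mono hJI
  ne_zero _ := hg.ne_zero hlam
  bound i h1 hi t ht := by
    have hR0 : 0 < R := by linarith
    have hQ : 0 ≤ Q * lam := (abs_nonneg (g t)).trans (by simpa using hg.2 0 n.zero_le t ht)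
    rw [iteratedDerivWithin_subset hJI hJ hI (hsmooth.of_le (by exact_mod_cast hi)) ht, div_pow,
      mul_div_assoc']
    calc _ ≤ Q * lam / R ^ i := by
          gcongr ?_ / _
          exact hg.2 i hi t ht
      _ ≤ Q * lam / R := by
          gcongr
          exact le_self_pow₀ hR (by omega)
      _ ≤ ε * (3 / 8 * lam) := by
          rw [div_le_iff₀ hR0]
          nlinarith
      _ ≤ ε * |g t| := by
          gcongr
          exact (hg.1 t ht).1

end TameOn

theorem mixedDet_subset (hJI : J ⊆ I) (hJ : UniqueDiffOn ℝ J) (hI : UniqueDiffOn ℝ I)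
    (hf : ∀ a < n, ContDiffOn ℝ (n - 1 : ℕ) (f a) I) {s : Fin n → ℝ} (hs : ∀ b, s b ∈ J) :
    mixedDet n f J s = mixedDet n f I s := by
  unfold mixedDet
  congr 2
  ext b a
  exact iteratedDerivWithin_subset hJI hJ hI
    ((hf a a.2).of_le (by exact_mod_cast Nat.le_pred_of_lt b.2)) (hs b)

theorem slowFamily_of_tameOn (hε : 0 ≤ ε) (hR : 1 ≤ R) (hQR : Q * (8 / 3) ≤ ε * R) (hJI : J ⊆ I)
    (hJc : IsPreconnected J) (hJ : UniqueDiffOn ℝ J) (hI : UniqueDiffOn ℝ I)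
    (hf : ∀ a < d, ContDiffOn ℝ (d - 1 : ℕ) (f a) I)
    (hW : ∀ j, 1 ≤ j → j ≤ d → ContDiffOn ℝ (d - j : ℕ) (wronskian j f I) I)
    (htame : ∀ j, 1 ≤ j → j ≤ d → ∃ lam, 0 < lam ∧ TameOn (d - j) lam Q w I J (wronskian j f I)) :
    SlowFamily d 4 ε (w / R) J f := by
  have hwronskian : ∀ j ≤ d, EqOn (wronskian j f J) (wronskian j f I) J := fun j hj t ht =>
    mixedDet_subset hJI hJ hI (fun a ha => (hf a (by omega)).of_le (by exact_mod_cast (by omega)))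
      fun _ => ht
  refine ⟨fun a ha => (hf a ha).mono hJI, fun j h1 hj s hs t ht => ?_, fun j h1 hj => ?_⟩
  · obtain ⟨lam, hlam, hj'⟩ := htame j h1 hj
    rw [hwronskian j hj hs, hwronskian j hj ht]
    exact hj'.nearlyConstOn hlam hJc ((hW j h1 hj).continuousOn.mono hJI) s hs t ht
  · obtain ⟨lam, hlam, hj'⟩ := htame j h1 hj
    exact (hj'.slowOn hlam hε hR hQR hJI hJ hI (hW j h1 hj)).congr (hwronskian j hj)

theorem exists_common_breakpoints {κ : Type*} [Fintype κ] {n : κ → ℕ} {f : κ → ℝ → ℝ} {α : ℝ}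
    (hα : 0 ≤ α) (hβ : ∀ i, 0 < (n i : ℝ) + α) (hab : a < b)
    (hf : ∀ i, HolderClass (n i) α (Icc a b) (f i)) (Λ : ℝ) :
    ∃ K Q : ℝ, 0 < K ∧ ∀ lam : κ → ℝ, (∀ i, 0 < lam i ∧ lam i ≤ Λ) → ∃ Z : Finset ℝ,
      (Z.card : ℝ) ≤ K * ∑ i, lam i ^ (-(1 / ((n i : ℝ) + α))) ∧
      ∀ u v : ℝ, u < v → Icc u v ⊆ Icc a b → (∀ z ∈ Z, z ∉ Ioo u v) →
        (∃ t ∈ Icc u v, ∀ i, |f i t| ∈ Icc (lam i / 2) (lam i)) →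
        ∀ i, TameOn (n i) (lam i) Q (v - u) (Icc a b) (Icc u v) (f i) := by
  classical
  choose K Q h using fun i => (hf i).exists_breakpoints hα (hβ i) hab Λ
  obtain ⟨K', hK'⟩ := Finite.exists_le K
  obtain ⟨Q', hQ'⟩ := Finite.exists_le Q
  refine ⟨max 1 K', Q', by positivity, fun lam hlam => ?_⟩
  choose Z hcard hZ using fun i => h i (lam i) (hlam i).1 (hlam i).2
  refine ⟨Finset.univ.biUnion Z, ?_, fun u v huv hsub havoid ht i => ?_⟩
  · rw [Finset.mul_sum]
    refine (Nat.cast_le.2 Finset.card_biUnion_le).trans ?_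
    rw [Nat.cast_sum]
    refine Finset.sum_le_sum fun i _ => (hcard i).trans ?_
    have := (hlam i).1
    gcongr
    exact (hK' i).trans (le_max_right _ _)
  · obtain ⟨t, ht, hti⟩ := ht
    have havoid' : ∀ z ∈ Z i, z ∉ Ioo u v := fun z hz =>
      havoid z (Finset.mem_biUnion.2 ⟨i, Finset.mem_univ _, hz⟩)
    have htame := hZ i u v huv hsub havoid' ⟨t, ht, hti i⟩
    exact htame.mono (hlam i).1.le le_rfl (hQ' i) subset_rfl

end Tame

section TangentCoord

variable {d n j k : ℕ} {a b u v c C B ε x y t N : ℝ} {I : Set ℝ} {γ : ℝ → Fin d → ℝ}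
  {σ : Equiv.Perm (Fin d)}

theorem iteratedDerivWithin_apply (hI : UniqueDiffOn ℝ I) (hγ : ContDiffOn ℝ n γ I) (i : Fin d)
    (hk : k ≤ n) : EqOn (iteratedDerivWithin k (fun t => γ t i) I)
      (fun t => iteratedDerivWithin k γ I t i) I := by
  have hjet : IsJet n (fun k t => iteratedDerivWithin k γ I t i) I := fun k hk t ht =>
    hasDerivWithinAt_pi.1 (isJet_iteratedDerivWithin hI hγ k hk t ht) i
  simpa only [iteratedDerivWithin_zero] using hjet.iteratedDerivWithin_eqOn hI hk

/-- The components of the tangent vector, in the order given by `σ` and followed by zeros. -/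
noncomputable def tangentCoord (γ : ℝ → Fin d → ℝ) (I : Set ℝ) (σ : Equiv.Perm (Fin d)) (k : ℕ) :
    ℝ → ℝ :=
  if hk : k < d then derivWithin (fun t => γ t (σ ⟨k, hk⟩)) I else 0

theorem contDiffOn_tangentCoord (hI : UniqueDiffOn ℝ I) (hγ : ContDiffOn ℝ d γ I) (k : ℕ) :
    ContDiffOn ℝ (d - 1 : ℕ) (tangentCoord γ I σ k) I := by
  unfold tangentCoord
  split_ifs with hk
  · refine (contDiffOn_pi.1 hγ _).derivWithin hI ?_
    exact_mod_cast (by omega : d - 1 + 1 ≤ d)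
  · exact contDiffOn_const

theorem mixedDet_tangentCoord (hI : UniqueDiffOn ℝ I) (hγ : ContDiffOn ℝ d γ I) (hj : j ≤ d)
    {s : Fin j → ℝ} (hs : ∀ b, s b ∈ I) :
    mixedDet j (tangentCoord γ I σ) I s = (Matrix.of fun b a : Fin j =>
      iteratedDerivWithin (b + 1) γ I (s b) (σ (Fin.castLE hj a))).det := by
  unfold mixedDet
  congr 2
  ext b a
  rw [tangentCoord, dif_pos (a.2.trans_le hj), ← iteratedDerivWithin_succ']
  exact iteratedDerivWithin_apply hI hγ _ (b.2.trans_le hj) (hs b)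

theorem mixedDet_tangentCoord_self (hI : UniqueDiffOn ℝ I) (hγ : ContDiffOn ℝ d γ I)
    {s : Fin d → ℝ} (hs : ∀ b, s b ∈ I) :
    mixedDet d (tangentCoord γ I σ) I s = (Equiv.Perm.sign σ : ℤ) *
      (Matrix.of fun b : Fin d => iteratedDerivWithin (b + 1) γ I (s b)).det := by
  rw [mixedDet_tangentCoord hI hγ le_rfl hs, ← Matrix.det_permute']
  rfl

theorem abs_wronskian_tangentCoord (hI : UniqueDiffOn ℝ I) (hγ : ContDiffOn ℝ d γ I)
    (ht : t ∈ I) : |wronskian d (tangentCoord γ I σ) I t| = torsion γ I t := by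
  rw [wronskian, mixedDet_tangentCoord_self hI hγ fun _ => ht, abs_mul, abs_intCast_sign, one_mul,
    torsion_eq_abs_det]

theorem holderClass_apply (hN : 0 ≤ N) (hI : UniqueDiffOn ℝ I) (hγ : IsClassCN N γ I)
    (i : Fin d) : HolderClass ⌊N⌋₊ (N - ⌊N⌋₊) I fun t => γ t i := by
  obtain ⟨hsmooth, K, hK⟩ := hγ
  refine ⟨contDiffOn_pi.1 hsmooth i, K, K.2, fun x hx y hy => ?_⟩
  rw [iteratedDerivWithin_apply hI hsmooth i le_rfl hx,
    iteratedDerivWithin_apply hI hsmooth i le_rfl hy]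
  have hdist := hK.dist_le hx hy
  rw [Real.coe_toNNReal _ (sub_nonneg.2 (Nat.floor_le hN))] at hdist
  exact (dist_le_pi_dist _ _ i).trans hdist

theorem holderClass_wronskian_tangentCoord {α : ℝ} (hα : 0 ≤ α) (hα1 : α ≤ 1) (hab : a < b)
    (hγ : ∀ i, HolderClass n α (Icc a b) fun t => γ t i) (hj1 : 1 ≤ j) (hj : j ≤ n) :
    HolderClass (n - j) α (Icc a b) (wronskian j (tangentCoord γ (Icc a b) σ) (Icc a b)) := by
  have hI := uniqueDiffOn_Icc hab
  refine HolderClass.det hα hα1 hab fun p q => ?_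
  have htangent : HolderClass (n - 1) α (Icc a b) (tangentCoord γ (Icc a b) σ q) := by
    unfold tangentCoord
    split_ifs with hq
    · have h := hγ (σ ⟨q, hq⟩)
      rw [show n = n - 1 + 1 by omega, HolderClass.succ_iff hI] at h
      exact h.2
    · exact HolderClass.const 0
  rw [show n - 1 = (n - 1 - p) + p by omega] at htangent
  exact (htangent.iteratedDerivWithin_of_add hI).of_le hα hα1 hab (by omega)

theorem MixedComparable.mixedBound (h : MixedComparable d B ε c C) (hc : 0 ≤ c) (hab : a < b)
    (hγ : ContDiffOn ℝ d γ (Icc a b)) (huv : u < v) (hsub : Icc u v ⊆ Icc a b)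
    (hslow : SlowFamily d B ε (v - u) (Icc u v) (tangentCoord γ (Icc a b) σ)) (ht : t ∈ Icc u v)
    (hx : 0 < x) (htorsion : torsion γ (Icc a b) t ∈ Icc x y) :
    MixedBound (fun k => iteratedDerivWithin (k + 1) γ (Icc a b)) (Icc u v) (c * x) (C * y) := by
  have hI := uniqueDiffOn_Icc hab
  let D (s : Fin d → ℝ) : ℝ := (Matrix.of fun k : Fin d =>
    iteratedDerivWithin (k + 1) γ (Icc a b) (s k)).det
  have hmixed : ∀ s : Fin d → ℝ, (∀ b, s b ∈ Icc u v) →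
      mixedDet d (tangentCoord γ (Icc a b) σ) (Icc u v) s = (Equiv.Perm.sign σ : ℤ) * D s :=
    fun s hs => by
      rw [mixedDet_subset hsub (uniqueDiffOn_Icc huv) hI
        (fun k _ => contDiffOn_tangentCoord hI hγ k) hs]
      exact mixedDet_tangentCoord_self hI hγ fun k => hsub (hs k)
  let Dt : ℝ := D fun _ => t
  rw [torsion_eq_abs_det] at htorsion
  change |Dt| ∈ Icc x y at htorsion
  have hDt0 : |Dt| ≠ 0 := (hx.trans_le htorsion.1).ne'
  refine ⟨|Dt| / Dt, by rw [abs_div, abs_abs, div_self hDt0], fun s hs => ?_⟩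
  have hratio : D s / Dt ∈ Icc c C := by
    have hsign : ((Equiv.Perm.sign σ : ℤ) : ℝ) ≠ 0 := by simp
    have hmem := h u v _ huv hslow s hs t ht
    rwa [wronskian, hmixed s hs, hmixed _ fun _ => ht, mul_div_mul_left _ _ hsign] at hmem
  rw [div_mul_eq_mul_div, mul_div_assoc, mul_comm |Dt|]
  exact ⟨mul_le_mul hratio.1 htorsion.1 hx.le (hc.trans hratio.1),
    mul_le_mul hratio.2 htorsion.2 (abs_nonneg _) (hc.trans (hratio.1.trans hratio.2))⟩

end TangentCoord

/-! ### Dyadic levels of the torsion and of the Wronskians -/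

section Dyadic

variable {x y K : ℝ} {i k : ℤ} {r : ℕ}

/-- The dyadic interval of the positive numbers of size about `2 ^ (-k)`. It is closed at both
ends, so that consecutive intervals share an endpoint. -/
def dyadic (k : ℤ) : Set ℝ :=
  Icc (2 ^ (-k) / 2) (2 ^ (-k))

theorem exists_mem_dyadic (hx : 0 < x) : ∃ k, x ∈ dyadic k := by
  obtain ⟨n, hlow, hup⟩ := exists_mem_Ioc_zpow hx (one_lt_two : (1 : ℝ) < 2)
  refine ⟨-(n + 1), ?_, by simpa using hup⟩
  rw [neg_neg, zpow_add_one₀ two_ne_zero, mul_div_cancel_right₀ _ two_ne_zero]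
  exact hlow.le

theorem pos_of_mem_dyadic (hx : x ∈ dyadic k) : 0 < x :=
  (by positivity : (0 : ℝ) < 2 ^ (-k) / 2).trans_le hx.1

theorem neg_le_of_mem_dyadic (hx : x ∈ dyadic i) (hxr : 2 * x ≤ 2 ^ r) : -(r : ℤ) ≤ i := by
  have hpow : (2 : ℝ) ^ (-i) ≤ 2 ^ (r : ℤ) := by
    rw [zpow_natCast]
    linarith [hx.1]
  linarith [(zpow_le_zpow_iff_right₀ (one_lt_two : (1 : ℝ) < 2)).1 hpow]

theorem le_add_of_mem_dyadic (hx : x ∈ dyadic i) (hy : y ∈ dyadic k) (hyx : y ≤ K * x)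
    (hKr : 2 * K ≤ 2 ^ r) : i ≤ k + r := by
  have hpow : (2 : ℝ) ^ (-k) ≤ 2 ^ (r + -i : ℤ) :=
    calc (2 : ℝ) ^ (-k) ≤ 2 * K * x := by linarith [hy.1]
      _ ≤ 2 ^ r * 2 ^ (-i) := by
        have := (pos_of_mem_dyadic hx).le
        gcongr
        exact hx.2
      _ = 2 ^ (r + -i : ℤ) := by rw [zpow_add₀ two_ne_zero, zpow_natCast]
  linarith [(zpow_le_zpow_iff_right₀ (one_lt_two : (1 : ℝ) < 2)).1 hpow]

end Dyadic

section Levels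

variable {d : ℕ} {γ : ℝ → Fin d → ℝ} {a b : ℝ}

/-- The points of `[a, b]` at which the torsion of `γ` is of size about `2 ^ (-k)`. -/
def torsionLevel (γ : ℝ → Fin d → ℝ) (a b : ℝ) (k : ℤ) : Set ℝ :=
  {t ∈ Icc a b | torsion γ (Icc a b) t ∈ dyadic k}

/-- The points of `torsionLevel γ a b k` at which the leading Wronskians of the coordinates of
`γ'`, ordered by `σ`, have prescribed sizes; `lev j` is the level of the one of order `j + 1`. -/
def wronskianLevel (γ : ℝ → Fin d → ℝ) (a b : ℝ) (k : ℤ) (σ : Equiv.Perm (Fin d))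
    (lev : Fin d → ℤ) : Set ℝ :=
  {t ∈ torsionLevel γ a b k |
    ∀ j : Fin d, |wronskian (j + 1) (tangentCoord γ (Icc a b) σ) (Icc a b) t| ∈ dyadic (lev j)}

/-- Every torsion level splits into Wronskian levels which are at most `r` steps below it and at
least `-r`. -/
def LevelsWithin (γ : ℝ → Fin d → ℝ) (a b : ℝ) (r : ℕ) : Prop :=
  ∀ k : ℤ, torsionLevel γ a b k ⊆
    ⋃ x : Equiv.Perm (Fin d) × (Fin d → Finset.Icc (-r : ℤ) (k + r)),
      wronskianLevel γ a b k x.1 fun j => x.2 j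

theorem exists_abs_iteratedDerivWithin_le (hab : a < b) (hγ : ContDiffOn ℝ d γ (Icc a b)) :
    ∃ A : ℝ, 1 ≤ A ∧ ∀ t ∈ Icc a b, ∀ k i : Fin d,
      |iteratedDerivWithin (k + 1) γ (Icc a b) t i| ≤ A := by
  have hbound : ∀ k : Fin d, ∃ A : ℝ, ∀ t ∈ Icc a b,
      ‖iteratedDerivWithin (k + 1) γ (Icc a b) t‖ ≤ A := fun k =>
    isCompact_Icc.exists_bound_of_continuousOn
      (hγ.continuousOn_iteratedDerivWithin (by exact_mod_cast k.2) (uniqueDiffOn_Icc hab))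
  choose A hA using hbound
  obtain ⟨A', hA'⟩ := Finite.exists_le A
  exact ⟨max A' 1, le_max_right _ _, fun t ht k i => (norm_le_pi_norm _ i).trans <|
    (hA k t ht).trans <| (hA' k).trans <| le_max_left _ _⟩

theorem exists_perm_torsion_le (hab : a < b) (hγ : ContDiffOn ℝ d γ (Icc a b)) :
    ∃ K : ℝ, ∀ t ∈ Icc a b, ∃ σ : Equiv.Perm (Fin d), ∀ j ≤ d,
      |wronskian j (tangentCoord γ (Icc a b) σ) (Icc a b) t| ≤ K ∧
      torsion γ (Icc a b) t ≤
        K * |wronskian j (tangentCoord γ (Icc a b) σ) (Icc a b) t| := by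
  obtain ⟨A, hA1, hA⟩ := exists_abs_iteratedDerivWithin_le hab hγ
  refine ⟨max (d.factorial * A ^ d) ((d * A) ^ d), fun t ht => ?_⟩
  obtain ⟨σ, hσ⟩ := exists_perm_abs_det_le hA1
    (Matrix.of fun k : Fin d => iteratedDerivWithin (k + 1) γ (Icc a b) t) (hA t ht)
  refine ⟨σ, fun j hj => ?_⟩
  rw [wronskian, mixedDet_tangentCoord (uniqueDiffOn_Icc hab) hγ hj fun _ => ht]
  constructor
  · refine le_trans ?_ (le_max_left _ _)
    have hdet := Matrix.det_le (abv := AbsoluteValue.abs)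
      (A := Matrix.of fun k i : Fin j =>
        iteratedDerivWithin (k + 1) γ (Icc a b) t (σ (Fin.castLE hj i)))
      (x := A) fun k i => hA t ht (Fin.castLE hj k) _
    rw [Fintype.card_fin, nsmul_eq_mul] at hdet
    refine hdet.trans ?_
    gcongr
  · rw [torsion_eq_abs_det]
    exact (hσ j hj).trans (mul_le_mul_of_nonneg_right (le_max_right _ _) (abs_nonneg _))

theorem exists_levelsWithin (γ : ℝ → Fin d → ℝ) (hab : a < b) :
    ∃ r : ℕ, ContDiffOn ℝ d γ (Icc a b) → LevelsWithin γ a b r := by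
  by_cases hγ : ContDiffOn ℝ d γ (Icc a b)
  swap
  · exact ⟨0, fun h => absurd h hγ⟩
  obtain ⟨K, hK⟩ := exists_perm_torsion_le hab hγ
  obtain ⟨r, hr⟩ := pow_unbounded_of_one_lt (2 * K) (one_lt_two : (1 : ℝ) < 2)
  refine ⟨r, fun _ k t ⟨ht, htk⟩ => ?_⟩
  obtain ⟨σ, hσ⟩ := hK t ht
  have hpos : ∀ j : Fin d, 0 < |wronskian (j + 1) (tangentCoord γ (Icc a b) σ) (Icc a b) t| := by
    intro j
    refine abs_pos.2 fun hzero => ?_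
    have hle := (hσ (j + 1) j.2).2
    rw [hzero, abs_zero, mul_zero] at hle
    exact (pos_of_mem_dyadic htk).not_ge hle
  choose lev hlev using fun j => exists_mem_dyadic (hpos j)
  have hmem : ∀ j, lev j ∈ Finset.Icc (-r : ℤ) (k + r) := fun j => Finset.mem_Icc.2
    ⟨neg_le_of_mem_dyadic (hlev j) (by linarith [(hσ (j + 1) j.2).1]),
      le_add_of_mem_dyadic (hlev j) htk (hσ (j + 1) j.2).2 hr.le⟩
  exact mem_iUnion.2 ⟨(σ, fun j => ⟨lev j, hmem j⟩), ⟨ht, htk⟩, hlev⟩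

theorem LevelsWithin.neg_le {r : ℕ} {k : ℤ} (hr : LevelsWithin γ a b r) (hd : 1 ≤ d)
    (hk : (torsionLevel γ a b k).Nonempty) : -(2 * r : ℤ) ≤ k := by
  obtain ⟨t, ht⟩ := hk
  obtain ⟨⟨-, lev⟩, -⟩ := mem_iUnion.1 (hr k ht)
  have hlev := Finset.mem_Icc.1 (lev ⟨0, hd⟩).2
  linarith

theorem Icc_eq_torsion_eq_zero_union {ι : ℤ → Type*} {I : (k : ℤ) → ι k → Set ℝ} {k₀ : ℤ}
    (hk₀ : ∀ k, (torsionLevel γ a b k).Nonempty → k₀ ≤ k)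
    (hcover : ∀ k, k₀ ≤ k → torsionLevel γ a b k ⊆ ⋃ l, I k l)
    (hI : ∀ k, k₀ ≤ k → ∀ l, I k l ⊆ Icc a b) :
    Icc a b = {t ∈ Icc a b | torsion γ (Icc a b) t = 0} ∪ ⋃ (k : ℤ) (_ : k₀ ≤ k) (l), I k l := by
  refine Subset.antisymm (fun t ht => ?_) (union_subset (sep_subset _ _) ?_)
  · refine or_iff_not_imp_left.2 fun hne => ?_
    have hpos : 0 < torsion γ (Icc a b) t :=
      (abs_nonneg _).lt_of_ne fun h => hne ⟨ht, h.symm⟩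
    obtain ⟨k, hk⟩ := exists_mem_dyadic hpos
    have hk' := hk₀ k ⟨t, ht, hk⟩
    exact mem_iUnion₂.2 ⟨k, hk', hcover k hk' ⟨ht, hk⟩⟩
  · exact iUnion₂_subset fun k hk => iUnion_subset (hI k hk)

end Levels

/-! ### Counting the intervals of a level -/

/-- The exponent `∑_{j = 1}^d 1 / (N - j)` in the bound for the number of intervals. -/
noncomputable def countExponent (d : ℕ) (N : ℝ) : ℝ :=
  ∑ j ∈ Finset.Icc 1 d, 1 / (N - (j : ℝ))

section Exponent

variable {d : ℕ} {N : ℝ}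

theorem sub_pos_of_mem_Icc {j : ℕ} (hN : d < N) (hj : j ∈ Finset.Icc 1 d) : 0 < N - j :=
  sub_pos.2 ((Nat.cast_le.2 (Finset.mem_Icc.1 hj).2).trans_lt hN)

theorem countExponent_nonneg (hN : d < N) : 0 ≤ countExponent d N :=
  Finset.sum_nonneg fun _ hj => (one_div_pos.2 (sub_pos_of_mem_Icc hN hj)).le

theorem one_div_le_countExponent {j : ℕ} (hN : d < N) (hj : j ∈ Finset.Icc 1 d) :
    1 / (N - j) ≤ countExponent d N :=
  Finset.single_le_sum (f := fun j : ℕ => 1 / (N - (j : ℝ)))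
    (fun _ hj => (one_div_pos.2 (sub_pos_of_mem_Icc hN hj)).le) hj

theorem zpow_neg_rpow_neg_le {i m : ℤ} {p S : ℝ} (hp : 0 ≤ p) (hpS : p ≤ S) (him : i ≤ m)
    (hm : 0 ≤ m) : ((2 : ℝ) ^ (-i)) ^ (-p) ≤ 2 ^ (m * S) := by
  rw [← Real.rpow_intCast, ← Real.rpow_mul two_pos.le]
  refine Real.rpow_le_rpow_of_exponent_le one_le_two ?_
  have him' : (i : ℝ) ≤ m := by exact_mod_cast him
  have : (0 : ℝ) ≤ m := by exact_mod_cast hm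
  push_cast
  rw [neg_mul_neg]
  gcongr

end Exponent

section Cover

variable {d : ℕ} {γ : ℝ → Fin d → ℝ} {a b c C ε u v u' v' t N Q : ℝ} {k : ℤ} {r : ℕ}
  {σ : Equiv.Perm (Fin d)} {lev : Fin d → ℤ}

/-- The intervals of the decomposition: `[lo, hi] ⊆ [a, b]`, and the determinants of
`γ', …, γ^{(d)}` taken at arbitrary points of `[lo, hi]` have constant sign and absolute value in
`[c, C]`. -/
def GoodInterval (γ : ℝ → Fin d → ℝ) (a b c C lo hi : ℝ) : Prop :=
  a ≤ lo ∧ hi ≤ b ∧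
    MixedBound (fun k => iteratedDerivWithin (k + 1) γ (Icc a b)) (Icc lo hi) c C

theorem torsion_mem_Icc_of_tameOn {x y lam w : ℝ} {J : Set ℝ} {s : ℝ}
    (hab : a < b) (hγ : ContDiffOn ℝ d γ (Icc a b)) (hJ : J ⊆ Icc a b)
    (htame : TameOn 0 lam Q w (Icc a b) J (wronskian d (tangentCoord γ (Icc a b) σ) (Icc a b)))
    (ht : t ∈ Icc a b) (htk : torsion γ (Icc a b) t ∈ Icc x y)
    (htlam : |wronskian d (tangentCoord γ (Icc a b) σ) (Icc a b) t| ∈ Icc (lam / 2) lam)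
    (hs : s ∈ J) : torsion γ (Icc a b) s ∈ Icc (3 / 8 * x) (3 * y) := by
  have hI := uniqueDiffOn_Icc hab
  have hsJ := htame.1 s hs
  rw [abs_wronskian_tangentCoord hI hγ (hJ hs)] at hsJ
  rw [abs_wronskian_tangentCoord hI hγ ht] at htlam
  exact ⟨by linarith [hsJ.1, htlam.2, htk.1], by linarith [hsJ.2, htlam.1, htk.2]⟩

theorem goodInterval_of_tameOn (hd : 1 ≤ d) (hε : 0 ≤ ε) (hc : 0 ≤ c)
    (hcmp : MixedComparable d 4 ε c C) (hab : a < b) (hγ : ContDiffOn ℝ d γ (Icc a b))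
    (hW : ∀ j, 1 ≤ j → j ≤ d → ContDiffOn ℝ (d - j : ℕ)
      (wronskian j (tangentCoord γ (Icc a b) σ) (Icc a b)) (Icc a b))
    {R : ℝ} (hR : 1 ≤ R) (hQR : Q * (8 / 3) ≤ ε * R) (huv : u < v) (hsub : Icc u v ⊆ Icc a b)
    (htame : ∀ j : Fin d, TameOn (d - (j + 1)) (2 ^ (-lev j)) Q (v - u) (Icc a b) (Icc u v)
      (wronskian (j + 1) (tangentCoord γ (Icc a b) σ) (Icc a b)))
    (ht : t ∈ wronskianLevel γ a b k σ lev)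
    (hsub' : Icc u' v' ⊆ Icc u v) (hlen : v' - u' = (v - u) / R) :
    GoodInterval γ a b (c * (3 / 16 * 2 ^ (-k))) (C * (3 * 2 ^ (-k))) u' v' := by
  have hI := uniqueDiffOn_Icc hab
  have huv' : u' < v' := sub_pos.1 (hlen ▸ by have := sub_pos.2 huv; positivity)
  have hsubab := hsub'.trans hsub
  have hu' := left_mem_Icc.2 huv'.le
  have htame' (j : Fin d) := (htame j).mono (by positivity) le_rfl le_rfl hsub'
  have hslow : SlowFamily d 4 ε (v' - u') (Icc u' v') (tangentCoord γ (Icc a b) σ) := by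
    rw [hlen]
    refine slowFamily_of_tameOn hε hR hQR hsubab isPreconnected_Icc (uniqueDiffOn_Icc huv') hI
      (fun k _ => contDiffOn_tangentCoord hI hγ k) hW fun j hj1 hj => ?_
    obtain ⟨j, rfl⟩ := Nat.exists_eq_add_of_le' hj1
    exact ⟨_, by positivity, htame' ⟨j, hj⟩⟩
  obtain ⟨⟨htI, htk⟩, htlev⟩ := ht
  obtain ⟨n, rfl⟩ := Nat.exists_eq_add_of_le' hd
  have htorsion := torsion_mem_Icc_of_tameOn hab hγ hsubab
    ((htame' (Fin.last n)).mono (by positivity) (Nat.zero_le _) le_rfl subset_rfl) htI htk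
    (htlev (Fin.last n)) hu'
  rw [show (3 / 16 : ℝ) * 2 ^ (-k) = 3 / 8 * (2 ^ (-k) / 2) by ring]
  exact ⟨(hsubab hu').1, (hsubab (right_mem_Icc.2 huv'.le)).2,
    hcmp.mixedBound hc hab hγ huv' hsubab hslow hu' (by positivity) htorsion⟩

theorem holderClass_wronskian_of_isClassCN {j : ℕ} (hab : a < b) (hN : d < N)
    (hγN : IsClassCN N γ (Icc a b)) (σ : Equiv.Perm (Fin d)) (hj1 : 1 ≤ j) (hj : j ≤ d) :
    HolderClass (⌊N⌋₊ - j) (N - ⌊N⌋₊) (Icc a b)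
      (wronskian j (tangentCoord γ (Icc a b) σ) (Icc a b)) := by
  have hN0 : 0 ≤ N := (Nat.cast_nonneg d).trans hN.le
  exact holderClass_wronskian_tangentCoord (sub_nonneg.2 (Nat.floor_le hN0))
    (by linarith [Nat.lt_floor_add_one N]) hab
    (holderClass_apply hN0 (uniqueDiffOn_Icc hab) hγN) hj1 (hj.trans (Nat.le_floor hN.le))

theorem exists_breakpoints_wronskian (hd : 1 ≤ d) (hab : a < b) (hN : d < N)
    (hγN : IsClassCN N γ (Icc a b)) (r : ℕ) (σ : Equiv.Perm (Fin d)) :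
    ∃ K Q : ℝ, ∀ (k : ℤ) (lev : Fin d → Finset.Icc (-r : ℤ) (k + r)),
      ∃ Z : Finset ℝ, (Z.card : ℝ) + 1 ≤ K * 2 ^ (k * countExponent d N) ∧
      ∀ u v : ℝ, u < v → Icc u v ⊆ Icc a b → (∀ z ∈ Z, z ∉ Ioo u v) →
        (wronskianLevel γ a b k σ (fun j => lev j) ∩ Icc u v).Nonempty →
        ∀ j : Fin d, TameOn (d - (j + 1)) (2 ^ (-(lev j : ℤ))) Q (v - u) (Icc a b) (Icc u v)
          (wronskian (j + 1) (tangentCoord γ (Icc a b) σ) (Icc a b)) := by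
  have hdN : d ≤ ⌊N⌋₊ := Nat.le_floor hN.le
  have horder (j : Fin d) : ((⌊N⌋₊ - (j + 1) : ℕ) : ℝ) + (N - ⌊N⌋₊) = N - (j + 1 : ℕ) := by
    rw [Nat.cast_sub (by omega)]
    ring
  have hmem (j : Fin d) : (j + 1 : ℕ) ∈ Finset.Icc 1 d := Finset.mem_Icc.2 ⟨by omega, j.2⟩
  obtain ⟨K, Q, hK, hbreak⟩ := exists_common_breakpoints
    (sub_nonneg.2 (Nat.floor_le ((Nat.cast_nonneg d).trans hN.le)))
    (fun j => (horder j).symm ▸ sub_pos_of_mem_Icc hN (hmem j)) hab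
    (fun j : Fin d => holderClass_wronskian_of_isClassCN hab hN hγN σ (Nat.le_add_left 1 j) j.2)
    (2 ^ r)
  set S := countExponent d N
  refine ⟨(K * d + 1) * 2 ^ (2 * r * S), Q, fun k lev => ?_⟩
  have hlev (j : Fin d) := Finset.mem_Icc.1 (lev j).2
  have hlam (j : Fin d) : 0 < (2 : ℝ) ^ (-(lev j : ℤ)) ∧ (2 : ℝ) ^ (-(lev j : ℤ)) ≤ 2 ^ r := by
    refine ⟨by positivity, ?_⟩
    rw [← zpow_natCast]
    exact zpow_le_zpow_right₀ one_le_two (by linarith [(hlev j).1])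
  obtain ⟨Z, hZ, htame⟩ := hbreak _ hlam
  refine ⟨Z, ?_, fun u v huv hsub havoid ⟨t, ht, htuv⟩ j =>
    (htame u v huv hsub havoid ⟨t, htuv, ht.2⟩ j).mono (by positivity) (by omega) le_rfl subset_rfl⟩
  have hk : 0 ≤ k + 2 * r := by linarith [hlev ⟨0, hd⟩]
  have hterm (j : Fin d) : ((2 : ℝ) ^ (-(lev j : ℤ))) ^
      (-(1 / (((⌊N⌋₊ - (j + 1) : ℕ) : ℝ) + (N - ⌊N⌋₊)))) ≤ 2 ^ ((k + 2 * r : ℤ) * S) := by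
    rw [horder]
    exact zpow_neg_rpow_neg_le (one_div_pos.2 (sub_pos_of_mem_Icc hN (hmem j))).le
      (one_div_le_countExponent hN (hmem j)) (by linarith [(hlev j).2]) hk
  have hone : (1 : ℝ) ≤ 2 ^ ((k + 2 * r : ℤ) * S) := Real.one_le_rpow one_le_two
    (mul_nonneg (by exact_mod_cast hk) (countExponent_nonneg hN))
  calc (Z.card : ℝ) + 1 ≤ K * ∑ _j : Fin d, 2 ^ ((k + 2 * r : ℤ) * S)
        + 2 ^ ((k + 2 * r : ℤ) * S) := by
        gcongr
        exact hZ.trans (by gcongr with j; exact hterm j)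
    _ = (K * d + 1) * 2 ^ ((k + 2 * r : ℤ) * S) := by simp; ring
    _ = (K * d + 1) * 2 ^ (2 * r * S) * 2 ^ (k * S) := by
        rw [mul_assoc, ← Real.rpow_add two_pos]
        push_cast
        ring_nf

theorem exists_cover_wronskianLevel (hd : 1 ≤ d) (hε : 0 < ε) (hc : 0 ≤ c)
    (hcmp : MixedComparable d 4 ε c C) (hab : a < b) (hN : d < N) (hγN : IsClassCN N γ (Icc a b))
    (r : ℕ) (σ : Equiv.Perm (Fin d)) :
    ∃ K : ℝ, 0 < K ∧ ∀ (k : ℤ) (lev : Fin d → Finset.Icc (-r : ℤ) (k + r)),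
      HasCover (GoodInterval γ a b (c * (3 / 16 * 2 ^ (-k))) (C * (3 * 2 ^ (-k))))
        (wronskianLevel γ a b k σ fun j => lev j) (K * 2 ^ (k * countExponent d N)) K := by
  have hγ : ContDiffOn ℝ d γ (Icc a b) := hγN.1.of_le (by exact_mod_cast Nat.le_floor hN.le)
  have hW (j : ℕ) (hj1 : 1 ≤ j) (hj : j ≤ d) : ContDiffOn ℝ (d - j : ℕ)
      (wronskian j (tangentCoord γ (Icc a b) σ) (Icc a b)) (Icc a b) :=
    (holderClass_wronskian_of_isClassCN hab hN hγN σ hj1 hj).1.of_le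
      (by exact_mod_cast Nat.sub_le_sub_right (Nat.le_floor hN.le) j)
  obtain ⟨K, Q, hbreak⟩ := exists_breakpoints_wronskian hd hab hN hγN r σ
  obtain ⟨R, hR⟩ := exists_nat_gt (max 1 (Q * (8 / 3) / ε))
  have hR1 : (1 : ℝ) ≤ R := (le_max_left _ _).trans hR.le
  have hQR : Q * (8 / 3) ≤ ε * R := (div_le_iff₀' hε).1 ((le_max_right _ _).trans hR.le)
  have hba := sub_pos.2 hab
  refine ⟨max (K * R) (b - a), lt_max_of_lt_right hba, fun k lev => ?_⟩
  obtain ⟨Z, hZ, htame⟩ := hbreak k lev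
  refine (HasCover.of_cells (X := R) (Z := Z) hab fun u v huv hsub havoid => ?_).mono
    (fun t ht => ⟨ht, ht.1.1⟩) ?_ (le_max_right _ _)
  · rcases eq_empty_or_nonempty (wronskianLevel γ a b k σ (fun j => lev j) ∩ Icc u v) with
      hempty | hne
    · exact (HasCover.of_eq_empty hempty).mono subset_rfl (by positivity) (sub_pos.2 huv).le
    · have ⟨t, ht, _⟩ := hne
      refine (HasCover.of_subdivision (R := R) (by rintro rfl; norm_num at hR1) huv.le
        fun u' v' hsub' hlen => ?_).mono inter_subset_right le_rfl le_rfl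
      exact goodInterval_of_tameOn hd hε.le hc hcmp hab hγ hW hR1 hQR huv hsub
        (htame u v huv hsub havoid hne) ht hsub' hlen
  · calc ((Z.card : ℝ) + 1) * R ≤ K * 2 ^ (k * countExponent d N) * R := by gcongr
      _ = K * R * 2 ^ (k * countExponent d N) := by ring
      _ ≤ max (K * R) (b - a) * 2 ^ (k * countExponent d N) := by
        gcongr
        exact le_max_left _ _

theorem exists_cover_torsionLevel (hd : 1 ≤ d) (hε : 0 < ε) (hc : 0 ≤ c)
    (hcmp : MixedComparable d 4 ε c C) (hab : a < b) (hr : LevelsWithin γ a b r) (hN : d < N)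
    (hγN : IsClassCN N γ (Icc a b)) :
    ∃ K : ℝ, 0 < K ∧ ∀ k : ℤ, -(2 * r : ℤ) ≤ k →
      HasCover (GoodInterval γ a b (c * (3 / 16 * 2 ^ (-k))) (C * (3 * 2 ^ (-k))))
        (torsionLevel γ a b k) (K * (k + (2 * r + 1)) ^ d * 2 ^ (k * countExponent d N))
        (K * (k + (2 * r + 1)) ^ d) := by
  choose K hK hcover using exists_cover_wronskianLevel hd hε hc hcmp hab hN hγN r
  obtain ⟨K', hK'⟩ := Finite.exists_le K
  have hK'0 : 0 < K' := (hK 1).trans_le (hK' 1)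
  refine ⟨d.factorial * K', by positivity, fun k hk => ?_⟩
  have hcard : (Fintype.card (Equiv.Perm (Fin d) × (Fin d → Finset.Icc (-r : ℤ) (k + r))) : ℝ) =
      d.factorial * (k + (2 * r + 1)) ^ d := by
    have hsteps : (((k + r + 1 + r).toNat : ℕ) : ℝ) = k + (2 * r + 1) := by
      rw [← Int.cast_natCast, Int.toNat_of_nonneg (by linarith)]
      push_cast
      ring
    simp [Fintype.card_perm, hsteps]
  have hunion := HasCover.iUnion fun x : Equiv.Perm (Fin d) ×
    (Fin d → Finset.Icc (-r : ℤ) (k + r)) => (hcover x.1 k x.2).mono subset_rfl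
      (mul_le_mul_of_nonneg_right (hK' x.1) (by positivity)) (hK' x.1)
  rw [hcard] at hunion
  exact hunion.mono (hr k) (by ring_nf; rfl) (by ring_nf; rfl)

end Cover

section Offspring

variable {d m : ℕ} {γ : ℝ → Fin d → ℝ} {a b c C lo hi : ℝ} {h : Fin (m + 1) → ℝ}

theorem one_le_prod_factorial (d : ℕ) : 1 ≤ ∏ k : Fin d, ((k : ℕ).factorial : ℝ) :=
  Finset.one_le_prod fun _ _ => mod_cast Nat.factorial_pos _

theorem GoodInterval.offspring_estimates (hI : GoodInterval γ a b c C lo hi) (hd : 1 ≤ d)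
    (hc : 0 < c) (hγ : ContDiffOn ℝ d γ (Icc a b)) (hh : Monotone h)
    (hlt : h (Fin.last m) - h 0 < b - a) :
    (∀ t ∈ shiftInterval lo hi h,
      c / ∏ k : Fin d, ((k : ℕ).factorial : ℝ) ≤
        torsion (offspring γ h) (shiftInterval a b h) t ∧
      torsion (offspring γ h) (shiftInterval a b h) t ≤ C) ∧
    InjOn (sumMap (offspring γ h)) {t | StrictMono t ∧ ∀ i, t i ∈ shiftInterval lo hi h} ∧
    ∀ t : Fin d → ℝ, (∀ i, t i ∈ shiftInterval lo hi h) →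
      c / (∏ k : Fin d, ((k : ℕ).factorial : ℝ)) * |(Matrix.vandermonde t).det| ≤
        |jacobianSumMap (offspring γ h) (shiftInterval a b h) t| := by
  obtain ⟨hlo, hhi, hG⟩ := hI
  refine ⟨fun t ht => ?_, injOn_sumMap_offspring hd hγ hlo hhi hG hc hh hlt, fun t ht => ?_⟩
  · have htorsion := torsion_offspring_mem_Icc hγ hlo hhi hG hc.le hh hlt ht
    exact ⟨(div_le_self hc.le (one_le_prod_factorial d)).trans htorsion.1, htorsion.2⟩
  · exact div_mul_abs_vandermonde_le_jacobianSumMap_offspring hd hγ hlo hhi hG hh hlt ht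

end Offspring

end TorsionDecomp

theorem theorem2p2 (d : ℕ) (hd : 1 ≤ d) (a b : ℝ) (hab : a < b) :
    -- constants that depend on `d` and `[a, b]` only
    ∃ c C : ℝ, 0 < c ∧ 0 < C ∧
    ∀ γ : ℝ → Fin d → ℝ,
    -- constants that depend on `γ` (and `d`, `[a, b]`) but not on `N`
    ∃ (k₀ : ℤ) (Cγ : ℝ), 0 < (k₀ : ℝ) + Cγ ∧
    ∀ N : ℝ, (d : ℝ) < N → IsClassCN N γ (Set.Icc a b) →
    ∃ (CNγ : ℝ) (n : ℤ → ℕ) (lo hi : (k : ℤ) → Fin (n k) → ℝ),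
      0 < CNγ ∧
      (∀ k, k₀ ≤ k → ∀ l, lo k l ≤ hi k l) ∧
      (Set.Icc a b = {t ∈ Set.Icc a b | torsion γ (Set.Icc a b) t = 0} ∪
        ⋃ (k : ℤ) (_ : k₀ ≤ k) (l : Fin (n k)), Set.Icc (lo k l) (hi k l)) ∧
      (∀ k, k₀ ≤ k → ∀ l : Fin (n k), ∀ (m : ℕ) (h : Fin (m + 1) → ℝ), Monotone h →
        -- the domain `[a, b]_h` of `γ_h` is an interval with more than one point
        h (Fin.last m) - h 0 < b - a →
        (∀ t ∈ shiftInterval (lo k l) (hi k l) h,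
          c * (2 : ℝ) ^ (-k) ≤ torsion (offspring γ h) (shiftInterval a b h) t ∧
          torsion (offspring γ h) (shiftInterval a b h) t ≤ C * (2 : ℝ) ^ (-k)) ∧
        Set.InjOn (sumMap (offspring γ h))
          {t | StrictMono t ∧ ∀ i, t i ∈ shiftInterval (lo k l) (hi k l) h} ∧
        (∀ t : Fin d → ℝ, (∀ i, t i ∈ shiftInterval (lo k l) (hi k l) h) →
          c * (2 : ℝ) ^ (-k) * |(Matrix.vandermonde t).det| ≤
            |jacobianSumMap (offspring γ h) (shiftInterval a b h) t|)) ∧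
      (∀ k, k₀ ≤ k → (n k : ℝ) ≤
        CNγ * ((k : ℝ) + Cγ) ^ d *
          (2 : ℝ) ^ ((k : ℝ) * ∑ j ∈ Finset.Icc 1 d, 1 / (N - (j : ℝ)))) ∧
      (∀ k, k₀ ≤ k → ∑ l, (hi k l - lo k l) ≤ CNγ * ((k : ℝ) + Cγ) ^ d) := by
  open TorsionDecomp in
  obtain ⟨ε, c, C, hε, hc, hC, hcmp⟩ := exists_mixedComparable d (by norm_num : (1 : ℝ) ≤ 4)
  refine ⟨c * (3 / 16) / ∏ k : Fin d, ((k : ℕ).factorial : ℝ), C * 3, by positivity, by positivity,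
    fun γ => ?_⟩
  obtain ⟨r, hr⟩ := exists_levelsWithin γ hab
  refine ⟨-(2 * r), 2 * r + 1, by push_cast; linarith, fun N hN hγN => ?_⟩
  have hγ : ContDiffOn ℝ d γ (Set.Icc a b) := hγN.1.of_le (by exact_mod_cast Nat.le_floor hN.le)
  obtain ⟨K, hK, hcover⟩ := exists_cover_torsionLevel hd hε hc.le hcmp hab (hr hγ) hN hγN
  choose! n lo hi hgood hsub hcard hlength using hcover
  refine ⟨K, n, lo, hi, hK, fun k hk l => (hgood k hk l).1, ?_, fun k hk l m h hh hlt => ?_,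
    hcard, hlength⟩
  · exact Icc_eq_torsion_eq_zero_union (fun k => (hr hγ).neg_le hd) hsub fun k hk l =>
      Set.Icc_subset_Icc (hgood k hk l).2.1 (hgood k hk l).2.2.1
  · rw [mul_assoc C, div_mul_eq_mul_div, mul_assoc c]
    exact (hgood k hk l).2.offspring_estimates hd (by positivity) hγ hh hlt
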